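/- Let $m>0$. For $s,\sigma\in\mathbb R$ let $H^s_\sigma$ be the space of complex tempered distributions $\psi$ on $\mathbb R^3$ with finite norm $\|\psi\|_{H^s_\sigma}=\|\langle x\rangle^{\sigma}\langle\nabla\rangle^{s}\psi\|_{L^2(\mathbb R^3)}$, where $\langle x\rangle=(1+|x|^2)^{1/2}$ and $\langle\nabla\rangle^s=(1-\Delta)^{s/2}$. Let $\mathcal F_\sigma=H^1_\sigma\oplus H^0_\sigma$, with the norm $\|\Psi\|_{\mathcal F_\sigma}=\|\psi\|_{H^1_\sigma}+\|\pi\|_{H^0_\sigma}$ for $\Psi=(\psi,\pi)$. For every $\Psi_0\in\mathcal F_0$ the free Klein–Gordon equation $$ i\dot\Psi(t)=\mathcal H_0\Psi(t),\qquad \mathcal H_0=\begin{pmatrix}0&i\\ i(\Delta-m^2)&0\end{pmatrix},\qquad t\in\mathbb R, $$ understood in the sense of tempered distributions on $\mathbb R^3$ for each $t$, has a unique solution $\Psi\in C(\mathbb R;\mathcal F_0)$ with $\Psi(0)=\Psi_0$. Let $\mathcal U_0(t)\Psi_0=\Psi(t)$ denote the corresponding dynamical group on $\mathcal F_0$. Let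 $\sigma>3/2$. Then $\mathcal F_\sigma\subset\mathcal F_0$, and there is a constant $C>0$, depending only on $m$ and $\sigma$, such that for all $\Psi_0\in\mathcal F_\sigma$ and all $t\in\mathbb R$ $$ \|\mathcal U_0(t)\Psi_0\|_{\mathcal F_{-\sigma}}\le \frac{C}{(1+|t|)^{3/2}}\,\|\Psi_0\|_{\mathcal F_\sigma}. $$ -/

import Mathlib

open scoped ENNReal

noncomputable section

namespace KleinGordon

open MeasureTheory TemperedDistribution Filter
open scoped SchwartzMap Laplacian Topology

/-- Three-dimensional Euclidean space. -/
abbrev R3 : Type := EuclideanSpace ℝ (Fin 3)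

/-- Complex tempered distributions on `ℝ³`. -/
abbrev Dist : Type := 𝓢'(R3, ℂ)

/-- The weight `⟨x⟩ ^ σ`, where `⟨x⟩ = (1 + |x|²) ^ (1/2)`. -/
def weight (σ : ℝ) (x : R3) : ℂ := (((1 + ‖x‖ ^ 2) ^ (σ / 2) : ℝ) : ℂ)

/-- The symbol of `⟨∇⟩ ^ s = (1 - Δ) ^ (s / 2)`. With the normalization `e ^ (-2πi x·ξ)` of the
Fourier transform used in Mathlib, `-Δ` has the symbol `|2πξ|²`. -/
def besselSymbol (s : ℝ) (ξ : R3) : ℂ :=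
  (((1 + ‖(2 * Real.pi) • ξ‖ ^ 2) ^ (s / 2) : ℝ) : ℂ)

theorem hasTemperateGrowth_weight (σ : ℝ) : (weight σ).HasTemperateGrowth := by
  unfold weight
  fun_prop

theorem hasTemperateGrowth_besselSymbol (s : ℝ) : (besselSymbol s).HasTemperateGrowth :=
  (hasTemperateGrowth_weight s).comp
    (((2 * Real.pi) • ContinuousLinearMap.id ℝ R3).hasTemperateGrowth)

/-- The operator `⟨x⟩ ^ σ ⟨∇⟩ ^ s` on tempered distributions. -/
def weightedBessel (s σ : ℝ) : Dist →L[ℂ] Dist :=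
  smulLeftCLM ℂ (weight σ) ∘L fourierMultiplierCLM ℂ (besselSymbol s)

/-- The norm `‖ψ‖_{H^s_σ} = ‖⟨x⟩ ^ σ ⟨∇⟩ ^ s ψ‖_{L²}` of a tempered distribution, with the value
`∞` if `⟨x⟩ ^ σ ⟨∇⟩ ^ s ψ` is not in `L²`. The infimum runs over the `L²` functions that represent
`⟨x⟩ ^ σ ⟨∇⟩ ^ s ψ`; there is at most one. -/
def sobolevNorm (s σ : ℝ) (ψ : Dist) : ℝ≥0∞ :=
  ⨅ (g : Lp ℂ 2 (volume : Measure R3)) (_ : weightedBessel s σ ψ = (g : Dist)), ‖g‖ₑ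

theorem sobolevNorm_eq {s σ : ℝ} {ψ : Dist} {g : Lp ℂ 2 (volume : Measure R3)}
    (h : weightedBessel s σ ψ = (g : Dist)) : sobolevNorm s σ ψ = ‖g‖ₑ := by
  refine le_antisymm (iInf₂_le g h) (le_iInf₂ fun g' h' => ?_)
  have hinj : Function.Injective (Lp.toTemperedDistributionCLM ℂ (volume : Measure R3) 2) :=
    LinearMap.ker_eq_bot.mp Lp.ker_toTemperedDistributionCLM_eq_bot
  have : g = g' := hinj (by simpa using h.symm.trans h')
  rw [this]

/-- Pairs `Ψ = (ψ, π)` of tempered distributions. -/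
abbrev Phase : Type := Dist × Dist

/-- The norm `‖Ψ‖_{𝓕_σ} = ‖ψ‖_{H^1_σ} + ‖π‖_{H^0_σ}`, with values in `[0, ∞]`. -/
def energyNorm (σ : ℝ) (Ψ : Phase) : ℝ≥0∞ :=
  sobolevNorm 1 σ Ψ.1 + sobolevNorm 0 σ Ψ.2

/-- The weighted energy space `𝓕_σ = H^1_σ ⊕ H^0_σ`: the pairs of finite norm. -/
def energySpace (σ : ℝ) : Set Phase := {Ψ | energyNorm σ Ψ < ∞}

/-- The operator `𝓗₀ = ((0, i), (i(Δ - m²), 0))`. -/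
def freeHamiltonian (m : ℝ) (Ψ : Phase) : Phase :=
  (Complex.I • Ψ.2, Complex.I • (Δ Ψ.1 - ((m : ℂ) ^ 2) • Ψ.1))

/-- `Ψ ∈ C(ℝ, 𝓕_0)` is a solution of the free Klein-Gordon equation `i Ψ' = 𝓗₀ Ψ`, the equation
being understood in the sense of tempered distributions on `ℝ³` for every time `t`. -/
structure IsFreeSolution (m : ℝ) (Ψ : ℝ → Phase) : Prop where
  mem : ∀ t, Ψ t ∈ energySpace 0
  continuous : ∀ t, Tendsto (fun s => energyNorm 0 (Ψ s - Ψ t)) (𝓝 t) (𝓝 0)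
  equation_fst : ∀ (t : ℝ) (φ : 𝓢(R3, ℂ)),
    HasDerivAt (fun s => (Ψ s).1 φ) (-Complex.I * (freeHamiltonian m (Ψ t)).1 φ) t
  equation_snd : ∀ (t : ℝ) (φ : 𝓢(R3, ℂ)),
    HasDerivAt (fun s => (Ψ s).2 φ) (-Complex.I * (freeHamiltonian m (Ψ t)).2 φ) t

end KleinGordon

end

open scoped ENNReal

noncomputable section

namespace KleinGordon

open MeasureTheory TemperedDistribution Filter
open scoped SchwartzMap Laplacian Topology FourierTransform

open scoped ComplexInnerProductSpace

/-! In Fourier variables the solution is `propagator`, with the symbols cos(tω), ω⁻¹ sin(tω) and -ω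
sin(tω), where ω = (m² + |2πξ|²)^(1/2). It is the only solution: the pairing of a solution at time s
with the transposed propagator over the time T - s does not depend on s
(`IsFreeSolution.eq_propagator`). Let ω₁ be ω for mass 1, the symbol of ⟨∇⟩. Conjugation with ⟨∇⟩
turns the energy norms into L² norms and the two sine symbols into (ω₁/ω) sin(tω) and -(ω/ω₁)
sin(tω). All amplitudes are now functions α(ω) with bounded derivatives. By duality and Euler's
formula it remains to bound ⟨x⟩^(-σ) exp(itω) α(ω) ⟨x⟩^(-σ) on L² by a multiple of (1 + |t|)^(-3/2),
which is `norm_form_decay`.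

Pointwise dispersion at the rate t^(-3/2) requires decay of the amplitude in ω. Where that fails,
the group velocity v stays away from zero, and the spatial weights give decay instead. As |v|² = 1 -
m²/ω², the two regimes are separated by the identity 1 = R³ + |v|⁴(1 + R + R²) with R = 1 - |v|⁴.

Low frequencies: R = O(ω⁻²), so the amplitude α R³ is O(ω⁻⁶). Its kernel at z is bounded by t^(-3/2)
uniformly in z (`norm_kernel_le`): integration over the planes orthogonal to z gives t⁻¹, and a van
der Corput estimate along z gives t^(-1/2) (`norm_integral_oscillatory_le`). For σ > 3/2 the weight
⟨x⟩^(-σ) maps L² to L¹, which suffices for a bounded kernel.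

High frequencies: the factor |v|⁴ compensates for the stationary point ξ = 0 and permits two
integrations by parts against exp(itω) (`norm_form_velocity_sq_le`). Each gains t⁻¹ and costs at
most one factor |x|. Truncation of the weighted functions at |x| ~ |t| converts this into |t|^(-σ)
for 1 ≤ σ ≤ 2 (`norm_form_high_le`); larger σ follow from σ = 2. -/

/-! ### Duality for `L²` and Sobolev norms -/

/-- The `L²` norm of a Schwartz function. -/
def l2norm (φ : 𝓢(R3, ℂ)) : ℝ := ‖φ.toLp 2 (volume : Measure R3)‖

theorem l2norm_nonneg (φ : 𝓢(R3, ℂ)) : 0 ≤ l2norm φ := norm_nonneg _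

theorem l2norm_eq (φ : 𝓢(R3, ℂ)) : l2norm φ = (eLpNorm φ 2 (volume : Measure R3)).toReal :=
  SchwartzMap.norm_toLp

theorem ofReal_l2norm (φ : 𝓢(R3, ℂ)) :
    ENNReal.ofReal (l2norm φ) = eLpNorm φ 2 (volume : Measure R3) := by
  rw [l2norm_eq, ENNReal.ofReal_toReal (φ.memLp 2 (volume : Measure R3)).eLpNorm_ne_top]

theorem l2norm_le_mul {f g : 𝓢(R3, ℂ)} {K : ℝ} (h : ∀ x, ‖f x‖ ≤ K * ‖g x‖) :
    l2norm f ≤ K * l2norm g := by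
  refine (Lp.norm_le_mul_norm_of_ae_le_mul ?_)
  filter_upwards [f.coeFn_toLp 2 (volume : Measure R3), g.coeFn_toLp 2 (volume : Measure R3)]
    with x hf hg
  rw [hf, hg]; exact h x

theorem l2norm_fourier (f : 𝓢(R3, ℂ)) : l2norm (𝓕 f) = l2norm f :=
  SchwartzMap.norm_fourier_toL2_eq f

theorem l2norm_fourierInv (f : 𝓢(R3, ℂ)) : l2norm (𝓕⁻ f) = l2norm f := by
  rw [← l2norm_fourier, FourierTransform.fourier_fourierInv_eq]

theorem enorm_integral_mul_le {f g : R3 → ℂ} (hf : AEStronglyMeasurable f)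
    (hg : AEStronglyMeasurable g) :
    ‖∫ x, f x * g x‖ₑ ≤ eLpNorm f 2 volume * eLpNorm g 2 volume := by
  refine (enorm_integral_le_lintegral_enorm _).trans ?_
  rw [← eLpNorm_one_eq_lintegral_enorm]
  have h := eLpNorm_smul_le_mul_eLpNorm (p := 2) (q := 2) (r := 1) (μ := (volume : Measure R3)) hg hf
  have e : (f • g) = fun x => f x * g x := rfl
  rwa [e] at h

theorem norm_toTemperedDistribution_apply_le (g : Lp ℂ 2 (volume : Measure R3))
    (φ : 𝓢(R3, ℂ)) : ‖(g : Dist) φ‖ ≤ ‖g‖ * l2norm φ := by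
  have := enorm_integral_mul_le (φ.continuous.aestronglyMeasurable (μ := volume))
    (Lp.aestronglyMeasurable g)
  rw [Lp.toTemperedDistribution_apply]
  rw [← ofReal_l2norm, ← Lp.enorm_def, ← ofReal_norm, ← ofReal_norm,
    ← ENNReal.ofReal_mul (l2norm_nonneg _)] at this
  have h2 := (ENNReal.ofReal_le_ofReal_iff (mul_nonneg (l2norm_nonneg _) (norm_nonneg _))).1 this
  simpa [mul_comm] using h2

/-- A tempered distribution that is bounded for the `L²` norm is an `L²` function. -/
theorem exists_eq_toTemperedDistribution {u : Dist} {C : ℝ} (hC : 0 ≤ C)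
    (h : ∀ φ, ‖u φ‖ ≤ C * l2norm φ) :
    ∃ g : Lp ℂ 2 (volume : Measure R3), u = (g : Dist) ∧ ‖g‖ ≤ C := by
  let e : 𝓢(R3, ℂ) →ₗ[ℂ] Lp ℂ 2 (volume : Measure R3) :=
    (SchwartzMap.toLpCLM ℂ ℂ 2 (volume : Measure R3)).toLinearMap
  let f : 𝓢(R3, ℂ) →ₗ[ℂ] ℂ :=
    { toFun := fun φ => u φ, map_add' := fun a b => map_add u a b,
      map_smul' := fun a b => map_smul u a b }
  have hd : DenseRange e := SchwartzMap.denseRange_toLpCLM (p := 2) ENNReal.ofNat_ne_top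
  have hn : ∀ φ, ‖f φ‖ ≤ C * ‖e φ‖ := h
  set L := f.extendOfNorm e
  have hL : ∀ φ, L (e φ) = u φ := fun φ => LinearMap.extendOfNorm_eq hd ⟨C, hn⟩ φ
  have hLn : ‖L‖ ≤ C :=
    ContinuousLinearMap.opNorm_le_bound _ hC (LinearMap.norm_extendOfNorm_apply_le hd C hn)
  set k := (InnerProductSpace.toDual ℂ (Lp ℂ 2 (volume : Measure R3))).symm L
  -- The distribution of a function g integrates φ g without conjugation, while the inner product
  -- conjugates the Riesz vector; hence the conjugate of k.
  refine ⟨star k, ?_, ?_⟩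
  · ext φ
    rw [← hL, ← InnerProductSpace.toDual_symm_apply, Lp.toTemperedDistribution_apply,
      L2.inner_def]
    apply integral_congr_ae
    filter_upwards [φ.coeFn_toLp 2 (volume : Measure R3), Lp.coeFn_star k] with x h1 h2
    rw [h2]
    simp only [RCLike.inner_apply, Pi.star_apply, smul_eq_mul]
    change (SchwartzMap.toLp φ 2 volume : R3 → ℂ) x * _ = _
    rw [h1]; rfl
  · have : ‖star k‖ = ‖k‖ := by
      have h2 : eLpNorm (star k : Lp ℂ 2 (volume : Measure R3)) 2 volume = eLpNorm k 2 volume := by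
        refine eLpNorm_congr_norm_ae ?_
        filter_upwards [Lp.coeFn_star k] with x hx
        rw [hx, Pi.star_apply, norm_star]
      rw [Lp.norm_def, Lp.norm_def, h2]
    rw [this]
    exact ((InnerProductSpace.toDual ℂ (Lp ℂ 2 (volume : Measure R3))).symm.norm_map L).trans_le hLn

theorem toTemperedDistribution_injective : Function.Injective
    (Lp.toTemperedDistributionCLM ℂ (volume : Measure R3) 2) :=
  LinearMap.ker_eq_bot.mp Lp.ker_toTemperedDistributionCLM_eq_bot

/-- The `L²` norm of a Schwartz function by duality. -/
theorem l2norm_le_of_forall {ψ : 𝓢(R3, ℂ)} {C : ℝ} (hC : 0 ≤ C)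
    (h : ∀ χ : 𝓢(R3, ℂ), ‖∫ x, χ x * ψ x‖ ≤ C * l2norm χ) : l2norm ψ ≤ C := by
  obtain ⟨g, hg, hgC⟩ := exists_eq_toTemperedDistribution
    (u := (ψ.toLp 2 (volume : Measure R3) : Dist)) hC (by
      intro φ
      rw [Lp.toTemperedDistribution_toLp_eq]
      simpa using h φ)
  have : ψ.toLp 2 (volume : Measure R3) = g := toTemperedDistribution_injective (by simpa using hg)
  rw [l2norm, this]; exact hgC

/-- All later norm bounds enter through this test against Schwartz functions: an L² representative
need not be exhibited, since Riesz representation supplies it. -/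
theorem sobolevNorm_le_of_forall {s σ : ℝ} {u : Dist} {C : ℝ} (hC : 0 ≤ C)
    (h : ∀ φ, ‖weightedBessel s σ u φ‖ ≤ C * l2norm φ) :
    sobolevNorm s σ u ≤ ENNReal.ofReal C := by
  obtain ⟨g, hg, hgC⟩ := exists_eq_toTemperedDistribution hC h
  rw [sobolevNorm_eq hg, ← ofReal_norm]
  exact ENNReal.ofReal_le_ofReal hgC

theorem exists_eq_of_sobolevNorm_lt_top {s σ : ℝ} {u : Dist} (h : sobolevNorm s σ u < ∞) :
    ∃ g : Lp ℂ 2 (volume : Measure R3), weightedBessel s σ u = (g : Dist) ∧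
      sobolevNorm s σ u = ‖g‖ₑ := by
  by_contra! hcon
  have : ∀ g : Lp ℂ 2 (volume : Measure R3), weightedBessel s σ u ≠ (g : Dist) :=
    fun g hg => hcon g hg (sobolevNorm_eq hg)
  simp [sobolevNorm, this] at h

/-! ### The one-dimensional dispersion relation -/

/-- The dispersion relation `κ ↦ (m² + κ²) ^ (1/2)`. -/
def disp (m κ : ℝ) : ℝ := √(m ^ 2 + κ ^ 2)

section Dispersion

variable {m : ℝ}

theorem disp_pos (hm : 0 < m) (κ : ℝ) : 0 < disp m κ := Real.sqrt_pos.2 (by positivity)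

theorem sq_disp (m κ : ℝ) : disp m κ ^ 2 = m ^ 2 + κ ^ 2 := Real.sq_sqrt (by positivity)

theorem le_disp (m κ : ℝ) : m ≤ disp m κ := Real.le_sqrt_of_sq_le (by nlinarith)

theorem abs_le_disp (m κ : ℝ) : |κ| ≤ disp m κ := Real.abs_le_sqrt (by nlinarith)

theorem continuous_disp (m : ℝ) : Continuous (disp m) := by unfold disp; fun_prop

theorem hasDerivAt_disp (hm : 0 < m) (κ : ℝ) : HasDerivAt (disp m) (κ / disp m κ) κ := by
  have h := (((hasDerivAt_id κ).pow 2).const_add (m ^ 2)).sqrt (by simp; positivity)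
  refine h.congr_deriv ?_
  have h0 : √(m ^ 2 + κ ^ 2) ≠ 0 := (disp_pos hm κ).ne'
  simp only [id, disp, Pi.pow_apply]
  field_simp
  simp

/-- The numerator collapses by ω² - κ² = m². Strict positivity of this second derivative of ω is the
nondegeneracy behind the rate t^(-1/2). -/
theorem hasDerivAt_velocity (hm : 0 < m) (κ : ℝ) :
    HasDerivAt (fun κ => κ / disp m κ) (m ^ 2 / disp m κ ^ 3) κ := by
  have hp := disp_pos hm κ
  refine ((hasDerivAt_id κ).div (hasDerivAt_disp hm κ) hp.ne').congr_deriv ?_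
  have := sq_disp m κ
  simp only [id]
  field_simp
  linarith

theorem hasDerivAt_curvature (hm : 0 < m) (κ : ℝ) :
    HasDerivAt (fun κ => m ^ 2 / disp m κ ^ 3) (-3 * m ^ 2 * κ / disp m κ ^ 5) κ := by
  have hp := disp_pos hm κ
  refine ((hasDerivAt_const κ (m ^ 2)).div ((hasDerivAt_disp hm κ).pow 3)
    (by simp; positivity)).congr_deriv ?_
  simp only [Pi.pow_apply]
  field_simp
  push_cast
  ring

end Dispersion

/-! ### Van der Corput's estimate -/

section Oscillatory

/-- Pointwise bounds for the remainder of the integration by parts in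
`norm_integral_oscillatory_le`. -/
theorem norm_remainder_le {m : ℝ} (hm : 0 < m) {K w p s s' p' b b' : ℝ} (hK : 0 ≤ K) (hw : m ≤ w)
    (hs : s = m ^ 2 / w ^ 3) (hs' : |s'| ≤ 3 * m ^ 2 / w ^ 4) (hp' : 0 ≤ p')
    (hb : |b| ≤ K / w ^ 5) (hb' : |b'| ≤ K / w ^ 5) :
    ‖(b' * p / (s + Complex.I * p ^ 2) -
        b * p * (s' + 2 * Complex.I * p * p') / (s + Complex.I * p ^ 2) ^ 2 : ℂ)‖ ≤
      K * (1 / m ^ 3 + 1 / m ^ 2 + 3 / m ^ 4 + 3 / m ^ 3) * (1 / w ^ 2) +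
        (K / m ^ 4 + 2 * K / m ^ 5) * (p' / (1 + p ^ 2)) := by
  have hw0 : 0 < w := hm.trans_le hw
  have hs0 : 0 < s := by rw [hs]; positivity
  set D : ℂ := s + Complex.I * p ^ 2 with hD
  have hDre : D.re = s := by simp [hD, ← Complex.ofReal_pow]
  have hDim : D.im = p ^ 2 := by simp [hD, ← Complex.ofReal_pow]
  have hD1 : s ≤ ‖D‖ := by simpa [hDre, abs_of_pos hs0] using Complex.abs_re_le_norm D
  have hD2 : p ^ 2 ≤ ‖D‖ := by simpa [hDim] using Complex.abs_im_le_norm D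
  have hDsq : ‖D‖ ^ 2 = s ^ 2 + p ^ 4 := by
    rw [Complex.sq_norm, Complex.normSq_apply, hDre, hDim]; ring
  have hD0 : 0 < ‖D‖ := hs0.trans_le hD1
  -- The bound |p| ≤ 1 + p² is split between the two parts of D: the real part s controls 1, and the
  -- imaginary part p² controls p².
  have hpD : |p| / ‖D‖ ≤ 1 / s + 1 := by
    have h1 : |p| ≤ 1 + p ^ 2 := by nlinarith [sq_abs p, abs_nonneg p, sq_nonneg (|p| - 1)]
    calc |p| / ‖D‖ ≤ (1 + p ^ 2) / ‖D‖ := by gcongr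
      _ = 1 / ‖D‖ + p ^ 2 / ‖D‖ := by ring
      _ ≤ 1 / s + 1 := by
        gcongr
        exact (div_le_one hD0).2 hD2
  have hs1 : 1 / s = w ^ 3 / m ^ 2 := by rw [hs]; field_simp
  have hmw : 1 / w ≤ 1 / m := one_div_le_one_div_of_le hm hw
  have hiw : 0 < 1 / w := by positivity
  have t1 : ‖(b' * p / D : ℂ)‖ ≤ K * (1 / m ^ 3 + 1 / m ^ 2) * (1 / w ^ 2) := by
    rw [norm_div, norm_mul, Complex.norm_real, Complex.norm_real, Real.norm_eq_abs,
      Real.norm_eq_abs, mul_div_assoc]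
    calc |b'| * (|p| / ‖D‖) ≤ K / w ^ 5 * (w ^ 3 / m ^ 2 + 1) := by rw [← hs1]; gcongr
      _ = K * ((1 / w) ^ 3 + 1 / m ^ 2) * (1 / w ^ 2) := by field_simp; ring
      _ ≤ K * ((1 / m) ^ 3 + 1 / m ^ 2) * (1 / w ^ 2) := by gcongr
      _ = _ := by rw [one_div_pow]
  have t2 : ‖(b * p * s' / D ^ 2 : ℂ)‖ ≤ K * (3 / m ^ 4 + 3 / m ^ 3) * (1 / w ^ 2) := by
    have e : ‖(b * p * s' / D ^ 2 : ℂ)‖ = |b| * |s'| * (|p| / ‖D‖) * (1 / ‖D‖) := by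
      rw [norm_div, norm_mul, norm_mul, norm_pow, Complex.norm_real, Complex.norm_real,
        Complex.norm_real, Real.norm_eq_abs, Real.norm_eq_abs, Real.norm_eq_abs]
      field_simp
    rw [e]
    calc |b| * |s'| * (|p| / ‖D‖) * (1 / ‖D‖)
        ≤ K / w ^ 5 * (3 * m ^ 2 / w ^ 4) * (w ^ 3 / m ^ 2 + 1) * (w ^ 3 / m ^ 2) := by
          rw [← hs1]; gcongr
      _ = K * (3 * (1 / w) ^ 4 + 3 * (1 / m) ^ 2 * (1 / w)) * (1 / w ^ 2) := by field_simp; ring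
      _ ≤ K * (3 * (1 / m) ^ 4 + 3 * (1 / m) ^ 2 * (1 / m)) * (1 / w ^ 2) := by gcongr
      _ = _ := by field_simp
  have t3 : ‖(b * p * (2 * Complex.I * p * p') / D ^ 2 : ℂ)‖ ≤
      (K / m ^ 4 + 2 * K / m ^ 5) * (p' / (1 + p ^ 2)) := by
    have e : ‖(b * p * (2 * Complex.I * p * p') / D ^ 2 : ℂ)‖
        = (2 * |b| * p ^ 2) * p' / (s ^ 2 + p ^ 4) := by
      rw [norm_div, norm_pow, hDsq]
      simp only [norm_mul, Complex.norm_real, Real.norm_eq_abs, Complex.norm_I, abs_of_nonneg hp']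
      have h2 : ‖(2 : ℂ)‖ = 2 := by simp
      have h3 : p ^ 2 = |p| * |p| := by rw [abs_mul_abs_self]; ring
      rw [h2, h3]; ring
    rw [e, div_le_iff₀ (by positivity)]
    have hb1 : |b| ≤ K / m ^ 4 * s := by
      refine hb.trans ?_
      rw [hs]
      calc K / w ^ 5 = K * (1 / w) ^ 2 * (1 / w ^ 3) := by field_simp
        _ ≤ K * (1 / m) ^ 2 * (1 / w ^ 3) := by gcongr
        _ = _ := by field_simp
    have hb2 : |b| ≤ K / m ^ 5 := hb.trans (by gcongr)
    -- The decay of b makes it at most a multiple of the curvature s, so 2sp² ≤ s² + p⁴ handles the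
    -- term in p². The term in p⁴ only needs b bounded.
    have key : 2 * |b| * p ^ 2 * (1 + p ^ 2) ≤ (K / m ^ 4 + 2 * K / m ^ 5) * (s ^ 2 + p ^ 4) := by
      have a1 : |b| * p ^ 2 ≤ K / m ^ 4 * s * p ^ 2 := by gcongr
      have a2 : |b| * p ^ 4 ≤ K / m ^ 5 * p ^ 4 := by gcongr
      have a3 : 0 ≤ K / m ^ 4 * (s - p ^ 2) ^ 2 := by positivity
      have a4 : 0 ≤ K / m ^ 5 * s ^ 2 := by positivity
      have a5 : 2 * K / m ^ 5 = 2 * (K / m ^ 5) := by ring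
      rw [a5]
      nlinarith
    calc 2 * |b| * p ^ 2 * p' = (2 * |b| * p ^ 2 * (1 + p ^ 2)) * (p' / (1 + p ^ 2)) := by
          field_simp
      _ ≤ ((K / m ^ 4 + 2 * K / m ^ 5) * (s ^ 2 + p ^ 4)) * (p' / (1 + p ^ 2)) := by gcongr
      _ = _ := by ring
  have split : (b' * p / D - b * p * (s' + 2 * Complex.I * p * p') / D ^ 2 : ℂ) =
      b' * p / D - b * p * s' / D ^ 2 - b * p * (2 * Complex.I * p * p') / D ^ 2 := by ring
  rw [split]
  calc _ ≤ _ := norm_sub_le _ _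
    _ ≤ _ := add_le_add_left (norm_sub_le _ _) _
    _ ≤ _ := add_le_add (add_le_add t1 t2) t3
    _ = _ := by ring

/-- Van der Corput's estimate for the phase `t ω(κ) + r κ`, uniformly in `r`. -/
theorem norm_integral_oscillatory_le {m : ℝ} (hm : 0 < m) {β β' : ℝ → ℝ} {K : ℝ} (hK : 0 ≤ K)
    (hβ : ∀ κ, HasDerivAt β (β' κ) κ) (hβ'c : Continuous β')
    (hb : ∀ κ, |β κ| ≤ K / disp m κ ^ 5) (hb' : ∀ κ, |β' κ| ≤ K / disp m κ ^ 5)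
    (hint : Integrable β) :
    ∃ C, ∀ t : ℝ, 0 < t → ∀ r : ℝ,
      ‖∫ κ, (β κ : ℂ) * Complex.exp (Complex.I * (t * disp m κ + r * κ : ℝ))‖ ≤ C / √t := by
  set C₁ := K * (1 / m ^ 3 + 1 / m ^ 2 + 3 / m ^ 4 + 3 / m ^ 3) with hC₁
  set C₂ := K / m ^ 4 + 2 * K / m ^ 5 with hC₂
  set C₀ := K * (1 / m ^ 5 + 1 / m ^ 4) with hC₀
  have hC₁0 : 0 ≤ C₁ := by positivity
  have hC₂0 : 0 ≤ C₂ := by positivity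
  refine ⟨2 * C₀ + (C₁ * (Real.pi / m) + C₂ * Real.pi), fun t ht r => ?_⟩
  set τ := √t with hτ
  have hτ0 : 0 < τ := Real.sqrt_pos.2 ht
  have hτt : τ * τ = t := Real.mul_self_sqrt ht.le
  set w : ℝ → ℝ := disp m with hw
  have hw0 : ∀ κ, 0 < w κ := disp_pos hm
  have hwc : Continuous w := continuous_disp m
  -- Here τ p is the derivative of the phase tω + rκ, and p' = τ s does not involve r; this is the
  -- source of uniformity in r.
  set p : ℝ → ℝ := fun κ => τ * (κ / w κ) + r / τ with hp
  set s : ℝ → ℝ := fun κ => m ^ 2 / w κ ^ 3 with hs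
  set s' : ℝ → ℝ := fun κ => -3 * m ^ 2 * κ / w κ ^ 5 with hs'
  set p' : ℝ → ℝ := fun κ => τ * s κ with hp'
  have dp : ∀ κ, HasDerivAt p (p' κ) κ := fun κ =>
    ((hasDerivAt_velocity hm κ).const_mul τ).add_const _
  have ds : ∀ κ, HasDerivAt s (s' κ) κ := fun κ => hasDerivAt_curvature hm κ
  have hs0 : ∀ κ, 0 < s κ := fun κ => by have := hw0 κ; simp only [hs]; positivity
  have hp'0 : ∀ κ, 0 ≤ p' κ := fun κ => (mul_pos hτ0 (hs0 κ)).le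
  have pc : Continuous p := continuous_iff_continuousAt.2 fun κ => (dp κ).continuousAt
  have sc : Continuous s := continuous_iff_continuousAt.2 fun κ => (ds κ).continuousAt
  have s'c : Continuous s' := by
    simp only [hs']
    exact (by fun_prop : Continuous fun κ : ℝ => -3 * m ^ 2 * κ).div (hwc.pow 5)
      fun κ => (pow_pos (hw0 κ) 5).ne'
  have p'c : Continuous p' := continuous_const.mul sc
  have βc : Continuous β := continuous_iff_continuousAt.2 fun κ => (hβ κ).continuousAt
  set D : ℝ → ℂ := fun κ => s κ + Complex.I * p κ ^ 2 with hD
  have hD0 : ∀ κ, D κ ≠ 0 := fun κ h => by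
    have : (D κ).re = s κ := by simp [hD, ← Complex.ofReal_pow]
    rw [h] at this; exact (hs0 κ).ne this
  have Dc : Continuous D := by
    simp only [hD]; fun_prop
  set e : ℝ → ℂ := fun κ => Complex.exp (Complex.I * (t * w κ + r * κ : ℝ)) with he
  have ec : Continuous e := by simp only [he]; fun_prop
  have en : ∀ κ, ‖e κ‖ = 1 := fun κ => by
    simp only [he]; rw [mul_comm, Complex.norm_exp_ofReal_mul_I]
  have dD : ∀ κ, HasDerivAt D (s' κ + 2 * Complex.I * p κ * p' κ) κ := fun κ => by
    have := (ds κ).ofReal_comp.add (((dp κ).ofReal_comp.pow 2).const_mul Complex.I)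
    refine this.congr_deriv ?_
    push_cast; ring
  have de : ∀ κ, HasDerivAt e (e κ * (Complex.I * (τ * p κ))) κ := fun κ => by
    have h1 : HasDerivAt (fun κ => t * w κ + r * κ) (t * (κ / w κ) + r * 1) κ :=
      ((hasDerivAt_disp hm κ).const_mul t).add ((hasDerivAt_id κ).const_mul r)
    refine ((h1.ofReal_comp.const_mul Complex.I).cexp).congr_deriv ?_
    have : t * (κ / w κ) + r * 1 = τ * p κ := by
      simp only [hp]; rw [mul_add, ← mul_assoc, hτt]; field_simp
    rw [this]; simp only [he]; push_cast; ring
  set R₀ : ℝ → ℂ := fun κ => β' κ * p κ / (s κ + Complex.I * p κ ^ 2) -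
    β κ * p κ * (s' κ + 2 * Complex.I * p κ * p' κ) / (s κ + Complex.I * p κ ^ 2) ^ 2 with hR₀
  have R₀c : Continuous R₀ := by
    refine (Continuous.div ?_ Dc hD0).sub (Continuous.div ?_ (Dc.pow 2)
      fun κ => pow_ne_zero 2 (hD0 κ)) <;> fun_prop
  -- The weight p / (s + i p²) is regular at the stationary point p = 0 and behaves like 1/(i p) far
  -- from it. Differentiating its numerator gives τ s and differentiating the exponential gives i τ
  -- p²; together they reproduce τ β e exactly, and only R₀ is left over.
  set W : ℝ → ℂ := fun κ => β κ * p κ / D κ * e κ with hW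
  have dW : ∀ κ, HasDerivAt W (τ * (β κ * e κ) + R₀ κ * e κ) κ := fun κ => by
    have h := ((((hβ κ).ofReal_comp.mul (dp κ).ofReal_comp).div (dD κ) (hD0 κ)).mul (de κ))
    refine h.congr_deriv ?_
    have hDκ : (s κ + Complex.I * p κ ^ 2 : ℂ) = D κ := rfl
    simp only [hR₀, hDκ, Pi.div_apply, Pi.mul_apply]
    have h0 := hD0 κ
    have hp'κ : (p' κ : ℂ) = τ * (D κ - Complex.I * p κ ^ 2) := by
      simp only [hp', ← hDκ]; push_cast; ring
    field_simp
    rw [hp'κ]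
    ring
  have hWb : ∀ κ, ‖W κ‖ ≤ C₀ := fun κ => by
    have hwκ := hw0 κ
    have hmw : 1 / w κ ≤ 1 / m := one_div_le_one_div_of_le hm (le_disp m κ)
    have hDre : (D κ).re = s κ := by simp [hD, ← Complex.ofReal_pow]
    have hDim : (D κ).im = p κ ^ 2 := by simp [hD, ← Complex.ofReal_pow]
    have hD1 : s κ ≤ ‖D κ‖ := by
      simpa [hDre, abs_of_pos (hs0 κ)] using Complex.abs_re_le_norm (D κ)
    have hD2 : p κ ^ 2 ≤ ‖D κ‖ := by simpa [hDim] using Complex.abs_im_le_norm (D κ)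
    have hDp : 0 < ‖D κ‖ := (hs0 κ).trans_le hD1
    have hpD : |p κ| / ‖D κ‖ ≤ w κ ^ 3 / m ^ 2 + 1 := by
      have h1 : |p κ| ≤ 1 + p κ ^ 2 := by
        nlinarith [sq_abs (p κ), abs_nonneg (p κ), sq_nonneg (|p κ| - 1)]
      calc |p κ| / ‖D κ‖ ≤ (1 + p κ ^ 2) / ‖D κ‖ := by gcongr
        _ = 1 / ‖D κ‖ + p κ ^ 2 / ‖D κ‖ := by ring
        _ ≤ 1 / s κ + 1 := by
          have := hs0 κ
          gcongr
          exact (div_le_one hDp).2 hD2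
        _ = _ := by simp only [hs]; field_simp
    have : ‖W κ‖ = |β κ| * (|p κ| / ‖D κ‖) := by
      simp only [hW, norm_mul, norm_div, Complex.norm_real, Real.norm_eq_abs, en]; ring
    rw [this]
    calc _ ≤ K / w κ ^ 5 * (w κ ^ 3 / m ^ 2 + 1) := mul_le_mul (hb κ) hpD (by positivity) (by positivity)
      _ = K * ((1 / w κ) ^ 5 + (1 / m) ^ 2 * (1 / w κ) ^ 2) := by field_simp; ring
      _ ≤ K * ((1 / m) ^ 5 + (1 / m) ^ 2 * (1 / m) ^ 2) := by gcongr
      _ = _ := by rw [hC₀]; field_simp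
  -- A primitive of the majorant of R₀. As arctan is bounded, its total increment is bounded
  -- independently of t and r, even though p' is of size √t.
  set Φ : ℝ → ℝ := fun κ => C₁ * (Real.arctan (κ / m) / m) + C₂ * Real.arctan (p κ) with hΦ
  have dΦ : ∀ κ, HasDerivAt Φ (C₁ * (1 / w κ ^ 2) + C₂ * (p' κ / (1 + p κ ^ 2))) κ := fun κ => by
    have h1 := (((hasDerivAt_id κ).div_const m).arctan.div_const m).const_mul C₁
    have h2 := ((dp κ).arctan).const_mul C₂
    refine (h1.add h2).congr_deriv ?_
    simp only [hw, sq_disp, id]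
    field_simp
  have hfin : ∀ R : ℝ, 0 ≤ R → ‖∫ κ in (-R)..R, (β κ : ℂ) * e κ‖ ≤
      (2 * C₀ + (C₁ * (Real.pi / m) + C₂ * Real.pi)) / τ := fun R hR => by
    have hle : -R ≤ R := by linarith
    have i1 : IntervalIntegrable (fun κ => (τ : ℂ) * (β κ * e κ)) volume (-R) R :=
      Continuous.intervalIntegrable (by fun_prop) _ _
    have i2 : IntervalIntegrable (fun κ => R₀ κ * e κ) volume (-R) R :=
      (R₀c.mul ec).intervalIntegrable _ _
    have ftc := intervalIntegral.integral_eq_sub_of_hasDerivAt (fun κ _ => dW κ) (i1.add i2)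
    rw [intervalIntegral.integral_add i1 i2, intervalIntegral.integral_const_mul] at ftc
    have iΦ : IntervalIntegrable (fun κ => C₁ * (1 / w κ ^ 2) + C₂ * (p' κ / (1 + p κ ^ 2)))
        volume (-R) R := by
      refine Continuous.intervalIntegrable ?_ _ _
      refine (continuous_const.mul (continuous_const.div (hwc.pow 2)
        fun κ => (pow_pos (hw0 κ) 2).ne')).add (continuous_const.mul (p'c.div (by fun_prop)
        fun κ => by positivity))
    have ftcΦ := intervalIntegral.integral_eq_sub_of_hasDerivAt (fun κ _ => dΦ κ) iΦ
    have hR₀i : ‖∫ κ in (-R)..R, R₀ κ * e κ‖ ≤ Φ R - Φ (-R) := by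
      rw [← ftcΦ]
      refine intervalIntegral.norm_integral_le_of_norm_le hle (Eventually.of_forall fun κ _ => ?_) iΦ
      rw [norm_mul, en, mul_one]
      refine norm_remainder_le hm hK (le_disp m κ) rfl ?_ (hp'0 κ) (hb κ) (hb' κ)
      have hwκ := hw0 κ
      simp only [hs']
      rw [abs_div, abs_mul, abs_mul, abs_of_pos (pow_pos hwκ 5), abs_neg,
        abs_of_pos (by positivity : (0:ℝ) < 3), abs_of_pos (by positivity : 0 < m ^ 2)]
      calc 3 * m ^ 2 * |κ| / w κ ^ 5 ≤ 3 * m ^ 2 * w κ / w κ ^ 5 := by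
            gcongr; exact abs_le_disp m κ
        _ = _ := by field_simp
    have hΦb : Φ R - Φ (-R) ≤ C₁ * (Real.pi / m) + C₂ * Real.pi := by
      have a1 := Real.arctan_lt_pi_div_two (R / m)
      have a2 := Real.neg_pi_div_two_lt_arctan (-R / m)
      have a3 := Real.arctan_lt_pi_div_two (p R)
      have a4 := Real.neg_pi_div_two_lt_arctan (p (-R))
      have e1 : Φ R - Φ (-R) = C₁ * ((Real.arctan (R / m) - Real.arctan (-R / m)) / m) +
          C₂ * (Real.arctan (p R) - Real.arctan (p (-R))) := by simp only [hΦ]; ring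
      rw [e1]
      gcongr <;> linarith
    have hτn : ‖(τ : ℂ)‖ = τ := by rw [Complex.norm_real, Real.norm_of_nonneg hτ0.le]
    rw [le_div_iff₀ hτ0, mul_comm, ← hτn, ← norm_mul]
    have : (τ : ℂ) * ∫ κ in (-R)..R, (β κ : ℂ) * e κ =
        (W R - W (-R)) - ∫ κ in (-R)..R, R₀ κ * e κ := by rw [← ftc]; ring
    rw [this]
    calc _ ≤ ‖W R - W (-R)‖ + ‖∫ κ in (-R)..R, R₀ κ * e κ‖ := norm_sub_le _ _
      _ ≤ (‖W R‖ + ‖W (-R)‖) + (Φ R - Φ (-R)) := add_le_add (norm_sub_le _ _) hR₀i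
      _ ≤ _ := by linarith [hWb R, hWb (-R)]
  have hI : Integrable (fun κ => (β κ : ℂ) * e κ) :=
    hint.ofReal.mul_bdd (c := 1) ec.aestronglyMeasurable (Eventually.of_forall fun κ => (en κ).le)
  have lim := intervalIntegral_tendsto_integral hI tendsto_neg_atTop_atBot tendsto_id
  refine le_of_tendsto lim.norm ?_
  filter_upwards [eventually_ge_atTop 0] with R hR using hfin R hR

end Oscillatory

/-! ### Slicing `ℝ³` into planes -/

section Slicing

/-- Splitting off the first coordinate of `ℝ³`. -/
def splitCoord : R3 ≃ᵐ ℝ × EuclideanSpace ℝ (Fin 2) :=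
  ((MeasurableEquiv.toLp 2 (Fin 3 → ℝ)).symm.trans
    (MeasurableEquiv.piFinSuccAbove (fun _ : Fin 3 => ℝ) 0)).trans
    (MeasurableEquiv.prodCongr (MeasurableEquiv.refl ℝ) (MeasurableEquiv.toLp 2 (Fin 2 → ℝ)))

theorem measurePreserving_splitCoord : MeasurePreserving splitCoord volume volume := by
  have h1 := EuclideanSpace.volume_preserving_symm_measurableEquiv_toLp (Fin 3)
  have h2 := volume_preserving_piFinSuccAbove (fun _ : Fin 3 => ℝ) 0
  have h3 := (EuclideanSpace.volume_preserving_symm_measurableEquiv_toLp (Fin 2)).symm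
  exact ((MeasurePreserving.id (volume : Measure ℝ)).prod h3).comp (h2.comp h1)

theorem splitCoord_fst (k : R3) : (splitCoord k).1 = k 0 := rfl

theorem norm_sq_eq_splitCoord (k : R3) :
    ‖k‖ ^ 2 = (splitCoord k).1 ^ 2 + ‖(splitCoord k).2‖ ^ 2 := by
  have h1 : (splitCoord k).2 0 = k 1 := rfl
  have h2 : (splitCoord k).2 1 = k 2 := rfl
  rw [EuclideanSpace.norm_sq_eq, EuclideanSpace.norm_sq_eq, splitCoord_fst, Fin.sum_univ_three,
    Fin.sum_univ_two, h1, h2]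
  simp only [Real.norm_eq_abs, sq_abs]
  ring

/-- Fubini. Integrability of the slice integrals is part of the conclusion because they are later
split into a main term and a remainder. -/
theorem integral_slice (F : ℝ → ℝ → ℂ) (hF : Integrable fun k : R3 => F (k 0) (‖k‖ ^ 2)) :
    Integrable (fun κ : ℝ => ∫ y : EuclideanSpace ℝ (Fin 2), F κ (κ ^ 2 + ‖y‖ ^ 2)) ∧
    ∫ k : R3, F (k 0) (‖k‖ ^ 2) =
      ∫ κ : ℝ, ∫ y : EuclideanSpace ℝ (Fin 2), F κ (κ ^ 2 + ‖y‖ ^ 2) := by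
  set G : ℝ × EuclideanSpace ℝ (Fin 2) → ℂ := fun q => F q.1 (q.1 ^ 2 + ‖q.2‖ ^ 2) with hG
  have e : (fun k : R3 => F (k 0) (‖k‖ ^ 2)) = G ∘ splitCoord := by
    ext k
    rw [Function.comp_apply, norm_sq_eq_splitCoord]
    rfl
  rw [e] at hF
  have hGi : Integrable G (volume : Measure (ℝ × EuclideanSpace ℝ (Fin 2))) :=
    (measurePreserving_splitCoord.integrable_comp_emb splitCoord.measurableEmbedding).1 hF
  refine ⟨Integrable.integral_prod_left hGi, ?_⟩
  have h1 := measurePreserving_splitCoord.integral_comp splitCoord.measurableEmbedding G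
  rw [← integral_prod G hGi, e]
  exact h1

theorem integral_radial_plane (f : ℝ → ℂ) :
    ∫ y : EuclideanSpace ℝ (Fin 2), f ‖y‖ =
      2 * Real.pi * ∫ ρ in Set.Ioi (0 : ℝ), (ρ : ℂ) * f ρ := by
  rw [integral_fun_norm_addHaar]
  have : (volume : Measure (EuclideanSpace ℝ (Fin 2))).real (Metric.ball 0 1) = Real.pi := by
    rw [Measure.real, EuclideanSpace.volume_ball_fin_two]
    simp [Real.pi_pos.le]
  rw [this]
  simp [mul_assoc]

/-- A plane wave against a radial function only sees the length of the frequency. -/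
theorem integral_radial_mul_exp_inner (G : ℝ → ℂ) (z : R3) :
    ∫ k : R3, G (‖k‖ ^ 2) * Complex.exp (Complex.I * (inner ℝ k z : ℝ)) =
      ∫ k : R3, G (‖k‖ ^ 2) * Complex.exp (Complex.I * (‖z‖ * k 0 : ℝ)) := by
  -- The reflection in the plane orthogonal to z - w exchanges z and w, which have equal length. It
  -- preserves the measure and every radial function.
  set w : R3 := EuclideanSpace.single 0 ‖z‖ with hw
  have hn : ‖z‖ = ‖w‖ := by simp [hw]
  set L := Submodule.reflection (ℝ ∙ (z - w))ᗮ with hL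
  have hLz : L z = w := Submodule.reflection_sub hn
  have h := L.measurePreserving.integral_comp L.toHomeomorph.measurableEmbedding
    (fun k : R3 => G (‖k‖ ^ 2) * Complex.exp (Complex.I * (‖z‖ * k 0 : ℝ)))
  rw [← h]
  congr 1
  ext k
  have h1 : inner ℝ k z = ‖z‖ * (L k) 0 := by
    rw [← L.inner_map_map, hLz, hw, EuclideanSpace.inner_single_right]
    simp [mul_comm]
  rw [h1, L.norm_map]

end Slicing

/-! ### The dispersive kernel estimate -/

section Kernel

variable {m : ℝ}

theorem integrable_one_div_disp_sq (hm : 0 < m) : Integrable fun κ : ℝ => 1 / disp m κ ^ 2 := by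
  have h := (integrable_inv_one_add_sq.comp_div hm.ne').const_mul (1 / m ^ 2)
  refine h.congr (Eventually.of_forall fun κ => ?_)
  simp only [sq_disp]
  field_simp

theorem tendsto_disp_atTop (m : ℝ) : Tendsto (disp m) atTop atTop :=
  tendsto_atTop_mono (fun κ => (le_abs_self κ).trans (abs_le_disp m κ)) tendsto_id

/-- Integration by parts in the plane orthogonal to a given direction. -/
theorem norm_slice_add_le (hm : 0 < m) {c c' c'' : ℝ → ℝ} {K : ℝ}
    (hc : ∀ w, m ≤ w → HasDerivAt c (c' w) w) (hc' : ∀ w, m ≤ w → HasDerivAt c' (c'' w) w)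
    (hcont : ContinuousOn c'' (Set.Ici m))
    (hb : ∀ w, m ≤ w → |c w| ≤ K / w ^ 5) (hb' : ∀ w, m ≤ w → |c' w| ≤ K / w ^ 5)
    (hb'' : ∀ w, m ≤ w → |c'' w| ≤ K / w ^ 5) :
    ∃ C, ∀ t : ℝ, 0 < t → ∀ M : ℝ, m ≤ M →
      ‖(∫ ρ in Set.Ioi (0 : ℝ), (ρ : ℂ) * ((c (disp M ρ) / disp M ρ : ℝ) *
          Complex.exp (Complex.I * (t * disp M ρ : ℝ)))) +
        Complex.exp (Complex.I * (t * M : ℝ)) * c M / (Complex.I * t)‖ ≤ C / t ^ 2 * (1 / M ^ 2) := by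
  have hK : 0 ≤ K := by
    have := (abs_nonneg _).trans (hb m le_rfl)
    by_contra! h
    exact absurd this (not_le.2 (div_neg_of_neg_of_pos h (by positivity)))
  set B := ∫ ρ in Set.Ioi (0 : ℝ), 1 / disp m ρ ^ 2 with hB
  refine ⟨K / m ^ 3 + K / m * B, fun t ht M hM => ?_⟩
  have hM0 : 0 < M := hm.trans_le hM
  have ht0 : (t : ℂ) ≠ 0 := by exact_mod_cast ht.ne'
  set Ω := disp M with hΩ
  have hΩ0 : ∀ ρ, 0 < Ω ρ := disp_pos hM0
  have hΩM : ∀ ρ, M ≤ Ω ρ := le_disp M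
  have hΩm : ∀ ρ, m ≤ Ω ρ := fun ρ => hM.trans (hΩM ρ)
  have hΩ1 : ∀ ρ, disp m ρ ≤ Ω ρ := fun ρ => Real.sqrt_le_sqrt (by gcongr)
  have Ωc : Continuous Ω := continuous_disp M
  set e : ℝ → ℂ := fun w => Complex.exp (Complex.I * (t * w : ℝ)) with he
  have en : ∀ w, ‖e w‖ = 1 := fun w => by
    simp only [he]; rw [mul_comm, Complex.norm_exp_ofReal_mul_I]
  have ec : Continuous e := by simp only [he]; fun_prop
  -- Two integrations by parts in one: the terms with c' cancel in A', which leaves e (c + c''/t²).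
  set A : ℝ → ℂ := fun w => e w * (c w / (Complex.I * t) + c' w / t ^ 2) with hA
  have de : ∀ w, HasDerivAt e (e w * (Complex.I * t)) w := fun w => by
    have h1 : HasDerivAt (fun w => t * w) (t * 1) w := (hasDerivAt_id w).const_mul t
    refine ((h1.ofReal_comp.const_mul Complex.I).cexp).congr_deriv ?_
    simp only [he]; push_cast; ring
  have dA : ∀ w, m ≤ w → HasDerivAt A (e w * (c w + c'' w / t ^ 2)) w := fun w hw => by
    refine ((de w).mul (((hc w hw).ofReal_comp.div_const (Complex.I * t)).add
      ((hc' w hw).ofReal_comp.div_const ((t : ℂ) ^ 2)))).congr_deriv ?_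
    have hI : Complex.I ≠ 0 := Complex.I_ne_zero
    have hI2 : Complex.I ^ 2 = -1 := Complex.I_sq
    simp only [Pi.add_apply]
    field_simp
    ring_nf
    simp only [hI2]
    ring
  set f' : ℝ → ℂ := fun ρ => e (Ω ρ) * (c (Ω ρ) + c'' (Ω ρ) / t ^ 2) * (ρ / Ω ρ : ℝ) with hf'
  have dAΩ : ∀ ρ, HasDerivAt (fun ρ => A (Ω ρ)) (f' ρ) ρ := fun ρ => by
    have := (dA (Ω ρ) (hΩm ρ)).scomp ρ (hasDerivAt_disp hM0 ρ)
    refine this.congr_deriv ?_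
    simp only [hf', Complex.real_smul]; ring
  have cc : Continuous fun ρ => c (Ω ρ) := continuous_iff_continuousAt.2 fun ρ =>
    ((hc _ (hΩm ρ)).continuousAt).comp Ωc.continuousAt
  have c''c : Continuous fun ρ => c'' (Ω ρ) :=
    hcont.comp_continuous Ωc fun ρ => hΩm ρ
  have hvc : Continuous fun ρ => ρ / Ω ρ := continuous_id.div Ωc fun ρ => (hΩ0 ρ).ne'
  have hv1 : ∀ ρ, |ρ / Ω ρ| ≤ 1 := fun ρ => by
    rw [abs_div, abs_of_pos (hΩ0 ρ), div_le_one (hΩ0 ρ)]; exact abs_le_disp M ρ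
  -- Of the five powers of Ω, one is spent on m, two on M for the later integration in κ, and two on
  -- integrability in ρ.
  have h5 : ∀ ρ, K / Ω ρ ^ 5 ≤ K / m * (1 / M ^ 2) * (1 / disp m ρ ^ 2) := fun ρ => by
    have hd := disp_pos hm ρ
    have : m * M ^ 2 * disp m ρ ^ 2 ≤ Ω ρ ^ 5 := by
      calc m * M ^ 2 * disp m ρ ^ 2 ≤ Ω ρ * Ω ρ ^ 2 * Ω ρ ^ 2 := by
            have := hΩ0 ρ
            gcongr
            · exact hΩm ρ
            · exact hΩM ρ
            · exact hΩ1 ρ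
        _ = _ := by ring
    calc K / Ω ρ ^ 5 ≤ K / (m * M ^ 2 * disp m ρ ^ 2) := by gcongr
      _ = _ := by field_simp
  have hbi : Integrable fun ρ => K / m * (1 / M ^ 2) * (1 / disp m ρ ^ 2) :=
    (integrable_one_div_disp_sq hm).const_mul _
  have g1 : Continuous fun ρ => e (Ω ρ) * c (Ω ρ) * (ρ / Ω ρ : ℝ) :=
    ((ec.comp Ωc).mul (Complex.continuous_ofReal.comp cc)).mul (Complex.continuous_ofReal.comp hvc)
  have g2 : Continuous fun ρ => e (Ω ρ) * c'' (Ω ρ) * (ρ / Ω ρ : ℝ) :=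
    ((ec.comp Ωc).mul (Complex.continuous_ofReal.comp c''c)).mul
      (Complex.continuous_ofReal.comp hvc)
  have i1 : Integrable fun ρ => e (Ω ρ) * c (Ω ρ) * (ρ / Ω ρ : ℝ) := by
    refine hbi.mono' g1.aestronglyMeasurable
      (Eventually.of_forall fun ρ => ?_)
    rw [norm_mul, norm_mul, en, one_mul, Complex.norm_real, Complex.norm_real, Real.norm_eq_abs,
      Real.norm_eq_abs]
    calc |c (Ω ρ)| * |ρ / Ω ρ| ≤ |c (Ω ρ)| * 1 := by gcongr; exact hv1 ρ
      _ ≤ _ := by rw [mul_one]; exact (hb _ (hΩm ρ)).trans (h5 ρ)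
  have n2 : ∀ ρ, ‖e (Ω ρ) * c'' (Ω ρ) * (ρ / Ω ρ : ℝ)‖ ≤
      K / m * (1 / M ^ 2) * (1 / disp m ρ ^ 2) := fun ρ => by
    rw [norm_mul, norm_mul, en, one_mul, Complex.norm_real, Complex.norm_real, Real.norm_eq_abs,
      Real.norm_eq_abs]
    calc |c'' (Ω ρ)| * |ρ / Ω ρ| ≤ |c'' (Ω ρ)| * 1 := by gcongr; exact hv1 ρ
      _ ≤ _ := by rw [mul_one]; exact (hb'' _ (hΩm ρ)).trans (h5 ρ)
  have i2 : Integrable fun ρ => e (Ω ρ) * c'' (Ω ρ) * (ρ / Ω ρ : ℝ) :=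
    hbi.mono' g2.aestronglyMeasurable (Eventually.of_forall n2)
  have ef' : f' = fun ρ => e (Ω ρ) * c (Ω ρ) * (ρ / Ω ρ : ℝ) +
      1 / t ^ 2 * (e (Ω ρ) * c'' (Ω ρ) * (ρ / Ω ρ : ℝ)) := by
    ext ρ; simp only [hf']; ring
  have if' : Integrable f' := by rw [ef']; exact i1.add (i2.const_mul _)
  have lim : Tendsto (fun ρ => A (Ω ρ)) atTop (𝓝 0) := by
    have hlim : Tendsto (fun ρ => (K / t + K / t ^ 2) / Ω ρ ^ 5) atTop (𝓝 0) :=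
      Tendsto.const_div_atTop ((tendsto_pow_atTop (by norm_num)).comp (tendsto_disp_atTop M)) _
    refine squeeze_zero_norm (fun ρ => ?_) hlim
    simp only [hA]
    rw [norm_mul, en, one_mul]
    refine (norm_add_le _ _).trans ?_
    rw [norm_div, norm_div, norm_mul, norm_pow, Complex.norm_I, one_mul, Complex.norm_real,
      Complex.norm_real, Complex.norm_real, Real.norm_eq_abs, Real.norm_eq_abs, Real.norm_eq_abs,
      abs_of_pos ht]
    calc |c (Ω ρ)| / t + |c' (Ω ρ)| / t ^ 2 ≤ K / Ω ρ ^ 5 / t + K / Ω ρ ^ 5 / t ^ 2 := by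
          gcongr
          · exact hb _ (hΩm ρ)
          · exact hb' _ (hΩm ρ)
      _ = _ := by ring
  have ftc := integral_Ioi_of_hasDerivAt_of_tendsto (a := 0)
    (dAΩ 0).continuousAt.continuousWithinAt (fun ρ _ => dAΩ ρ) if'.integrableOn lim
  have hΩ00 : Ω 0 = M := by simp [hΩ, disp, Real.sqrt_sq hM0.le]
  rw [ef', integral_add i1.integrableOn (i2.const_mul _).integrableOn, integral_const_mul,
    hΩ00] at ftc
  have e1 : (∫ ρ in Set.Ioi (0 : ℝ), (ρ : ℂ) * ((c (Ω ρ) / Ω ρ : ℝ) *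
      Complex.exp (Complex.I * (t * Ω ρ : ℝ)))) =
      ∫ ρ in Set.Ioi (0 : ℝ), e (Ω ρ) * c (Ω ρ) * (ρ / Ω ρ : ℝ) := by
    congr 1; ext ρ; simp only [he]; push_cast; ring
  rw [e1]
  have e2 : (∫ ρ in Set.Ioi (0 : ℝ), e (Ω ρ) * c (Ω ρ) * (ρ / Ω ρ : ℝ)) +
      Complex.exp (Complex.I * (t * M : ℝ)) * c M / (Complex.I * t) =
      -(e M * c' M / t ^ 2) -
        1 / t ^ 2 * ∫ ρ in Set.Ioi (0 : ℝ), e (Ω ρ) * c'' (Ω ρ) * (ρ / Ω ρ : ℝ) := by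
    have : (∫ ρ in Set.Ioi (0 : ℝ), e (Ω ρ) * c (Ω ρ) * (ρ / Ω ρ : ℝ)) = 0 - A M -
      1 / t ^ 2 * ∫ ρ in Set.Ioi (0 : ℝ), e (Ω ρ) * c'' (Ω ρ) * (ρ / Ω ρ : ℝ) := by
      rw [← ftc]; ring
    rw [this]; simp only [hA, he]; ring
  rw [e2]
  have n3 : ‖∫ ρ in Set.Ioi (0 : ℝ), e (Ω ρ) * c'' (Ω ρ) * (ρ / Ω ρ : ℝ)‖ ≤
      K / m * (1 / M ^ 2) * B := by
    rw [hB, ← integral_const_mul]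
    exact norm_integral_le_of_norm_le hbi.integrableOn (Eventually.of_forall n2)
  have n4 : |c' M| ≤ K / m ^ 3 * (1 / M ^ 2) := by
    refine (hb' M hM).trans ?_
    calc K / M ^ 5 = K / M ^ 3 * (1 / M ^ 2) := by field_simp
      _ ≤ _ := by gcongr
  refine (norm_sub_le _ _).trans ?_
  rw [norm_neg, norm_div, norm_mul, norm_mul, norm_div, en, norm_one, one_mul, norm_pow,
    Complex.norm_real, Complex.norm_real, Real.norm_eq_abs, Real.norm_eq_abs, abs_of_pos ht]
  calc |c' M| / t ^ 2 + 1 / t ^ 2 * ‖∫ ρ in Set.Ioi (0 : ℝ), e (Ω ρ) * c'' (Ω ρ) * (ρ / Ω ρ : ℝ)‖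
      ≤ K / m ^ 3 * (1 / M ^ 2) / t ^ 2 + 1 / t ^ 2 * (K / m * (1 / M ^ 2) * B) := by gcongr
    _ = _ := by ring

/-- The integrand is O(ω⁻⁶), hence comparable with (1 + |k/m|²)^(-3), which is integrable since 6
exceeds the dimension 3. -/
theorem integrable_disp_norm (hm : 0 < m) {c : ℝ → ℝ} {K : ℝ}
    (hc : ContinuousOn c (Set.Ici m)) (hb : ∀ w, m ≤ w → |c w| ≤ K / w ^ 5) :
    Integrable fun k : R3 => c (disp m ‖k‖) / disp m ‖k‖ := by
  have hd : Continuous fun k : R3 => disp m ‖k‖ := (continuous_disp m).comp continuous_norm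
  have h0 : Integrable fun x : R3 => (1 + ‖x‖ ^ 2) ^ (-(6 : ℝ) / 2) :=
    integrable_rpow_neg_one_add_norm_sq (by simp; norm_num)
  have h1 := (h0.comp_smul (inv_ne_zero hm.ne')).const_mul (K / m ^ 6)
  refine h1.mono' ((hc.comp_continuous hd fun k => le_disp m _).div hd
    fun k => (disp_pos hm _).ne').aestronglyMeasurable (Eventually.of_forall fun k => ?_)
  have hp := disp_pos hm ‖k‖
  rw [Real.norm_eq_abs, abs_div, abs_of_pos hp]
  have e1 : ((1 + ‖m⁻¹ • k‖ ^ 2) : ℝ) ^ (-(6 : ℝ) / 2) = m ^ 6 / disp m ‖k‖ ^ 6 := by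
    have : (1 + ‖m⁻¹ • k‖ ^ 2) = disp m ‖k‖ ^ 2 / m ^ 2 := by
      rw [sq_disp, norm_smul, norm_inv, Real.norm_of_nonneg hm.le]; field_simp
    rw [this, show (-(6 : ℝ) / 2) = ((-3 : ℤ) : ℝ) by norm_num, Real.rpow_intCast]
    rw [zpow_neg, ← inv_zpow, inv_div]
    norm_cast
    rw [div_pow, ← pow_mul, ← pow_mul]
  rw [e1]
  calc |c (disp m ‖k‖)| / disp m ‖k‖ ≤ K / disp m ‖k‖ ^ 5 / disp m ‖k‖ := by
        gcongr; exact hb _ (le_disp m _)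
    _ = _ := by field_simp

/-- The dispersive estimate for a symbol of sufficient decay. -/
theorem norm_kernel_le (hm : 0 < m) {c c' c'' : ℝ → ℝ} {K : ℝ}
    (hc : ∀ w, m ≤ w → HasDerivAt c (c' w) w) (hc' : ∀ w, m ≤ w → HasDerivAt c' (c'' w) w)
    (hcont : ContinuousOn c'' (Set.Ici m))
    (hb : ∀ w, m ≤ w → |c w| ≤ K / w ^ 5) (hb' : ∀ w, m ≤ w → |c' w| ≤ K / w ^ 5)
    (hb'' : ∀ w, m ≤ w → |c'' w| ≤ K / w ^ 5) :
    ∃ C, ∀ t : ℝ, 1 ≤ |t| → ∀ z : R3,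
      ‖∫ k : R3, (c (disp m ‖k‖) / disp m ‖k‖ : ℝ) *
          Complex.exp (Complex.I * (t * disp m ‖k‖ : ℝ)) *
          Complex.exp (Complex.I * (inner ℝ k z : ℝ))‖ ≤ C / (|t| * √|t|) := by
  have hK : 0 ≤ K := by
    have := (abs_nonneg _).trans (hb m le_rfl)
    by_contra! h
    exact absurd this (not_le.2 (div_neg_of_neg_of_pos h (by positivity)))
  have ccont : ContinuousOn c (Set.Ici m) := fun w hw => (hc w hw).continuousAt.continuousWithinAt
  have c'cont : ContinuousOn c' (Set.Ici m) := fun w hw => (hc' w hw).continuousAt.continuousWithinAt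
  have hdc := continuous_disp m
  have hd0 := disp_pos hm
  have cint : Integrable fun κ => c (disp m κ) := by
    refine ((integrable_one_div_disp_sq hm).const_mul (K / m ^ 3)).mono'
      (ccont.comp_continuous hdc fun κ => le_disp m _).aestronglyMeasurable
      (Eventually.of_forall fun κ => ?_)
    have := hd0 κ
    refine (hb _ (le_disp m κ)).trans ?_
    calc K / disp m κ ^ 5 = K / disp m κ ^ 3 * (1 / disp m κ ^ 2) := by field_simp
      _ ≤ _ := by gcongr; exact le_disp m κ
  obtain ⟨C₁, hC₁⟩ := norm_integral_oscillatory_le hm (β := fun κ => c (disp m κ))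
    (β' := fun κ => c' (disp m κ) * (κ / disp m κ)) hK
    (fun κ => (hc _ (le_disp m κ)).comp κ (hasDerivAt_disp hm κ))
    ((c'cont.comp_continuous hdc fun κ => le_disp m _).mul
      (continuous_id.div hdc fun κ => (hd0 κ).ne'))
    (fun κ => hb _ (le_disp m κ))
    (fun κ => by
      have h1 : |κ / disp m κ| ≤ 1 := by
        rw [abs_div, abs_of_pos (hd0 κ), div_le_one (hd0 κ)]; exact abs_le_disp m κ
      rw [abs_mul]
      calc _ ≤ |c' (disp m κ)| * 1 := by gcongr
        _ ≤ _ := by rw [mul_one]; exact hb' _ (le_disp m κ)) cint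
  obtain ⟨C₂, hC₂⟩ := norm_slice_add_le hm hc hc' hcont hb hb' hb''
  set B := ∫ κ, 1 / disp m κ ^ 2 with hB
  have hB0 : 0 ≤ B := integral_nonneg fun κ => by have := hd0 κ; positivity
  have pos : ∀ t : ℝ, 1 ≤ t → ∀ z : R3,
      ‖∫ k : R3, (c (disp m ‖k‖) / disp m ‖k‖ : ℝ) *
          Complex.exp (Complex.I * (t * disp m ‖k‖ : ℝ)) *
          Complex.exp (Complex.I * (inner ℝ k z : ℝ))‖ ≤
        2 * Real.pi * (|C₂| * B + C₁) / (t * √t) := by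
    intro t ht z
    have ht0 : 0 < t := by linarith
    set G : ℝ → ℂ := fun s => (c √(m ^ 2 + s) / √(m ^ 2 + s) : ℝ) *
      Complex.exp (Complex.I * (t * √(m ^ 2 + s) : ℝ)) with hG
    have hint : Integrable fun k : R3 => G (‖k‖ ^ 2) *
        Complex.exp (Complex.I * (‖z‖ * k 0 : ℝ)) := by
      have h1 := (integrable_disp_norm hm ccont hb).ofReal (𝕜 := ℂ)
      have h2 : Continuous fun k : R3 => Complex.exp (Complex.I * (t * disp m ‖k‖ : ℝ)) := by
        have := hdc.comp (continuous_norm (E := R3)); simp only [Function.comp_def] at this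
        fun_prop
      have h3 : Continuous fun k : R3 => Complex.exp (Complex.I * (‖z‖ * k 0 : ℝ)) := by fun_prop
      refine (h1.mul_bdd (c := 1) h2.aestronglyMeasurable (Eventually.of_forall fun k => ?_)).mul_bdd
        (c := 1) h3.aestronglyMeasurable (Eventually.of_forall fun k => ?_)
      · rw [mul_comm, Complex.norm_exp_ofReal_mul_I]
      · rw [mul_comm, Complex.norm_exp_ofReal_mul_I]
    have e0 : ∫ k : R3, (c (disp m ‖k‖) / disp m ‖k‖ : ℝ) *
          Complex.exp (Complex.I * (t * disp m ‖k‖ : ℝ)) *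
          Complex.exp (Complex.I * (inner ℝ k z : ℝ)) =
        ∫ k : R3, G (‖k‖ ^ 2) * Complex.exp (Complex.I * (inner ℝ k z : ℝ)) := rfl
    obtain ⟨hJi, hJ⟩ := integral_slice
      (fun κ s => G s * Complex.exp (Complex.I * (‖z‖ * κ : ℝ))) hint
    set E : ℝ → ℂ := fun κ => Complex.exp (Complex.I * (‖z‖ * κ : ℝ)) with hE
    have en : ∀ κ, ‖E κ‖ = 1 := fun w => by
      simp only [hE]; rw [mul_comm, Complex.norm_exp_ofReal_mul_I]
    set J : ℝ → ℂ := fun κ => ∫ ρ in Set.Ioi (0 : ℝ), (ρ : ℂ) *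
      ((c (disp (disp m κ) ρ) / disp (disp m κ) ρ : ℝ) *
        Complex.exp (Complex.I * (t * disp (disp m κ) ρ : ℝ))) with hJdef
    have inner_eq : ∀ κ, ∫ y : EuclideanSpace ℝ (Fin 2), G (κ ^ 2 + ‖y‖ ^ 2) * E κ =
        2 * Real.pi * (J κ * E κ) := fun κ => by
      rw [integral_mul_const, integral_radial_plane (fun ρ => G (κ ^ 2 + ρ ^ 2))]
      -- On a plane at height κ the dispersion relation is again of Klein-Gordon type, with the mass
      -- M = (m² + κ²)^(1/2).
      have : ∀ ρ, √(m ^ 2 + (κ ^ 2 + ρ ^ 2)) = disp (disp m κ) ρ := fun ρ => by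
        rw [← add_assoc, ← sq_disp]; rfl
      simp only [hG, this, hJdef]
      ring
    replace hJi : Integrable fun κ => 2 * Real.pi * (J κ * E κ) :=
      hJi.congr (Eventually.of_forall fun κ => inner_eq κ)
    replace hJ := hJ.trans (integral_congr_ae (Eventually.of_forall fun κ => inner_eq κ))
    set S : ℝ → ℂ := fun κ => (c (disp m κ) : ℂ) *
      Complex.exp (Complex.I * (t * disp m κ + ‖z‖ * κ : ℝ)) with hS
    have hSi : Integrable S := by
      refine (cint.ofReal (𝕜 := ℂ)).mul_bdd (c := 1) (Continuous.aestronglyMeasurable (by fun_prop))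
        (Eventually.of_forall fun κ => ?_)
      rw [mul_comm, Complex.norm_exp_ofReal_mul_I]
    have hJi' : Integrable fun κ => J κ * E κ := by
      have hpi : (2 * Real.pi : ℂ) ≠ 0 := by
        simp [Real.pi_ne_zero]
      exact (hJi.const_mul (2 * Real.pi : ℂ)⁻¹).congr
        (Eventually.of_forall fun κ => inv_mul_cancel_left₀ hpi _)
    -- The boundary term of each slice is moved into S, whose phase tω(κ) + ‖z‖κ is covered by van
    -- der Corput with r = ‖z‖. The rest is O(t⁻²) with an integrable bound in κ.
    have hsplit : ∫ κ, J κ * E κ = (∫ κ, (J κ * E κ + 1 / (Complex.I * t) * S κ)) -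
        1 / (Complex.I * t) * ∫ κ, S κ := by
      rw [integral_add hJi' (hSi.const_mul _), integral_const_mul]; ring
    have hrem : ‖∫ κ, (J κ * E κ + 1 / (Complex.I * t) * S κ)‖ ≤ |C₂| / t ^ 2 * B := by
      rw [hB, ← integral_const_mul]
      refine norm_integral_le_of_norm_le ((integrable_one_div_disp_sq hm).const_mul _)
        (Eventually.of_forall fun κ => ?_)
      have e1 : J κ * E κ + 1 / (Complex.I * t) * S κ = (J κ +
          Complex.exp (Complex.I * (t * disp m κ : ℝ)) * c (disp m κ) / (Complex.I * t)) * E κ := by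
        simp only [hS, hE]
        rw [show Complex.I * ((t * disp m κ + ‖z‖ * κ : ℝ) : ℂ) =
          Complex.I * (t * disp m κ : ℝ) + Complex.I * (‖z‖ * κ : ℝ) by push_cast; ring,
          Complex.exp_add]
        ring
      rw [e1, norm_mul, en, mul_one]
      refine (hC₂ t ht0 (disp m κ) (le_disp m κ)).trans ?_
      have := hd0 κ
      gcongr
      exact le_abs_self _
    rw [e0, integral_radial_mul_exp_inner, hJ, integral_const_mul, norm_mul, hsplit]
    have hpi : ‖(2 * Real.pi : ℂ)‖ = 2 * Real.pi := by
      simp [abs_of_pos Real.pi_pos]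
    have hst : 1 ≤ √t := Real.one_le_sqrt.2 ht
    have hst2 : √t ≤ t := by nlinarith [Real.mul_self_sqrt ht0.le]
    rw [hpi, mul_div_assoc]
    refine mul_le_mul_of_nonneg_left ?_ (by positivity)
    refine (norm_sub_le _ _).trans ?_
    rw [norm_mul, norm_div, norm_mul, norm_one, Complex.norm_I, one_mul, Complex.norm_real,
      Real.norm_of_nonneg ht0.le, add_div]
    refine add_le_add (hrem.trans ?_) ?_
    · rw [div_mul_eq_mul_div, sq]
      gcongr
    · calc 1 / t * ‖∫ κ, S κ‖ ≤ 1 / t * (C₁ / √t) := by gcongr; exact hC₁ t ht0 ‖z‖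
        _ = _ := by field_simp
  refine ⟨2 * Real.pi * (|C₂| * B + C₁), fun t ht z => ?_⟩
  rcases le_or_gt 0 t with h | h
  · rw [abs_of_nonneg h] at ht ⊢
    exact pos t ht z
  · rw [abs_of_neg h] at ht ⊢
    -- Complex conjugation reverses the signs of both t and z.
    have := pos (-t) ht (-z)
    rw [← RCLike.norm_conj, ← integral_conj] at this
    refine le_trans (le_of_eq ?_) this
    congr 2
    ext k
    simp only [map_mul, ← Complex.exp_conj, Complex.conj_I, Complex.conj_ofReal, inner_neg_right]
    push_cast
    congr 2 <;> ring_nf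

end Kernel

/-! ### Amplitudes with bounded derivatives -/

section BoundedDerivatives

/-- `BddDerivOn m n f`: the function `f` is `n` times continuously differentiable on `[m, ∞)`, with
bounded derivatives. -/
def BddDerivOn (m : ℝ) : ℕ → (ℝ → ℝ) → Prop
  | 0, f => ContinuousOn f (Set.Ici m) ∧ ∃ C, ∀ w, m ≤ w → |f w| ≤ C
  | n + 1, f => (∃ C, ∀ w, m ≤ w → |f w| ≤ C) ∧
      ∃ f' : ℝ → ℝ, (∀ w, m ≤ w → HasDerivAt f (f' w) w) ∧ BddDerivOn m n f'

namespace BddDerivOn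

variable {m : ℝ} {n : ℕ} {f g : ℝ → ℝ}

theorem bdd (h : BddDerivOn m n f) : ∃ C, ∀ w, m ≤ w → |f w| ≤ C := by
  cases n with
  | zero => exact h.2
  | succ n => exact h.1

theorem continuousOn (h : BddDerivOn m n f) : ContinuousOn f (Set.Ici m) := by
  cases n with
  | zero => exact h.1
  | succ n =>
    obtain ⟨_, f', hf', _⟩ := h
    exact fun w hw => (hf' w hw).continuousAt.continuousWithinAt

theorem of_succ (h : BddDerivOn m (n + 1) f) : BddDerivOn m n f := by
  induction n generalizing f with
  | zero => exact ⟨h.continuousOn, h.bdd⟩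
  | succ n ih =>
    obtain ⟨hb, f', hf', hn⟩ := h
    exact ⟨hb, f', hf', ih hn⟩

theorem const (c : ℝ) : BddDerivOn m n fun _ => c := by
  induction n generalizing c with
  | zero => exact ⟨continuousOn_const, |c|, fun _ _ => le_rfl⟩
  | succ n ih => exact ⟨⟨|c|, fun _ _ => le_rfl⟩, fun _ => 0, fun w _ => hasDerivAt_const w c, ih 0⟩

theorem bdd_add (hf : ∃ C, ∀ w, m ≤ w → |f w| ≤ C) (hg : ∃ C, ∀ w, m ≤ w → |g w| ≤ C) :
    ∃ C, ∀ w, m ≤ w → |f w + g w| ≤ C := by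
  obtain ⟨C, hC⟩ := hf
  obtain ⟨D, hD⟩ := hg
  exact ⟨C + D, fun w hw => (abs_add_le _ _).trans (add_le_add (hC w hw) (hD w hw))⟩

theorem bdd_mul (hf : ∃ C, ∀ w, m ≤ w → |f w| ≤ C) (hg : ∃ C, ∀ w, m ≤ w → |g w| ≤ C) :
    ∃ C, ∀ w, m ≤ w → |f w * g w| ≤ C := by
  obtain ⟨C, hC⟩ := hf
  obtain ⟨D, hD⟩ := hg
  refine ⟨C * D, fun w hw => ?_⟩
  rw [abs_mul]
  exact mul_le_mul (hC w hw) (hD w hw) (abs_nonneg _) ((abs_nonneg _).trans (hC w hw))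

theorem add (hf : BddDerivOn m n f) (hg : BddDerivOn m n g) :
    BddDerivOn m n fun w => f w + g w := by
  induction n generalizing f g with
  | zero => exact ⟨hf.1.add hg.1, bdd_add hf.2 hg.2⟩
  | succ n ih =>
    obtain ⟨bf, f', hf', hfn⟩ := hf
    obtain ⟨bg, g', hg', hgn⟩ := hg
    exact ⟨bdd_add bf bg, _, fun w hw => (hf' w hw).add (hg' w hw), ih hfn hgn⟩

theorem mul (hf : BddDerivOn m n f) (hg : BddDerivOn m n g) :
    BddDerivOn m n fun w => f w * g w := by
  induction n generalizing f g with
  | zero => exact ⟨hf.1.mul hg.1, bdd_mul hf.2 hg.2⟩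
  | succ n ih =>
    have hf0 := hf.of_succ
    have hg0 := hg.of_succ
    obtain ⟨bf, f', hf', hfn⟩ := hf
    obtain ⟨bg, g', hg', hgn⟩ := hg
    exact ⟨bdd_mul bf bg, _, fun w hw => (hf' w hw).mul (hg' w hw),
      (ih hfn hg0).add (ih hf0 hgn)⟩

theorem neg (hf : BddDerivOn m n f) : BddDerivOn m n fun w => -f w := by
  simpa using (const (-1)).mul hf

theorem sub (hf : BddDerivOn m n f) (hg : BddDerivOn m n g) :
    BddDerivOn m n fun w => f w - g w := by
  simpa [sub_eq_add_neg] using hf.add hg.neg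

theorem pow (hf : BddDerivOn m n f) (k : ℕ) : BddDerivOn m n fun w => f w ^ k := by
  induction k with
  | zero => simpa using const 1
  | succ k ih => simpa [pow_succ] using ih.mul hf

theorem inv (hm : 0 < m) : BddDerivOn m n fun w => w⁻¹ := by
  have hb : ∃ C, ∀ w, m ≤ w → |w⁻¹| ≤ C := by
    refine ⟨m⁻¹, fun w hw => ?_⟩
    have := hm.trans_le hw
    rw [abs_of_pos (by positivity)]
    gcongr
  induction n with
  | zero =>
    exact ⟨continuousOn_inv₀.mono fun w hw => (hm.trans_le hw).ne', hb⟩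
  | succ n ih =>
    refine ⟨hb, _, fun w hw => hasDerivAt_inv (hm.trans_le hw).ne', ?_⟩
    simpa using (ih.pow 2).neg

end BddDerivOn

/-- The dispersion relation of mass `1` in terms of that of mass `m`. -/
def unitDisp (m w : ℝ) : ℝ := √(w ^ 2 + (1 - m ^ 2))

section UnitDisp

variable {m w : ℝ}

theorem sq_unitDisp (hm : 0 < m) (hw : m ≤ w) : unitDisp m w ^ 2 = w ^ 2 + (1 - m ^ 2) :=
  Real.sq_sqrt (by nlinarith)

theorem one_le_unitDisp (hm : 0 < m) (hw : m ≤ w) : 1 ≤ unitDisp m w :=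
  Real.one_le_sqrt.2 (by nlinarith)

theorem hasDerivAt_unitDisp (hm : 0 < m) (hw : m ≤ w) :
    HasDerivAt (unitDisp m) (w * (unitDisp m w)⁻¹) w := by
  have h0 : √(w ^ 2 + (1 - m ^ 2)) ≠ 0 := by
    have := one_le_unitDisp hm hw; unfold unitDisp at this; positivity
  have h1 : w ^ 2 + (1 - m ^ 2) ≠ 0 := by nlinarith
  refine ((((hasDerivAt_id w).pow 2).add_const (1 - m ^ 2)).sqrt (by simpa using h1)).congr_deriv ?_
  simp only [id, unitDisp, Pi.pow_apply]
  field_simp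
  simp

theorem bdd_inv_unitDisp (hm : 0 < m) : ∃ C, ∀ w, m ≤ w → |(unitDisp m w)⁻¹| ≤ C := by
  refine ⟨1, fun w hw => ?_⟩
  have h := one_le_unitDisp hm hw
  rw [abs_of_nonneg (by positivity)]
  exact inv_le_one_of_one_le₀ h

theorem bdd_mul_inv_unitDisp (hm : 0 < m) :
    ∃ C, ∀ w, m ≤ w → |w * (unitDisp m w)⁻¹| ≤ C := by
  refine ⟨1 + m, fun w hw => ?_⟩
  have h := one_le_unitDisp hm hw
  have hw0 := hm.trans_le hw
  have hs := sq_unitDisp hm hw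
  rw [abs_of_nonneg (by positivity), ← div_eq_mul_inv, div_le_iff₀ (by positivity)]
  refine abs_le_of_sq_le_sq' ?_ (by positivity) |>.2
  rw [mul_pow, hs]
  nlinarith [mul_nonneg hm.le (sub_nonneg.2 hw), mul_pos hm hw0,
    mul_nonneg (mul_nonneg hm.le hm.le) (mul_nonneg (sub_nonneg.2 hw) (by linarith : 0 ≤ w + m))]

theorem bdd_unitDisp_mul_inv (hm : 0 < m) :
    ∃ C, ∀ w, m ≤ w → |unitDisp m w * w⁻¹| ≤ C := by
  refine ⟨1 + 1 / m, fun w hw => ?_⟩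
  have h := one_le_unitDisp hm hw
  have hw0 := hm.trans_le hw
  have hs := sq_unitDisp hm hw
  rw [abs_of_nonneg (by positivity), ← div_eq_mul_inv, div_le_iff₀ (by positivity)]
  have h1 : w + 1 ≤ (1 + 1 / m) * w := by
    have : 1 ≤ 1 / m * w := by rw [one_div, inv_mul_eq_div, le_div_iff₀ hm]; linarith
    linarith
  refine le_trans ?_ h1
  refine abs_le_of_sq_le_sq' ?_ (by positivity) |>.2
  rw [hs]; nlinarith

/-- With u the unit dispersion, q = 1/u and v = w/u satisfy q' = -v q² and v' = q - v² q.
Differentiation stays in the algebra generated by the pair, so both claims need a single induction.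
-/
theorem bddDerivOn_inv_unitDisp_and (hm : 0 < m) (n : ℕ) :
    BddDerivOn m n (fun w => (unitDisp m w)⁻¹) ∧
      BddDerivOn m n (fun w => w * (unitDisp m w)⁻¹) := by
  have d1 : ∀ w, m ≤ w → HasDerivAt (fun w => (unitDisp m w)⁻¹)
      (-(w * (unitDisp m w)⁻¹ * (unitDisp m w)⁻¹ ^ 2)) w := fun w hw => by
    have h0 : unitDisp m w ≠ 0 := by have := one_le_unitDisp hm hw; positivity
    refine ((hasDerivAt_unitDisp hm hw).inv h0).congr_deriv ?_
    field_simp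
  have d2 : ∀ w, m ≤ w → HasDerivAt (fun w => w * (unitDisp m w)⁻¹)
      ((unitDisp m w)⁻¹ - (w * (unitDisp m w)⁻¹) ^ 2 * (unitDisp m w)⁻¹) w := fun w hw => by
    refine ((hasDerivAt_id w).mul (d1 w hw)).congr_deriv ?_
    simp only [id]
    ring
  induction n with
  | zero =>
    exact ⟨⟨fun w hw => (d1 w hw).continuousAt.continuousWithinAt, bdd_inv_unitDisp hm⟩,
      ⟨fun w hw => (d2 w hw).continuousAt.continuousWithinAt, bdd_mul_inv_unitDisp hm⟩⟩
  | succ n ih =>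
    exact ⟨⟨bdd_inv_unitDisp hm, _, d1, (ih.2.mul (ih.1.pow 2)).neg⟩,
      ⟨bdd_mul_inv_unitDisp hm, _, d2, ih.1.sub ((ih.2.pow 2).mul ih.1)⟩⟩

theorem bddDerivOn_unitDisp_mul_inv (hm : 0 < m) (n : ℕ) :
    BddDerivOn m n (fun w => unitDisp m w * w⁻¹) := by
  have d : ∀ w, m ≤ w → HasDerivAt (fun w => unitDisp m w * w⁻¹)
      ((unitDisp m w)⁻¹ - unitDisp m w * w⁻¹ * w⁻¹) w := fun w hw => by
    have hw0 := hm.trans_le hw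
    refine ((hasDerivAt_unitDisp hm hw).mul (hasDerivAt_inv hw0.ne')).congr_deriv ?_
    field_simp
    ring
  induction n with
  | zero => exact ⟨fun w hw => (d w hw).continuousAt.continuousWithinAt, bdd_unitDisp_mul_inv hm⟩
  | succ n ih =>
    exact ⟨bdd_unitDisp_mul_inv hm, _, d, (bddDerivOn_inv_unitDisp_and hm n).1.sub
      (ih.mul (BddDerivOn.inv hm))⟩

end UnitDisp

/-- The dispersive estimate for the low frequency part of an amplitude with bounded derivatives. -/
theorem norm_lowKernel_le {m : ℝ} (hm : 0 < m) {α : ℝ → ℝ} (hα : BddDerivOn m 2 α) :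
    (Integrable fun k : R3 => α (disp m ‖k‖) *
      (1 - (1 - m ^ 2 * (disp m ‖k‖)⁻¹ ^ 2) ^ 2) ^ 3) ∧
    ∃ C, 0 ≤ C ∧ ∀ t : ℝ, 1 ≤ |t| → ∀ z : R3,
      ‖∫ k : R3, (α (disp m ‖k‖) * (1 - (1 - m ^ 2 * (disp m ‖k‖)⁻¹ ^ 2) ^ 2) ^ 3 : ℝ) *
          Complex.exp (Complex.I * (t * disp m ‖k‖ : ℝ)) *
          Complex.exp (Complex.I * (inner ℝ k z : ℝ))‖ ≤ C / (|t| * √|t|) := by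
  have hinv : BddDerivOn m 2 fun w => w⁻¹ := BddDerivOn.inv hm
  -- From 1 - (1 - m²/w²)² = (m²/w²)(2 - m²/w²) the cube supplies w⁻⁶. One power is the denominator
  -- in `norm_kernel_le`, and the other five form the decay demanded of c.
  have hG : BddDerivOn m 2 fun w => m ^ 6 * (2 - m ^ 2 * w⁻¹ ^ 2) ^ 3 * α w :=
    ((BddDerivOn.const _).mul (((BddDerivOn.const 2).sub
      ((BddDerivOn.const _).mul (hinv.pow 2))).pow 3)).mul hα
  set G : ℝ → ℝ := fun w => m ^ 6 * (2 - m ^ 2 * w⁻¹ ^ 2) ^ 3 * α w with hGdef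
  -- Differentiation of w⁻⁵ g replaces g by g' - 5 g / w, so the factor w⁻⁵ persists and only
  -- boundedness of the cofactors matters.
  have dstep : ∀ {g g' : ℝ → ℝ} {w : ℝ}, m ≤ w → HasDerivAt g (g' w) w →
      HasDerivAt (fun w => w⁻¹ ^ 5 * g w) (w⁻¹ ^ 5 * (g' w - 5 * (w⁻¹ * g w))) w := by
    intro g g' w hw hg
    have hw0 := hm.trans_le hw
    refine (((hasDerivAt_inv hw0.ne').pow 5).mul hg).congr_deriv ?_
    change ((5 : ℕ) : ℝ) * w⁻¹ ^ 4 * (-(w ^ 2)⁻¹) * g w + w⁻¹ ^ 5 * g' w = _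
    field_simp
    push_cast
    ring
  have hbd : ∀ {g : ℝ → ℝ} {C K : ℝ}, C ≤ K → (∀ w, m ≤ w → |g w| ≤ C) →
      ∀ w, m ≤ w → |w⁻¹ ^ 5 * g w| ≤ K / w ^ 5 := by
    intro g C K hCK hg w hw
    have hw0 := hm.trans_le hw
    rw [abs_mul, abs_of_pos (by positivity), inv_pow, inv_mul_eq_div]
    gcongr
    exact (hg w hw).trans hCK
  obtain ⟨⟨C₀, hC₀⟩, G', hG', hG'2⟩ := hG
  have hG1 : BddDerivOn m 1 fun w => G' w - 5 * (w⁻¹ * G w) :=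
    hG'2.sub ((BddDerivOn.const 5).mul (hinv.of_succ.mul
      (BddDerivOn.of_succ ⟨⟨C₀, hC₀⟩, G', hG', hG'2⟩)))
  have hG1' := hG1
  obtain ⟨⟨C₁, hC₁⟩, G'', hG'', hG''2⟩ := hG1
  have hG2 : BddDerivOn m 0 fun w => G'' w - 5 * (w⁻¹ * (G' w - 5 * (w⁻¹ * G w))) :=
    hG''2.sub ((BddDerivOn.const 5).mul (hinv.of_succ.of_succ.mul hG1'.of_succ))
  obtain ⟨hcont, C₂, hC₂⟩ := hG2
  set K := max C₀ (max C₁ C₂) with hK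
  have b0 := hbd (K := K) (le_max_left _ _) hC₀
  have b1 := hbd (K := K) ((le_max_left _ _).trans (le_max_right _ _)) hC₁
  have b2 := hbd (K := K) ((le_max_right _ _).trans (le_max_right _ _)) hC₂
  have d0 := fun w (hw : m ≤ w) => dstep hw (hG' w hw)
  have d1 := fun w (hw : m ≤ w) => dstep hw (hG'' w hw)
  have hcc : ContinuousOn
      (fun w => w⁻¹ ^ 5 * (G'' w - 5 * (w⁻¹ * (G' w - 5 * (w⁻¹ * G w))))) (Set.Ici m) :=
    (hinv.continuousOn.pow 5).mul hcont
  have e : ∀ k : R3, (disp m ‖k‖)⁻¹ ^ 5 * G (disp m ‖k‖) / disp m ‖k‖ =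
      α (disp m ‖k‖) * (1 - (1 - m ^ 2 * (disp m ‖k‖)⁻¹ ^ 2) ^ 2) ^ 3 := fun k => by
    simp only [hGdef, div_eq_mul_inv]
    ring
  obtain ⟨C, hC⟩ := norm_kernel_le hm d0 d1 hcc b0 b1 b2
  have hint := integrable_disp_norm hm
    (fun w hw => (d0 w hw).continuousAt.continuousWithinAt) b0
  simp only [e] at hC hint
  refine ⟨hint, |C|, abs_nonneg _, fun t ht z => (hC t ht z).trans ?_⟩
  gcongr
  exact le_abs_self _

end BoundedDerivatives

/-! ### Frequency and group velocity on `ℝ³` -/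

/-- The dispersion relation of the Klein-Gordon equation as a function of the frequency. -/
def omega (m : ℝ) (ξ : R3) : ℝ := disp m ‖(2 * Real.pi) • ξ‖

/-- The coordinate vectors of `ℝ³`. -/
abbrev coordVec (j : Fin 3) : R3 := EuclideanSpace.single j (1 : ℝ)

/-- The components of the group velocity. -/
def velocity (m : ℝ) (j : Fin 3) (ξ : R3) : ℝ := 2 * Real.pi * ξ j * (omega m ξ)⁻¹

section Omega

variable {m : ℝ}

theorem omega_pos (hm : 0 < m) (ξ : R3) : 0 < omega m ξ := disp_pos hm _

theorem le_omega (m : ℝ) (ξ : R3) : m ≤ omega m ξ := le_disp m _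

theorem sq_omega (m : ℝ) (ξ : R3) : omega m ξ ^ 2 = m ^ 2 + (2 * Real.pi) ^ 2 * ‖ξ‖ ^ 2 := by
  rw [omega, sq_disp, norm_smul, Real.norm_of_nonneg (by positivity), mul_pow]

theorem continuous_omega (m : ℝ) : Continuous (omega m) := by
  unfold omega
  exact (continuous_disp m).comp (by fun_prop)

theorem hasFDerivAt_omega (hm : 0 < m) (ξ : R3) :
    HasFDerivAt (omega m) (((2 * Real.pi) ^ 2 * (omega m ξ)⁻¹) • innerSL ℝ ξ) ξ := by
  have e : omega m = fun ξ => √(m ^ 2 + (2 * Real.pi) ^ 2 * ‖ξ‖ ^ 2) := by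
    ext ξ
    rw [← sq_omega, Real.sqrt_sq (omega_pos hm ξ).le]
  have h1 : HasFDerivAt (fun ξ : R3 => m ^ 2 + (2 * Real.pi) ^ 2 * ‖ξ‖ ^ 2)
      ((2 * Real.pi) ^ 2 • (2 • innerSL ℝ ξ)) ξ :=
    (((hasStrictFDerivAt_norm_sq ξ).hasFDerivAt).const_mul _).const_add _
  have h2 := h1.sqrt (by positivity)
  rw [e]
  refine h2.congr_fderiv ?_
  ext h
  simp
  field_simp

theorem fderiv_omega_coordVec (hm : 0 < m) (ξ : R3) (j : Fin 3) :
    fderiv ℝ (omega m) ξ (coordVec j) = 2 * Real.pi * velocity m j ξ := by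
  rw [(hasFDerivAt_omega hm ξ).fderiv]
  simp [velocity, coordVec, EuclideanSpace.inner_single_right]
  ring

theorem abs_velocity_le (hm : 0 < m) (j : Fin 3) (ξ : R3) : |velocity m j ξ| ≤ 1 := by
  have h0 := omega_pos hm ξ
  rw [velocity, abs_mul, abs_inv, abs_of_pos h0, ← div_eq_mul_inv, div_le_one h0]
  refine abs_le_of_sq_le_sq ?_ h0.le
  rw [sq_omega, mul_pow]
  have : ξ j ^ 2 ≤ ‖ξ‖ ^ 2 := by
    have := PiLp.norm_apply_le ξ j
    rw [← sq_abs, ← Real.norm_eq_abs]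
    gcongr
  nlinarith [sq_nonneg m, mul_le_mul_of_nonneg_left this (sq_nonneg (2 * Real.pi))]

/-- Since the squared speed is a function of ω alone, the factor separating low from high
frequencies is radial. It shows that 1 - |v|⁴ is O(ω⁻²). -/
theorem sum_sq_velocity (hm : 0 < m) (ξ : R3) :
    ∑ j, velocity m j ξ ^ 2 = 1 - m ^ 2 * (omega m ξ)⁻¹ ^ 2 := by
  have h0 := omega_pos hm ξ
  have h1 := sq_omega m ξ
  rw [EuclideanSpace.norm_sq_eq] at h1
  simp only [Real.norm_eq_abs, sq_abs, Fin.sum_univ_three] at h1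
  simp only [velocity, Fin.sum_univ_three]
  field_simp
  linarith

end Omega

/-! ### Symbols with bounded partial derivatives -/

section BddPartials

/-- `BddPartials n f`: the function `f` is differentiable `n` times in the coordinate directions,
with bounded continuous partial derivatives. -/
def BddPartials : ℕ → (R3 → ℝ) → Prop
  | 0, f => Continuous f ∧ ∃ C, ∀ ξ, |f ξ| ≤ C
  | n + 1, f => Differentiable ℝ f ∧ (∃ C, ∀ ξ, |f ξ| ≤ C) ∧
      ∀ j, BddPartials n fun ξ => fderiv ℝ f ξ (coordVec j)

namespace BddPartials

variable {n : ℕ} {f g : R3 → ℝ}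

theorem bdd (h : BddPartials n f) : ∃ C, ∀ ξ, |f ξ| ≤ C := by
  cases n with
  | zero => exact h.2
  | succ n => exact h.2.1

theorem continuous (h : BddPartials n f) : Continuous f := by
  cases n with
  | zero => exact h.1
  | succ n => exact h.1.continuous

theorem of_succ (h : BddPartials (n + 1) f) : BddPartials n f := by
  induction n generalizing f with
  | zero => exact ⟨h.continuous, h.bdd⟩
  | succ n ih => exact ⟨h.1, h.2.1, fun j => ih (h.2.2 j)⟩

theorem const (c : ℝ) : BddPartials n fun _ => c := by
  induction n generalizing c with
  | zero => exact ⟨continuous_const, |c|, fun _ => le_rfl⟩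
  | succ n ih => exact ⟨differentiable_const c, ⟨|c|, fun _ => le_rfl⟩, fun j => by simpa using ih 0⟩

theorem bdd_add (hf : ∃ C, ∀ ξ, |f ξ| ≤ C) (hg : ∃ C, ∀ ξ, |g ξ| ≤ C) :
    ∃ C, ∀ ξ, |f ξ + g ξ| ≤ C := by
  obtain ⟨C, hC⟩ := hf
  obtain ⟨D, hD⟩ := hg
  exact ⟨C + D, fun ξ => (abs_add_le _ _).trans (add_le_add (hC ξ) (hD ξ))⟩

theorem bdd_mul (hf : ∃ C, ∀ ξ, |f ξ| ≤ C) (hg : ∃ C, ∀ ξ, |g ξ| ≤ C) :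
    ∃ C, ∀ ξ, |f ξ * g ξ| ≤ C := by
  obtain ⟨C, hC⟩ := hf
  obtain ⟨D, hD⟩ := hg
  refine ⟨C * D, fun ξ => ?_⟩
  rw [abs_mul]
  exact mul_le_mul (hC ξ) (hD ξ) (abs_nonneg _) ((abs_nonneg _).trans (hC ξ))

theorem add (hf : BddPartials n f) (hg : BddPartials n g) :
    BddPartials n fun ξ => f ξ + g ξ := by
  induction n generalizing f g with
  | zero => exact ⟨hf.1.add hg.1, bdd_add hf.2 hg.2⟩
  | succ n ih =>
    refine ⟨hf.1.add hg.1, bdd_add hf.2.1 hg.2.1, fun j => ?_⟩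
    have : (fun ξ => fderiv ℝ (fun ξ => f ξ + g ξ) ξ (coordVec j)) =
        fun ξ => fderiv ℝ f ξ (coordVec j) + fderiv ℝ g ξ (coordVec j) := by
      ext ξ
      rw [fderiv_fun_add (hf.1 ξ) (hg.1 ξ)]; rfl
    rw [this]
    exact ih (hf.2.2 j) (hg.2.2 j)

theorem fderiv_mul_coordVec (hf : Differentiable ℝ f) (hg : Differentiable ℝ g) (ξ h : R3) :
    fderiv ℝ (fun ξ => f ξ * g ξ) ξ h = f ξ * fderiv ℝ g ξ h + fderiv ℝ f ξ h * g ξ := by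
  rw [fderiv_fun_mul (hf ξ) (hg ξ)]
  simp [mul_comm]

theorem mul (hf : BddPartials n f) (hg : BddPartials n g) :
    BddPartials n fun ξ => f ξ * g ξ := by
  induction n generalizing f g with
  | zero => exact ⟨hf.1.mul hg.1, bdd_mul hf.2 hg.2⟩
  | succ n ih =>
    refine ⟨hf.1.mul hg.1, bdd_mul hf.2.1 hg.2.1, fun j => ?_⟩
    simp only [fderiv_mul_coordVec hf.1 hg.1]
    exact (ih hf.of_succ (hg.2.2 j)).add (ih (hf.2.2 j) hg.of_succ)

theorem neg (hf : BddPartials n f) : BddPartials n fun ξ => -f ξ := by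
  simpa using (const (-1)).mul hf

theorem sub (hf : BddPartials n f) (hg : BddPartials n g) :
    BddPartials n fun ξ => f ξ - g ξ := by
  simpa [sub_eq_add_neg] using hf.add hg.neg

theorem pow (hf : BddPartials n f) (k : ℕ) : BddPartials n fun ξ => f ξ ^ k := by
  induction k with
  | zero => simpa using const 1
  | succ k ih => simpa [pow_succ] using ih.mul hf

variable {m : ℝ}

/-- The formulas ∂ₗ ω⁻¹ = -2π vₗ ω⁻² and ∂ₗ vⱼ = 2π (δⱼₗ - vⱼ vₗ) ω⁻¹ keep derivatives inside the
algebra generated by ω⁻¹ and the bounded velocities. This again forces a joint induction. -/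
theorem inv_omega_and_velocity (hm : 0 < m) (n : ℕ) :
    BddPartials n (fun ξ => (omega m ξ)⁻¹) ∧ ∀ j, BddPartials n (velocity m j) := by
  have hid : Differentiable ℝ fun ξ => (omega m ξ)⁻¹ := fun ξ =>
    ((hasDerivAt_inv (omega_pos hm ξ).ne').comp_hasFDerivAt ξ
      (hasFDerivAt_omega hm ξ)).differentiableAt
  have hd : ∀ j, Differentiable ℝ (velocity m j) := fun j => by
    unfold velocity
    exact (by fun_prop : Differentiable ℝ fun ξ : R3 => 2 * Real.pi * ξ j).mul hid
  have hi : ∀ l ξ, fderiv ℝ (fun ξ : R3 => (omega m ξ)⁻¹) ξ (coordVec l) =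
      -(2 * Real.pi * (velocity m l ξ * (omega m ξ)⁻¹ ^ 2)) := fun l ξ => by
    have := (hasDerivAt_inv (omega_pos hm ξ).ne').comp_hasFDerivAt ξ (hasFDerivAt_omega hm ξ)
    have e2 : (fun ξ => (omega m ξ)⁻¹) = (fun y => y⁻¹) ∘ omega m := rfl
    rw [e2, this.fderiv, ← (hasFDerivAt_omega hm ξ).fderiv]
    simp only [smul_apply, fderiv_omega_coordVec hm, smul_eq_mul]
    rw [inv_pow]; ring
  have hv : ∀ (j l : Fin 3) ξ, fderiv ℝ (velocity m j) ξ (coordVec l) =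
      2 * Real.pi * ((if j = l then 1 else 0) * (omega m ξ)⁻¹) - 2 * Real.pi *
        (velocity m j ξ * velocity m l ξ * (omega m ξ)⁻¹) := by
    intro j l ξ
    have hc : Differentiable ℝ fun ξ : R3 => 2 * Real.pi * ξ j := by fun_prop
    have e : velocity m j = fun ξ => (2 * Real.pi * ξ j) * (omega m ξ)⁻¹ := rfl
    have h1 : fderiv ℝ (fun ξ : R3 => 2 * Real.pi * ξ j) ξ (coordVec l) =
        2 * Real.pi * (if j = l then 1 else 0) := by
      have : HasFDerivAt (fun ξ : R3 => 2 * Real.pi * ξ j)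
          ((2 * Real.pi) • (EuclideanSpace.proj j : R3 →L[ℝ] ℝ)) ξ :=
        ((EuclideanSpace.proj j : R3 →L[ℝ] ℝ).hasFDerivAt).const_mul _
      rw [this.fderiv]
      simp [coordVec]
    rw [e, fderiv_mul_coordVec hc hid, h1, hi]
    simp only [velocity]
    ring
  have hib : ∃ C, ∀ ξ, |(omega m ξ)⁻¹| ≤ C := by
    refine ⟨m⁻¹, fun ξ => ?_⟩
    rw [abs_of_pos (inv_pos.2 (omega_pos hm ξ))]
    exact inv_anti₀ hm (le_omega m ξ)
  have hb : ∀ j, ∃ C, ∀ ξ, |velocity m j ξ| ≤ C := fun j => ⟨1, abs_velocity_le hm j⟩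
  induction n with
  | zero => exact ⟨⟨hid.continuous, hib⟩, fun j => ⟨(hd j).continuous, hb j⟩⟩
  | succ n ih =>
    refine ⟨⟨hid, hib, fun l => ?_⟩, fun j => ⟨hd j, hb j, fun l => ?_⟩⟩
    · simp only [hi l]
      exact ((const _).mul ((ih.2 l).mul (ih.1.pow 2))).neg
    · simp only [hv j l]
      exact ((const _).mul ((const _).mul ih.1)).sub
        ((const _).mul (((ih.2 j).mul (ih.2 l)).mul ih.1))

theorem comp_omega (hm : 0 < m) {α : ℝ → ℝ} (hα : BddDerivOn m n α) :
    BddPartials n fun ξ => α (omega m ξ) := by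
  have hb : ∀ {n : ℕ} {α : ℝ → ℝ}, BddDerivOn m n α → ∃ C, ∀ ξ, |α (omega m ξ)| ≤ C := by
    intro n α h
    obtain ⟨C, hC⟩ := h.bdd
    exact ⟨C, fun ξ => hC _ (le_omega m ξ)⟩
  induction n generalizing α with
  | zero =>
    exact ⟨hα.continuousOn.comp_continuous (continuous_omega m) fun ξ => le_omega m ξ, hb hα⟩
  | succ n ih =>
    have hb' := hb hα
    obtain ⟨_, α', hα', hn⟩ := hα
    have h1 := fun ξ => (hα' _ (le_omega m ξ)).comp_hasFDerivAt ξ (hasFDerivAt_omega hm ξ)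
    refine ⟨fun ξ => (h1 ξ).differentiableAt, hb', fun j => ?_⟩
    have : (fun ξ => fderiv ℝ (fun ξ => α (omega m ξ)) ξ (coordVec j)) =
        fun ξ => α' (omega m ξ) * (2 * Real.pi * velocity m j ξ) := by
      ext ξ
      have e2 : (fun ξ => α (omega m ξ)) = α ∘ omega m := rfl
      rw [e2, (h1 ξ).fderiv, ← (hasFDerivAt_omega hm ξ).fderiv]
      simp only [smul_apply, fderiv_omega_coordVec hm, smul_eq_mul]
    rw [this]
    exact (ih hn).mul ((const _).mul ((inv_omega_and_velocity hm n).2 j))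

end BddPartials

end BddPartials

/-! ### The oscillatory bilinear form and integration by parts -/

section Form

variable {m : ℝ}

/-- The oscillating factor `exp (i t ω)`. -/
def phase (m t : ℝ) (ξ : R3) : ℂ := Complex.exp (Complex.I * (t * omega m ξ : ℝ))

theorem norm_phase (m t : ℝ) (ξ : R3) : ‖phase m t ξ‖ = 1 := by
  rw [phase, mul_comm, Complex.norm_exp_ofReal_mul_I]

theorem continuous_phase (m t : ℝ) : Continuous (phase m t) := by
  have := continuous_omega m
  unfold phase
  fun_prop

theorem hasFDerivAt_phase (hm : 0 < m) (t : ℝ) (ξ : R3) :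
    HasFDerivAt (phase m t) ((phase m t ξ * Complex.I * t) •
      (Complex.ofRealCLM.comp (fderiv ℝ (omega m) ξ))) ξ := by
  have h1 := (hasFDerivAt_omega hm ξ)
  rw [h1.fderiv]
  have h2 := Complex.ofRealCLM.hasFDerivAt.comp ξ (h1.const_mul t)
  have h3 := (h2.const_mul Complex.I).cexp
  refine h3.congr_fderiv ?_
  ext h
  simp [phase]
  ring

/-- The bilinear form `∫ exp (i t ω) c (𝓕⁻¹ f) (𝓕 g)`. -/
def form (m t : ℝ) (c : R3 → ℝ) (f g : 𝓢(R3, ℂ)) : ℂ :=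
  ∫ ξ, phase m t ξ * c ξ * (𝓕⁻ f ξ * 𝓕 g ξ)

theorem integrable_mul_schwartz {a : R3 → ℂ} (ha : Continuous a) {C : ℝ} (hC : ∀ ξ, ‖a ξ‖ ≤ C)
    (F G : 𝓢(R3, ℂ)) : Integrable fun ξ => a ξ * (F ξ * G ξ) := by
  have h2 : Integrable fun ξ => F ξ * G ξ := by
    obtain ⟨D, hD⟩ : ∃ D, ∀ x, ‖G x‖ ≤ D := ⟨_, fun x => SchwartzMap.norm_le_seminorm ℝ G x⟩
    exact F.integrable.mul_bdd G.continuous.aestronglyMeasurable (Eventually.of_forall hD)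
  exact h2.bdd_mul ha.aestronglyMeasurable (Eventually.of_forall hC)

theorem norm_integral_mul_schwartz_le {a : R3 → ℂ} {C : ℝ}
    (hC : ∀ ξ, ‖a ξ‖ ≤ C) (F G : 𝓢(R3, ℂ)) :
    ‖∫ ξ, a ξ * (F ξ * G ξ)‖ ≤ C * (l2norm F * l2norm G) := by
  have hC0 : 0 ≤ C := (norm_nonneg _).trans (hC 0)
  have h1 : ‖∫ ξ, a ξ * (F ξ * G ξ)‖ₑ ≤ ENNReal.ofReal C * (eLpNorm F 2 volume * eLpNorm G 2 volume) := by
    refine (enorm_integral_le_lintegral_enorm _).trans ?_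
    have h := eLpNorm_smul_le_mul_eLpNorm (p := 2) (q := 2) (r := 1) (μ := (volume : Measure R3))
      (G.continuous.aestronglyMeasurable) (F.continuous.aestronglyMeasurable)
    rw [eLpNorm_one_eq_lintegral_enorm] at h
    calc ∫⁻ ξ, ‖a ξ * (F ξ * G ξ)‖ₑ ≤ ∫⁻ ξ, ENNReal.ofReal C * ‖(⇑F • ⇑G) ξ‖ₑ := by
          refine lintegral_mono fun ξ => ?_
          rw [enorm_mul]
          gcongr
          · rw [← ofReal_norm]; exact ENNReal.ofReal_le_ofReal (hC ξ)
          · rfl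
      _ = ENNReal.ofReal C * ∫⁻ ξ, ‖(⇑F • ⇑G) ξ‖ₑ :=
          lintegral_const_mul' _ _ ENNReal.ofReal_ne_top
      _ ≤ _ := by gcongr
  rw [← ofReal_l2norm, ← ofReal_l2norm, ← ENNReal.ofReal_mul (l2norm_nonneg _),
    ← ENNReal.ofReal_mul hC0, ← ofReal_norm] at h1
  exact (ENNReal.ofReal_le_ofReal_iff (mul_nonneg hC0
    (mul_nonneg (l2norm_nonneg _) (l2norm_nonneg _)))).1 h1

/-- Plancherel, with a constant independent of t. It serves small times, the tails beyond the
spatial cutoff, and the terms without oscillation gain. -/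
theorem norm_form_le (m t : ℝ) {c : R3 → ℝ} {C : ℝ} (hC : ∀ ξ, |c ξ| ≤ C) (f g : 𝓢(R3, ℂ)) :
    ‖form m t c f g‖ ≤ C * (l2norm f * l2norm g) := by
  rw [form, ← l2norm_fourierInv f, ← l2norm_fourier g]
  refine norm_integral_mul_schwartz_le (fun ξ => ?_) _ _
  rw [norm_mul, norm_phase, one_mul, Complex.norm_real]
  exact hC ξ

/-- Multiplication of a Schwartz function with a coordinate. -/
def mulCoord (j : Fin 3) : 𝓢(R3, ℂ) →L[ℂ] 𝓢(R3, ℂ) :=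
  SchwartzMap.smulLeftCLM ℂ fun x : R3 => (inner ℝ x (coordVec j) : ℂ)

theorem mulCoord_apply (j : Fin 3) (f : 𝓢(R3, ℂ)) (x : R3) : mulCoord j f x = x j * f x := by
  have hT : (fun x : R3 => (inner ℝ x (coordVec j) : ℂ)).HasTemperateGrowth :=
    Function.Complex.hasTemperateGrowth_ofReal.comp
      (Function.hasTemperateGrowth_inner_left (coordVec j))
  rw [mulCoord, SchwartzMap.smulLeftCLM_apply_apply hT]
  simp [EuclideanSpace.inner_single_right]

theorem mulCoord_eq (j : Fin 3) (f : 𝓢(R3, ℂ)) :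
    mulCoord j f = SchwartzMap.smulLeftCLM ℂ (inner ℝ · (coordVec j)) f :=
  SchwartzMap.smulLeftCLM_ofReal ℂ (Function.hasTemperateGrowth_inner_left (coordVec j)) f

theorem fderiv_fourier (f : 𝓢(R3, ℂ)) (j : Fin 3) (ξ : R3) :
    fderiv ℝ ⇑(𝓕 f : 𝓢(R3, ℂ)) ξ (coordVec j) = -(2 * Real.pi * Complex.I) * 𝓕 (mulCoord j f) ξ := by
  have := SchwartzMap.lineDerivOp_fourier_eq f (coordVec j)
  rw [← mulCoord_eq] at this
  rw [← SchwartzMap.lineDerivOp_apply_eq_fderiv, this, FourierTransform.fourier_smul]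
  rfl

theorem fderiv_fourierInv (f : 𝓢(R3, ℂ)) (j : Fin 3) (ξ : R3) :
    fderiv ℝ ⇑(𝓕⁻ f : 𝓢(R3, ℂ)) ξ (coordVec j) = (2 * Real.pi * Complex.I) * 𝓕⁻ (mulCoord j f) ξ := by
  have := SchwartzMap.lineDerivOp_fourierInv_eq f (coordVec j)
  rw [← mulCoord_eq] at this
  rw [← SchwartzMap.lineDerivOp_apply_eq_fderiv, this, FourierTransform.fourierInv_smul]
  rfl

/-- Integration by parts in the form, which gains a factor `t`. -/
theorem form_velocity_mul (hm : 0 < m) (t : ℝ) (j : Fin 3) {c : R3 → ℝ} (hc : BddPartials 1 c)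
    (f g : 𝓢(R3, ℂ)) :
    2 * Real.pi * Complex.I * t * form m t (fun ξ => velocity m j ξ * c ξ) f g =
      -form m t (fun ξ => fderiv ℝ c ξ (coordVec j)) f g
      - 2 * Real.pi * Complex.I * form m t c (mulCoord j f) g
      + 2 * Real.pi * Complex.I * form m t c f (mulCoord j g) := by
  obtain ⟨hcd, ⟨C, hC⟩, hc'⟩ := hc
  obtain ⟨hc'c, C', hC'⟩ := hc' j
  have hpc := continuous_phase m t
  have hvc := ((BddPartials.inv_omega_and_velocity hm 0).2 j).continuous
  have hcc := hcd.continuous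
  have I : ∀ {a : R3 → ℝ}, Continuous a → (∃ C, ∀ ξ, |a ξ| ≤ C) → ∀ F G : 𝓢(R3, ℂ),
      Integrable fun ξ => phase m t ξ * a ξ * (F ξ * G ξ) := by
    intro a ha hb F G
    obtain ⟨C, hC⟩ := hb
    refine integrable_mul_schwartz (by fun_prop) (C := C) (fun ξ => ?_) F G
    rw [norm_mul, norm_phase, one_mul, Complex.norm_real]
    exact hC ξ
  set F : 𝓢(R3, ℂ) := 𝓕⁻ f with hF
  set G : 𝓢(R3, ℂ) := 𝓕 g with hG
  set F' : 𝓢(R3, ℂ) := 𝓕⁻ (mulCoord j f) with hF'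
  set G' : 𝓢(R3, ℂ) := 𝓕 (mulCoord j g) with hG'
  have dF : ∀ ξ, fderiv ℝ F ξ (coordVec j) = 2 * Real.pi * Complex.I * F' ξ := fderiv_fourierInv f j
  have dG : ∀ ξ, fderiv ℝ G ξ (coordVec j) = -(2 * Real.pi * Complex.I) * G' ξ :=
    fderiv_fourier g j
  set P : R3 → ℂ := fun ξ => c ξ * (F ξ * G ξ) with hP
  have dP : ∀ ξ, HasFDerivAt P ((c ξ : ℂ) • ((F ξ) • fderiv ℝ G ξ +
      (G ξ) • fderiv ℝ F ξ) + (F ξ * G ξ) •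
        Complex.ofRealCLM.comp (fderiv ℝ c ξ)) ξ := fun ξ =>
    (Complex.ofRealCLM.hasFDerivAt.comp ξ (hcd ξ).hasFDerivAt).mul
      ((F.hasFDerivAt ξ).mul (G.hasFDerivAt ξ))
  have eP : ∀ ξ, fderiv ℝ P ξ (coordVec j) * phase m t ξ =
      phase m t ξ * (fderiv ℝ c ξ (coordVec j) : ℝ) * (F ξ * G ξ) +
      2 * Real.pi * Complex.I * (phase m t ξ * c ξ * (F' ξ * G ξ)) -
      2 * Real.pi * Complex.I * (phase m t ξ * c ξ * (F ξ * G' ξ)) := fun ξ => by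
    rw [(dP ξ).fderiv]
    simp only [add_apply, smul_apply, smul_eq_mul, dF, dG,
      ContinuousLinearMap.comp_apply, Complex.ofRealCLM_apply]
    ring
  -- The derivative of exp(itω) along the j-th axis is 2πi t vⱼ exp(itω); the velocity factor in the
  -- symbol is what makes this step possible without dividing by vⱼ.
  have eQ : ∀ ξ, P ξ * fderiv ℝ (phase m t) ξ (coordVec j) =
      2 * Real.pi * Complex.I * t *
        (phase m t ξ * (velocity m j ξ * c ξ : ℝ) * (F ξ * G ξ)) := fun ξ => by
    rw [(hasFDerivAt_phase hm t ξ).fderiv]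
    simp only [smul_apply, smul_eq_mul, ContinuousLinearMap.comp_apply, Complex.ofRealCLM_apply,
      fderiv_omega_coordVec hm, hP]
    push_cast
    ring
  have i1 := I hc'c ⟨C', hC'⟩ F G
  have i2 := (I hcc ⟨C, hC⟩ F' G).const_mul (2 * Real.pi * Complex.I)
  have i3 := (I hcc ⟨C, hC⟩ F G').const_mul (2 * Real.pi * Complex.I)
  have i4 := (I (hvc.mul hcc) (BddPartials.bdd_mul ⟨1, abs_velocity_le hm j⟩ ⟨C, hC⟩)
    F G).const_mul (2 * Real.pi * Complex.I * t)
  have i5 := I hcc ⟨C, hC⟩ F G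
  have key := integral_mul_fderiv_eq_neg_fderiv_mul_of_integrable (μ := (volume : Measure R3))
    (f := P) (g := phase m t) (v := coordVec j)
    (by simp only [eP]; exact (i1.add i2).sub i3) (by simp only [eQ]; exact i4)
    (i5.congr (Eventually.of_forall fun ξ => by simp only [hP]; ring))
    (fun ξ _ => (dP ξ).differentiableAt) (fun ξ _ => (hasFDerivAt_phase hm t ξ).differentiableAt)
  simp only [eP, eQ] at key
  have s1 : ∀ (a b d : R3 → ℂ), Integrable a → Integrable b → Integrable d →
      (∫ ξ, (a ξ + b ξ - d ξ)) = (∫ ξ, a ξ) + (∫ ξ, b ξ) - ∫ ξ, d ξ := by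
    intro a b d ha hb hd
    rw [← integral_add ha hb]
    exact integral_sub (ha.add hb) hd
  rw [s1 _ _ _ i1 i2 i3, integral_const_mul, integral_const_mul, integral_const_mul] at key
  simp only [form]
  rw [← hF, ← hG, ← hF', ← hG', key]
  ring

end Form

/-! ### Low frequencies: from `L¹` to `L^∞` -/

section LowFrequency

/-- A Fourier multiplier with bounded kernel, tested with integrable functions. -/
theorem norm_integral_symbol_le {s : R3 → ℂ} (hs : Integrable s) {M : ℝ}
    (hM : ∀ z : R3, ‖∫ ξ, s ξ * Complex.exp (Complex.I * (inner ℝ ((2 * Real.pi) • ξ) z : ℝ))‖ ≤ M)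
    (f g : 𝓢(R3, ℂ)) :
    ‖∫ ξ, s ξ * (𝓕⁻ f ξ * 𝓕 g ξ)‖ ≤ M * (∫ x, ‖f x‖) * ∫ x, ‖g x‖ := by
  set F : 𝓢(R3, ℂ) := 𝓕⁻ f with hF
  obtain ⟨D, hD⟩ : ∃ D, ∀ x, ‖F x‖ ≤ D := ⟨_, fun x => SchwartzMap.norm_le_seminorm ℝ F x⟩
  have bddF : ∀ {s : R3 → ℂ}, Integrable s → Integrable fun ξ => s ξ * F ξ := fun hs =>
    hs.mul_bdd F.continuous.aestronglyMeasurable (Eventually.of_forall hD)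
  have h1 : ∫ ξ, s ξ * (F ξ * 𝓕 g ξ) = ∫ x, g x * 𝓕 (fun ξ => s ξ * F ξ) x := by
    have := VectorFourier.integral_fourierIntegral_smul_eq_flip (L := innerₗ R3) (μ := volume)
      (ν := volume) Real.continuous_fourierChar continuous_inner g.integrable (bddF hs)
    rw [flip_innerₗ] at this
    refine Eq.trans ?_ this
    refine integral_congr_ae (Eventually.of_forall fun ξ => ?_)
    change s ξ * (F ξ * 𝓕 g ξ) = 𝓕 (g : R3 → ℂ) ξ * (s ξ * F ξ)
    rw [SchwartzMap.fourier_coe]; ring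
  have h2 : ∀ x, ‖𝓕 (fun ξ => s ξ * F ξ) x‖ ≤ M * ∫ y, ‖f y‖ := by
    intro x
    -- Evaluation of the transform at x is absorbed into the symbol as a modulation; the inverse
    -- transform at y is then the kernel at y - x.
    set sx : R3 → ℂ := fun ξ => Complex.exp (Complex.I * (-inner ℝ ((2 * Real.pi) • ξ) x : ℝ)) * s ξ
      with hsx
    have hsxi : Integrable sx := by
      refine hs.bdd_mul (c := 1) (Continuous.aestronglyMeasurable (by fun_prop))
        (Eventually.of_forall fun ξ => ?_)
      rw [mul_comm, Complex.norm_exp_ofReal_mul_I]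
    have e1 : 𝓕 (fun ξ => s ξ * F ξ) x = ∫ ξ, F ξ * sx ξ := by
      rw [Real.fourier_eq']
      refine integral_congr_ae (Eventually.of_forall fun ξ => ?_)
      simp only [hsx, smul_eq_mul, inner_smul_left]
      rw [show ((-2 * Real.pi * inner ℝ ξ x : ℝ) : ℂ) * Complex.I =
        Complex.I * ((-((2 * Real.pi) * inner ℝ ξ x) : ℝ) : ℂ) by push_cast; ring]
      simp only [RCLike.conj_to_real]
      ring
    have e2 : ∫ ξ, F ξ * sx ξ = ∫ y, f y * 𝓕⁻ sx y := by
      have := VectorFourier.integral_fourierIntegral_smul_eq_flip (L := -innerₗ R3) (μ := volume)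
        (ν := volume) Real.continuous_fourierChar (by simp only [LinearMap.neg_apply]; exact continuous_inner.neg) f.integrable hsxi
      have hflip : (-innerₗ R3).flip = -innerₗ R3 := by
        ext x y; simp [real_inner_comm]
      rw [hflip] at this
      refine Eq.trans ?_ this
      refine integral_congr_ae (Eventually.of_forall fun ξ => ?_)
      change F ξ * sx ξ = 𝓕⁻ (f : R3 → ℂ) ξ * sx ξ
      rw [hF, SchwartzMap.fourierInv_coe]
    have e3 : ∀ y, ‖𝓕⁻ sx y‖ ≤ M := by
      intro y
      rw [Real.fourierInv_eq']
      refine le_trans (le_of_eq ?_) (hM (y - x))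
      congr 1
      refine integral_congr_ae (Eventually.of_forall fun ξ => ?_)
      simp only [hsx, smul_eq_mul, inner_sub_right, inner_smul_left, RCLike.conj_to_real]
      rw [← mul_assoc, ← Complex.exp_add, mul_comm]
      congr 2
      push_cast; ring
    rw [e1, e2, ← integral_const_mul]
    refine norm_integral_le_of_norm_le (f.integrable.norm.const_mul M)
      (Eventually.of_forall fun y => ?_)
    rw [norm_mul, mul_comm]
    gcongr
    exact e3 y
  rw [h1, ← integral_const_mul]
  refine norm_integral_le_of_norm_le (g.integrable.norm.const_mul _) (Eventually.of_forall fun x => ?_)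
  rw [norm_mul, mul_comm]
  gcongr
  exact h2 x

/-- The dispersive estimate for the low frequency part of the form. -/
theorem norm_form_low_le {m : ℝ} (hm : 0 < m) {α : ℝ → ℝ} (hα : BddDerivOn m 2 α) :
    ∃ C, 0 ≤ C ∧ ∀ t : ℝ, 1 ≤ |t| → ∀ f g : 𝓢(R3, ℂ),
      ‖form m t (fun ξ => α (omega m ξ) * (1 - (∑ j, velocity m j ξ ^ 2) ^ 2) ^ 3) f g‖ ≤
        C / (|t| * √|t|) * ((∫ x, ‖f x‖) * ∫ x, ‖g x‖) := by
  obtain ⟨hint, C, hC0, hC⟩ := norm_lowKernel_le hm hα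
  set b : ℝ → ℝ := fun r => α (disp m r) * (1 - (1 - m ^ 2 * (disp m r)⁻¹ ^ 2) ^ 2) ^ 3 with hb
  have hpi : (2 * Real.pi) ≠ 0 := by positivity
  -- The Jacobian of the substitution k = 2πξ.
  set c₀ := |((2 * Real.pi) ^ 3)⁻¹| with hc₀
  refine ⟨c₀ * C, by positivity, fun t ht f g => ?_⟩
  have e : ∀ ξ, α (omega m ξ) * (1 - (∑ j, velocity m j ξ ^ 2) ^ 2) ^ 3 =
      b ‖(2 * Real.pi) • ξ‖ := fun ξ => by
    rw [sum_sq_velocity hm]; rfl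
  simp only [form, e]
  have hsi : Integrable fun ξ : R3 => phase m t ξ * (b ‖(2 * Real.pi) • ξ‖ : ℝ) := by
    have h1 := (hint.comp_smul hpi).ofReal (𝕜 := ℂ)
    exact h1.bdd_mul (continuous_phase m t).aestronglyMeasurable
      (Eventually.of_forall fun ξ => (norm_phase m t ξ).le)
  refine (norm_integral_symbol_le hsi (M := c₀ * C / (|t| * √|t|)) (fun z => ?_) f g).trans
    (le_of_eq (by ring))
  have h2 := Measure.integral_comp_smul (volume : Measure R3) (fun k : R3 =>
    (b ‖k‖ : ℂ) * Complex.exp (Complex.I * (t * disp m ‖k‖ : ℝ)) *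
      Complex.exp (Complex.I * (inner ℝ k z : ℝ))) (2 * Real.pi)
  rw [show Module.finrank ℝ R3 = 3 by simp, ← hc₀] at h2
  have h3 : ∫ ξ : R3, phase m t ξ * (b ‖(2 * Real.pi) • ξ‖ : ℝ) *
      Complex.exp (Complex.I * (inner ℝ ((2 * Real.pi) • ξ) z : ℝ)) =
      c₀ • ∫ k : R3, (b ‖k‖ : ℂ) * Complex.exp (Complex.I * (t * disp m ‖k‖ : ℝ)) *
        Complex.exp (Complex.I * (inner ℝ k z : ℝ)) := by
    refine Eq.trans (integral_congr_ae (Eventually.of_forall fun ξ => ?_)) h2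
    simp only [phase, omega]
    ring
  rw [h3, norm_smul, Real.norm_of_nonneg (by positivity), mul_div_assoc]
  gcongr
  exact hC t ht z

end LowFrequency

/-! ### High frequencies: decay paid for by weights -/

section HighFrequency

variable {m : ℝ}

/-- The weighted `L²` norm of a Schwartz function. -/
def weightedNorm (σ : ℝ) (f : 𝓢(R3, ℂ)) : ℝ :=
  l2norm (SchwartzMap.smulLeftCLM ℂ (weight σ) f)

theorem weightedNorm_nonneg (σ : ℝ) (f : 𝓢(R3, ℂ)) : 0 ≤ weightedNorm σ f := l2norm_nonneg _

theorem norm_weight (σ : ℝ) (x : R3) : ‖weight σ x‖ = (1 + ‖x‖ ^ 2) ^ (σ / 2) := by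
  rw [weight, Complex.norm_real, Real.norm_of_nonneg (by positivity)]

theorem norm_smulLeft_weight (σ : ℝ) (f : 𝓢(R3, ℂ)) (x : R3) :
    ‖SchwartzMap.smulLeftCLM ℂ (weight σ) f x‖ = (1 + ‖x‖ ^ 2) ^ (σ / 2) * ‖f x‖ := by
  rw [SchwartzMap.smulLeftCLM_apply_apply (hasTemperateGrowth_weight σ), norm_smul, norm_weight]

theorem weightedNorm_mono {σ τ : ℝ} (h : σ ≤ τ) (f : 𝓢(R3, ℂ)) :
    weightedNorm σ f ≤ weightedNorm τ f := by
  rw [weightedNorm, weightedNorm, ← one_mul (l2norm (SchwartzMap.smulLeftCLM ℂ (weight τ) f))]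
  refine l2norm_le_mul fun x => ?_
  rw [norm_smulLeft_weight, norm_smulLeft_weight, one_mul]
  gcongr
  nlinarith [sq_nonneg ‖x‖]

theorem l2norm_eq_weightedNorm_zero (f : 𝓢(R3, ℂ)) : l2norm f = weightedNorm 0 f := by
  rw [weightedNorm]
  congr 1
  ext x
  rw [SchwartzMap.smulLeftCLM_apply_apply (hasTemperateGrowth_weight 0)]
  simp [weight]

theorem abs_coord_le (x : R3) (j : Fin 3) : |x j| ≤ (1 + ‖x‖ ^ 2) ^ ((1 : ℝ) / 2) := by
  rw [← Real.sqrt_eq_rpow]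
  refine Real.abs_le_sqrt ?_
  have := PiLp.norm_apply_le x j
  rw [Real.norm_eq_abs] at this
  nlinarith [sq_abs (x j), abs_nonneg (x j), norm_nonneg x]

theorem weightedNorm_mulCoord_le (σ : ℝ) (j : Fin 3) (f : 𝓢(R3, ℂ)) :
    weightedNorm σ (mulCoord j f) ≤ weightedNorm (σ + 1) f := by
  rw [weightedNorm, weightedNorm,
    ← one_mul (l2norm (SchwartzMap.smulLeftCLM ℂ (weight (σ + 1)) f))]
  refine l2norm_le_mul fun x => ?_
  rw [norm_smulLeft_weight, norm_smulLeft_weight, one_mul, mulCoord_apply, norm_mul,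
    Complex.norm_real, Real.norm_eq_abs, add_div, Real.rpow_add (by positivity), mul_assoc]
  gcongr
  exact abs_coord_le x j

/-- One integration by parts. -/
theorem norm_form_velocity_le (hm : 0 < m) (j : Fin 3) {c : R3 → ℝ} (hc : BddPartials 1 c) :
    ∃ C, 0 ≤ C ∧ ∀ (t : ℝ) (f g : 𝓢(R3, ℂ)),
      |t| * ‖form m t (fun ξ => velocity m j ξ * c ξ) f g‖ ≤
        C * (weightedNorm 1 f * weightedNorm 0 g + weightedNorm 0 f * weightedNorm 1 g) := by
  obtain ⟨C, hC⟩ := hc.bdd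
  obtain ⟨D, hD⟩ := (hc.2.2 j).bdd
  have hC0 : 0 ≤ C := (abs_nonneg _).trans (hC 0)
  have hD0 : 0 ≤ D := (abs_nonneg _).trans (hD 0)
  refine ⟨D + C, by positivity, fun t f g => ?_⟩
  have id := congrArg norm (form_velocity_mul hm t j hc f g)
  have h2pi : ‖(2 * Real.pi * Complex.I : ℂ)‖ = 2 * Real.pi := by
    simp [abs_of_pos Real.pi_pos]
  rw [norm_mul, norm_mul, h2pi, Complex.norm_real, Real.norm_eq_abs] at id
  have n0 := norm_form_le m t hD f g
  have n1 := norm_form_le m t hC (mulCoord j f) g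
  have n2 := norm_form_le m t hC f (mulCoord j g)
  have m1 : l2norm (mulCoord j f) ≤ weightedNorm 1 f := by
    rw [l2norm_eq_weightedNorm_zero]; simpa using weightedNorm_mulCoord_le 0 j f
  have m2 : l2norm (mulCoord j g) ≤ weightedNorm 1 g := by
    rw [l2norm_eq_weightedNorm_zero]; simpa using weightedNorm_mulCoord_le 0 j g
  have m3 : weightedNorm 0 f ≤ weightedNorm 1 f := weightedNorm_mono zero_le_one f
  simp only [l2norm_eq_weightedNorm_zero f, l2norm_eq_weightedNorm_zero g] at n0 n1 n2
  have f0 := weightedNorm_nonneg 0 f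
  have g0 := weightedNorm_nonneg 0 g
  have f1 := weightedNorm_nonneg 1 f
  have g1 := weightedNorm_nonneg 1 g
  have tri : ‖-form m t (fun ξ => fderiv ℝ c ξ (coordVec j)) f g
      - 2 * Real.pi * Complex.I * form m t c (mulCoord j f) g
      + 2 * Real.pi * Complex.I * form m t c f (mulCoord j g)‖ ≤
      D * (weightedNorm 0 f * weightedNorm 0 g) +
      2 * Real.pi * (C * (weightedNorm 1 f * weightedNorm 0 g)) +
      2 * Real.pi * (C * (weightedNorm 0 f * weightedNorm 1 g)) := by
    refine (norm_add_le _ _).trans (add_le_add ((norm_sub_le _ _).trans (add_le_add ?_ ?_)) ?_)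
    · rw [norm_neg]; exact n0
    · rw [norm_mul, h2pi]
      refine mul_le_mul_of_nonneg_left (n1.trans ?_) (by positivity)
      gcongr
    · rw [norm_mul, h2pi]
      refine mul_le_mul_of_nonneg_left (n2.trans ?_) (by positivity)
      gcongr
  rw [← id] at tri
  -- The derivative term carries no factor 2π; as 2π ≥ 1 it may be given one, and 2π then cancels
  -- throughout.
  have hpi : 1 ≤ 2 * Real.pi := by linarith [Real.pi_gt_three]
  have hpp : 0 < 2 * Real.pi := by linarith
  have k1 : D * (weightedNorm 0 f * weightedNorm 0 g) ≤
      2 * Real.pi * (D * (weightedNorm 1 f * weightedNorm 0 g)) := by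
    refine le_trans ?_ (le_mul_of_one_le_left (by positivity) hpi)
    gcongr
  have k2 : 0 ≤ 2 * Real.pi * (D * (weightedNorm 0 f * weightedNorm 1 g)) := by positivity
  refine le_of_mul_le_mul_left ?_ hpp
  calc _ = 2 * Real.pi * |t| * ‖form m t (fun ξ => velocity m j ξ * c ξ) f g‖ := by ring
    _ ≤ _ := tri
    _ ≤ _ := by linarith

/-- Two integrations by parts. -/
theorem norm_form_velocity_sq_le (hm : 0 < m) (l j : Fin 3) {q : R3 → ℝ} (hq : BddPartials 2 q) :
    ∃ C, 0 ≤ C ∧ ∀ (t : ℝ) (f g : 𝓢(R3, ℂ)),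
      |t| ^ 2 * ‖form m t (fun ξ => velocity m l ξ ^ 2 * velocity m j ξ ^ 2 * q ξ) f g‖ ≤
        C * (weightedNorm 2 f * weightedNorm 0 g + weightedNorm 1 f * weightedNorm 1 g +
          weightedNorm 0 f * weightedNorm 2 g) := by
  have hV := (BddPartials.inv_omega_and_velocity hm 2).2
  obtain ⟨c₁, hc₁def⟩ : ∃ c : R3 → ℝ, c = fun ξ => velocity m j ξ * (velocity m l ξ * q ξ) :=
    ⟨_, rfl⟩
  have hc₁ : BddPartials 2 c₁ := hc₁def ▸ (hV j).mul ((hV l).mul hq)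
  have hc : BddPartials 2 fun ξ => velocity m j ξ * c₁ ξ := (hV j).mul hc₁
  have hc₃ : BddPartials 1 fun ξ => fderiv ℝ (velocity m j) ξ (coordVec l) *
      (velocity m l ξ * q ξ) + fderiv ℝ c₁ ξ (coordVec l) :=
    (((hV j).2.2 l).mul ((hV l).mul hq).of_succ).add (hc₁.2.2 l)
  have e1 : (fun ξ => velocity m l ξ ^ 2 * velocity m j ξ ^ 2 * q ξ) =
      fun ξ => velocity m l ξ * (velocity m j ξ * c₁ ξ) := by
    ext ξ; simp only [hc₁def]; ring
  -- The reason for squaring both velocities: after the derivative in direction l has fallen on the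
  -- symbol, a factor vⱼ survives in every term, ready for the second integration by parts.
  have e2 : (fun ξ => fderiv ℝ (fun ξ => velocity m j ξ * c₁ ξ) ξ (coordVec l)) =
      fun ξ => velocity m j ξ * (fderiv ℝ (velocity m j) ξ (coordVec l) *
        (velocity m l ξ * q ξ) + fderiv ℝ c₁ ξ (coordVec l)) := by
    ext ξ
    rw [BddPartials.fderiv_mul_coordVec (hV j).1 hc₁.1]
    simp only [hc₁def]; ring
  obtain ⟨A, hA0, hA⟩ := norm_form_velocity_le hm j hc₃
  obtain ⟨B, hB0, hB⟩ := norm_form_velocity_le hm j hc₁.of_succ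
  refine ⟨A + 2 * B, by positivity, fun t f g => ?_⟩
  have id := congrArg norm (form_velocity_mul hm t l hc.of_succ f g)
  rw [e2] at id
  have h2pi : ‖(2 * Real.pi * Complex.I : ℂ)‖ = 2 * Real.pi := by
    simp [abs_of_pos Real.pi_pos]
  rw [norm_mul, norm_mul, h2pi, Complex.norm_real, Real.norm_eq_abs] at id
  have n0 := hA t f g
  have n1 := hB t (mulCoord l f) g
  have n2 := hB t f (mulCoord l g)
  have a1 : weightedNorm 0 (mulCoord l f) ≤ weightedNorm 1 f := by
    simpa using weightedNorm_mulCoord_le 0 l f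
  have a2 : weightedNorm 1 (mulCoord l f) ≤ weightedNorm 2 f := by
    simpa [one_add_one_eq_two] using weightedNorm_mulCoord_le 1 l f
  have b1 : weightedNorm 0 (mulCoord l g) ≤ weightedNorm 1 g := by
    simpa using weightedNorm_mulCoord_le 0 l g
  have b2 : weightedNorm 1 (mulCoord l g) ≤ weightedNorm 2 g := by
    simpa [one_add_one_eq_two] using weightedNorm_mulCoord_le 1 l g
  have f12 : weightedNorm 1 f ≤ weightedNorm 2 f := weightedNorm_mono (by norm_num) f
  have g12 : weightedNorm 1 g ≤ weightedNorm 2 g := weightedNorm_mono (by norm_num) g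
  have f0 := weightedNorm_nonneg 0 f
  have g0 := weightedNorm_nonneg 0 g
  have f1 := weightedNorm_nonneg 1 f
  have g1 := weightedNorm_nonneg 1 g
  have f2 := weightedNorm_nonneg 2 f
  have g2 := weightedNorm_nonneg 2 g
  rw [e1]
  generalize form m t (fun ξ => velocity m j ξ * (fderiv ℝ (velocity m j) ξ (coordVec l) *
    (velocity m l ξ * q ξ) + fderiv ℝ c₁ ξ (coordVec l))) f g = X at id n0
  generalize form m t (fun ξ => velocity m j ξ * c₁ ξ) (mulCoord l f) g = Y at id n1
  generalize form m t (fun ξ => velocity m j ξ * c₁ ξ) f (mulCoord l g) = Z at id n2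
  generalize form m t (fun ξ => velocity m l ξ * (velocity m j ξ * c₁ ξ)) f g = W at id ⊢
  have tri : ‖-X - 2 * Real.pi * Complex.I * Y + 2 * Real.pi * Complex.I * Z‖ ≤
      ‖X‖ + 2 * Real.pi * ‖Y‖ + 2 * Real.pi * ‖Z‖ := by
    refine (norm_add_le _ _).trans (add_le_add ((norm_sub_le _ _).trans (add_le_add ?_ ?_)) ?_)
    · rw [norm_neg]
    · rw [norm_mul, h2pi]
    · rw [norm_mul, h2pi]
  rw [← id] at tri
  clear id e1 e2 hc₃ hc₁ hc hV hA hB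
  generalize weightedNorm 0 (mulCoord l f) = F0 at *
  generalize weightedNorm 1 (mulCoord l f) = F1 at *
  generalize weightedNorm 0 (mulCoord l g) = G0 at *
  generalize weightedNorm 1 (mulCoord l g) = G1 at *
  generalize weightedNorm 0 f = x0 at *
  generalize weightedNorm 1 f = x1 at *
  generalize weightedNorm 2 f = x2 at *
  generalize weightedNorm 0 g = y0 at *
  generalize weightedNorm 1 g = y1 at *
  generalize weightedNorm 2 g = y2 at *
  obtain ⟨S, hS⟩ : ∃ S, S = x2 * y0 + x1 * y1 + x0 * y2 := ⟨_, rfl⟩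
  rw [← hS]
  have p20 : x1 * y0 ≤ x2 * y0 := by gcongr
  have p02 : x0 * y1 ≤ x0 * y2 := by gcongr
  have p11 : 0 ≤ x1 * y1 := by positivity
  have q20 : 0 ≤ x2 * y0 := by positivity
  have q02 : 0 ≤ x0 * y2 := by positivity
  have N0 := n0.trans (mul_le_mul_of_nonneg_left (by rw [hS]; linarith : _ ≤ S) hA0)
  have N1 : |t| * ‖Y‖ ≤ B * S := by
    refine n1.trans (mul_le_mul_of_nonneg_left ?_ hB0)
    have h1 : F1 * y0 ≤ x2 * y0 := by gcongr
    have h2 : F0 * y1 ≤ x1 * y1 := by gcongr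
    rw [hS]; linarith
  have N2 : |t| * ‖Z‖ ≤ B * S := by
    refine n2.trans (mul_le_mul_of_nonneg_left ?_ hB0)
    have h1 : x1 * G0 ≤ x1 * y1 := by gcongr
    have h2 : x0 * G1 ≤ x0 * y2 := by gcongr
    rw [hS]; linarith
  have hS0 : 0 ≤ S := by rw [hS]; linarith
  have hpi : 1 ≤ 2 * Real.pi := by linarith [Real.pi_gt_three]
  have hpp : 0 < 2 * Real.pi := by linarith
  have hAS : A * S ≤ 2 * Real.pi * (A * S) := le_mul_of_one_le_left (by positivity) hpi
  refine le_of_mul_le_mul_left ?_ hpp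
  calc 2 * Real.pi * (|t| ^ 2 * ‖W‖) = |t| * (2 * Real.pi * |t| * ‖W‖) := by ring
    _ ≤ |t| * (‖X‖ + 2 * Real.pi * ‖Y‖ + 2 * Real.pi * ‖Z‖) := by gcongr
    _ = |t| * ‖X‖ + 2 * Real.pi * (|t| * ‖Y‖) + 2 * Real.pi * (|t| * ‖Z‖) := by ring
    _ ≤ A * S + 2 * Real.pi * (B * S) + 2 * Real.pi * (B * S) := by gcongr
    _ ≤ 2 * Real.pi * (A * S) + 2 * Real.pi * (B * S) + 2 * Real.pi * (B * S) := by linarith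
    _ = 2 * Real.pi * ((A + 2 * B) * S) := by ring

end HighFrequency

/-! ### Weighted decay of the form -/

section FormDecay

variable {m : ℝ}

theorem integrable_form (m t : ℝ) {c : R3 → ℝ} (hc : BddPartials 0 c) (F G : 𝓢(R3, ℂ)) :
    Integrable fun ξ => phase m t ξ * c ξ * (F ξ * G ξ) := by
  obtain ⟨hcc, C, hC⟩ := hc
  have hp := continuous_phase m t
  refine integrable_mul_schwartz (by fun_prop) (C := C) (fun ξ => ?_) F G
  rw [norm_mul, norm_phase, one_mul, Complex.norm_real]
  exact hC ξ

theorem form_add_left (t : ℝ) {c : R3 → ℝ} (hc : BddPartials 0 c) (f₁ f₂ g : 𝓢(R3, ℂ)) :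
    form m t c (f₁ + f₂) g = form m t c f₁ g + form m t c f₂ g := by
  rw [form, form, form, ← integral_add (integrable_form m t hc _ _) (integrable_form m t hc _ _)]
  refine integral_congr_ae (Eventually.of_forall fun ξ => ?_)
  simp only [FourierTransform.fourierInv_add, add_apply]
  ring

theorem form_add_right (t : ℝ) {c : R3 → ℝ} (hc : BddPartials 0 c) (f g₁ g₂ : 𝓢(R3, ℂ)) :
    form m t c f (g₁ + g₂) = form m t c f g₁ + form m t c f g₂ := by
  rw [form, form, form, ← integral_add (integrable_form m t hc _ _) (integrable_form m t hc _ _)]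
  refine integral_congr_ae (Eventually.of_forall fun ξ => ?_)
  simp only [FourierTransform.fourier_add, add_apply]
  ring

theorem form_add_symbol (t : ℝ) {c d : R3 → ℝ} (hc : BddPartials 0 c) (hd : BddPartials 0 d)
    (f g : 𝓢(R3, ℂ)) :
    form m t (fun ξ => c ξ + d ξ) f g = form m t c f g + form m t d f g := by
  rw [form, form, form, ← integral_add (integrable_form m t hc _ _) (integrable_form m t hd _ _)]
  refine integral_congr_ae (Eventually.of_forall fun ξ => ?_)
  push_cast
  ring

theorem form_sum_symbol {ι : Type*} (s : Finset ι) (t : ℝ) {c : ι → R3 → ℝ}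
    (hc : ∀ i, BddPartials 0 (c i)) (f g : 𝓢(R3, ℂ)) :
    form m t (fun ξ => ∑ i ∈ s, c i ξ) f g = ∑ i ∈ s, form m t (c i) f g := by
  simp only [form]
  rw [← integral_finsetSum s fun i _ => integrable_form m t (hc i) _ _]
  refine integral_congr_ae (Eventually.of_forall fun ξ => ?_)
  push_cast
  rw [Finset.mul_sum, Finset.sum_mul]

/-- The square ⟨x⟩^(-2σ) is integrable on ℝ³ as 2σ > 3; this is where the strict inequality σ > 3/2
is needed. -/
theorem memLp_weight {σ : ℝ} (hσ : 3 / 2 < σ) : MemLp (weight (-σ)) 2 (volume : Measure R3) := by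
  have hm : AEStronglyMeasurable (weight (-σ)) (volume : Measure R3) :=
    (hasTemperateGrowth_weight (-σ)).1.continuous.aestronglyMeasurable
  rw [memLp_two_iff_integrable_sq_norm hm]
  have h := integrable_rpow_neg_one_add_norm_sq (E := R3) (μ := volume) (r := 2 * σ)
    (by simp; linarith)
  refine h.congr (Eventually.of_forall fun x => ?_)
  simp only [norm_weight]
  rw [← Real.rpow_mul_natCast (by positivity)]
  congr 1
  push_cast; ring

/-- Multiplication with a large negative power of `⟨x⟩` maps `L²` to `L¹`. -/
theorem integral_norm_smulLeft_weight_le {σ : ℝ} (hσ : 3 / 2 < σ) :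
    ∃ C, 0 ≤ C ∧ ∀ φ : 𝓢(R3, ℂ),
      ∫ x, ‖SchwartzMap.smulLeftCLM ℂ (weight (-σ)) φ x‖ ≤ C * l2norm φ := by
  have hw := memLp_weight hσ
  refine ⟨(eLpNorm (weight (-σ)) 2 (volume : Measure R3)).toReal, ENNReal.toReal_nonneg,
    fun φ => ?_⟩
  have h := eLpNorm_smul_le_mul_eLpNorm (p := 2) (q := 2) (r := 1) (μ := (volume : Measure R3))
      (φ.continuous.aestronglyMeasurable) hw.1
  have e : (⇑(SchwartzMap.smulLeftCLM ℂ (weight (-σ)) φ)) = weight (-σ) • ⇑φ := by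
    ext x
    rw [SchwartzMap.smulLeftCLM_apply_apply (hasTemperateGrowth_weight _)]
    rfl
  rw [integral_norm_eq_lintegral_enorm (SchwartzMap.continuous _).aestronglyMeasurable,
    ← eLpNorm_one_eq_lintegral_enorm, e, l2norm_eq, ← ENNReal.toReal_mul]
  refine ENNReal.toReal_mono (ENNReal.mul_ne_top hw.2.ne ?_) h
  exact (φ.memLp 2 volume).2.ne

/-- The smooth cutoff to the ball of radius `|t|`. -/
def cutoff (t : ℝ) (x : R3) : ℂ := weight (-2) (t⁻¹ • x)

theorem hasTemperateGrowth_cutoff (t : ℝ) : (cutoff t).HasTemperateGrowth :=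
  (hasTemperateGrowth_weight (-2)).comp ((t⁻¹ • ContinuousLinearMap.id ℝ R3).hasTemperateGrowth)

theorem cutoff_eq (t : ℝ) (x : R3) : cutoff t x = (((1 + ‖x‖ ^ 2 / t ^ 2)⁻¹ : ℝ) : ℂ) := by
  rw [cutoff, weight, norm_smul, norm_inv, mul_pow, inv_pow, Real.norm_eq_abs, sq_abs,
    show (-2 : ℝ) / 2 = -1 by norm_num, Real.rpow_neg_one, inv_mul_eq_div]

theorem norm_cutoff_smulLeft (t σ : ℝ) (φ : 𝓢(R3, ℂ)) (x : R3) :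
    ‖SchwartzMap.smulLeftCLM ℂ (cutoff t) (SchwartzMap.smulLeftCLM ℂ (weight (-σ)) φ) x‖ =
      (1 + ‖x‖ ^ 2 / t ^ 2)⁻¹ * ((1 + ‖x‖ ^ 2) ^ (-σ / 2) * ‖φ x‖) := by
  rw [SchwartzMap.smulLeftCLM_apply_apply (hasTemperateGrowth_cutoff t), norm_smul,
    norm_smulLeft_weight, cutoff_eq, Complex.norm_real, Real.norm_of_nonneg (by positivity)]

/-- No use is made of the decay of the cutoff: the weight ⟨x⟩^(τ-σ) is already at most 1. It is
needed for τ = 0 and τ = 1. -/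
theorem weightedNorm_cutoff_le {σ τ : ℝ} (h : τ ≤ σ) (t : ℝ) (φ : 𝓢(R3, ℂ)) :
    weightedNorm τ (SchwartzMap.smulLeftCLM ℂ (cutoff t)
      (SchwartzMap.smulLeftCLM ℂ (weight (-σ)) φ)) ≤ l2norm φ := by
  rw [weightedNorm, ← one_mul (l2norm φ)]
  refine l2norm_le_mul fun x => ?_
  rw [norm_smulLeft_weight, norm_cutoff_smulLeft]
  have h1 : (1 + ‖x‖ ^ 2 / t ^ 2)⁻¹ ≤ 1 := inv_le_one_of_one_le₀ (by
    have : 0 ≤ ‖x‖ ^ 2 / t ^ 2 := by positivity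
    linarith)
  have h2 : (1 + ‖x‖ ^ 2) ^ (τ / 2) * (1 + ‖x‖ ^ 2) ^ (-σ / 2) ≤ 1 := by
    rw [← Real.rpow_add (by positivity)]
    exact Real.rpow_le_one_of_one_le_of_nonpos (by nlinarith [sq_nonneg ‖x‖]) (by linarith)
  calc _ = (1 + ‖x‖ ^ 2 / t ^ 2)⁻¹ * ((1 + ‖x‖ ^ 2) ^ (τ / 2) * (1 + ‖x‖ ^ 2) ^ (-σ / 2)) *
        ‖φ x‖ := by ring
    _ ≤ 1 * 1 * ‖φ x‖ := by gcongr
    _ = 1 * ‖φ x‖ := by ring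

/-- With y = 1 + |x|²/t², the inverse of the cutoff, |t| ≥ 1 gives 1 + |x|² ≤ t² y. Hence the excess
weight ⟨x⟩^(2-σ) is at most |t|^(2-σ) y^(1-σ/2), and the cutoff absorbs the power of y. -/
theorem weightedNorm_two_cutoff_le {σ : ℝ} (h0 : 0 ≤ σ) (h2 : σ ≤ 2) {t : ℝ} (ht : 1 ≤ |t|)
    (φ : 𝓢(R3, ℂ)) :
    weightedNorm 2 (SchwartzMap.smulLeftCLM ℂ (cutoff t)
      (SchwartzMap.smulLeftCLM ℂ (weight (-σ)) φ)) ≤ |t| ^ (2 - σ) * l2norm φ := by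
  rw [weightedNorm]
  refine l2norm_le_mul fun x => ?_
  rw [norm_smulLeft_weight, norm_cutoff_smulLeft]
  have ht0 : 0 < |t| := by linarith
  set y := 1 + ‖x‖ ^ 2 / t ^ 2 with hy
  have hy1 : 1 ≤ y := by
    have : 0 ≤ ‖x‖ ^ 2 / t ^ 2 := by positivity
    linarith
  have hxy : 1 + ‖x‖ ^ 2 ≤ |t| ^ 2 * y := by
    have : |t| ^ 2 * y = |t| ^ 2 + ‖x‖ ^ 2 := by
      rw [hy, ← sq_abs t]; field_simp
    rw [this]
    nlinarith
  have h1 : (1 + ‖x‖ ^ 2) ^ ((2 : ℝ) / 2) * (1 + ‖x‖ ^ 2) ^ (-σ / 2) ≤ |t| ^ (2 - σ) * y := by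
    rw [← Real.rpow_add (by positivity)]
    calc (1 + ‖x‖ ^ 2) ^ ((2 : ℝ) / 2 + -σ / 2) ≤ (|t| ^ 2 * y) ^ ((2 : ℝ) / 2 + -σ / 2) := by
          gcongr
          linarith
      _ = |t| ^ (2 - σ) * y ^ ((2 : ℝ) / 2 + -σ / 2) := by
          rw [Real.mul_rpow (by positivity) (by positivity), ← Real.rpow_natCast,
            ← Real.rpow_mul ht0.le]
          congr 2
          push_cast; ring
      _ ≤ |t| ^ (2 - σ) * y ^ (1 : ℝ) := by
          gcongr
          linarith
      _ = _ := by rw [Real.rpow_one]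
  calc _ = ((1 + ‖x‖ ^ 2) ^ ((2 : ℝ) / 2) * (1 + ‖x‖ ^ 2) ^ (-σ / 2)) * y⁻¹ * ‖φ x‖ := by ring
    _ ≤ (|t| ^ (2 - σ) * y) * y⁻¹ * ‖φ x‖ := by gcongr
    _ = |t| ^ (2 - σ) * ‖φ x‖ := by
      have : y ≠ 0 := by linarith
      field_simp

/-- One minus the cutoff is z/(1+z) with z = |x|²/t². It lies in [0, 1], so it is at most its own
power σ/2, hence at most (⟨x⟩/|t|)^σ, and the weight cancels ⟨x⟩^σ. -/
theorem l2norm_sub_cutoff_le {σ : ℝ} (h0 : 0 ≤ σ) (h2 : σ ≤ 2) {t : ℝ} (ht : 1 ≤ |t|)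
    (φ : 𝓢(R3, ℂ)) :
    l2norm (SchwartzMap.smulLeftCLM ℂ (weight (-σ)) φ - SchwartzMap.smulLeftCLM ℂ (cutoff t)
      (SchwartzMap.smulLeftCLM ℂ (weight (-σ)) φ)) ≤ |t| ^ (-σ) * l2norm φ := by
  refine l2norm_le_mul fun x => ?_
  have ht0 : 0 < |t| := by linarith
  rw [sub_apply, SchwartzMap.smulLeftCLM_apply_apply (hasTemperateGrowth_cutoff t),
    smul_eq_mul, ← one_sub_mul, norm_mul, norm_smulLeft_weight, cutoff_eq, ← Complex.ofReal_one,
    ← Complex.ofReal_sub, Complex.norm_real]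
  set z := ‖x‖ ^ 2 / t ^ 2 with hz
  have hz0 : 0 ≤ z := by positivity
  have e : 1 - (1 + z)⁻¹ = z / (1 + z) := by field_simp; ring
  have h1 : z / (1 + z) ≤ 1 := by rw [div_le_one (by positivity)]; linarith
  have h3 : z / (1 + z) ≤ z := div_le_self hz0 (by linarith)
  have hzx : z ≤ (1 + ‖x‖ ^ 2) * |t| ^ (-2 : ℝ) := by
    rw [hz, Real.rpow_neg ht0.le, Real.rpow_two, sq_abs, div_eq_mul_inv]
    gcongr
    linarith
  have h4 : z / (1 + z) ≤ (1 + ‖x‖ ^ 2) ^ (σ / 2) * |t| ^ (-σ) := by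
    calc z / (1 + z) ≤ (z / (1 + z)) ^ (σ / 2) := by
          rcases (by positivity : 0 ≤ z / (1 + z)).eq_or_lt with h | h
          · rw [← h]; positivity
          · exact Real.self_le_rpow_of_le_one h.le h1 (by linarith)
      _ ≤ ((1 + ‖x‖ ^ 2) * |t| ^ (-2 : ℝ)) ^ (σ / 2) := by
          gcongr
          exact h3.trans hzx
      _ = _ := by
          rw [Real.mul_rpow (by positivity) (by positivity), ← Real.rpow_mul ht0.le]
          congr 2
          ring
  rw [e, Real.norm_of_nonneg (by positivity)]
  calc _ ≤ (1 + ‖x‖ ^ 2) ^ (σ / 2) * |t| ^ (-σ) * ((1 + ‖x‖ ^ 2) ^ (-σ / 2) * ‖φ x‖) := by gcongr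
    _ = ((1 + ‖x‖ ^ 2) ^ (σ / 2) * (1 + ‖x‖ ^ 2) ^ (-σ / 2)) * (|t| ^ (-σ) * ‖φ x‖) := by ring
    _ = _ := by
      rw [← Real.rpow_add (by positivity), show σ / 2 + -σ / 2 = 0 by ring, Real.rpow_zero, one_mul]

/-- Two integrations by parts give t⁻² at the price of second order weights, of which only order σ
is available. Truncation at |x| ~ |t| makes the missing weight cost |t|^(2-σ), and the tails are
O(|t|^(-σ)) in L². The mixed term with two first order weights needs σ ≥ 1. -/
theorem norm_form_high_le (hm : 0 < m) {q : R3 → ℝ} (hq : BddPartials 2 q) {σ : ℝ} (h1 : 1 ≤ σ)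
    (h2 : σ ≤ 2) :
    ∃ C, 0 ≤ C ∧ ∀ t : ℝ, 1 ≤ |t| → ∀ φ χ : 𝓢(R3, ℂ),
      ‖form m t (fun ξ => (∑ j, velocity m j ξ ^ 2) ^ 2 * q ξ)
        (SchwartzMap.smulLeftCLM ℂ (weight (-σ)) φ) (SchwartzMap.smulLeftCLM ℂ (weight (-σ)) χ)‖ ≤
        C * |t| ^ (-σ) * (l2norm φ * l2norm χ) := by
  have hV := (BddPartials.inv_omega_and_velocity hm 2).2
  choose A hA0 hA using fun i : Fin 3 × Fin 3 => norm_form_velocity_sq_le hm i.1 i.2 hq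
  have hterm : ∀ i : Fin 3 × Fin 3,
      BddPartials 0 fun ξ => velocity m i.1 ξ ^ 2 * velocity m i.2 ξ ^ 2 * q ξ := fun i =>
    ((((hV i.1).pow 2).mul ((hV i.2).pow 2)).mul hq).of_succ.of_succ
  have hsum : (fun ξ => (∑ j, velocity m j ξ ^ 2) ^ 2 * q ξ) =
      fun ξ => ∑ i : Fin 3 × Fin 3, velocity m i.1 ξ ^ 2 * velocity m i.2 ξ ^ 2 * q ξ := by
    ext ξ
    rw [sq, Finset.sum_mul_sum, ← Finset.sum_product', Finset.univ_product_univ, Finset.sum_mul]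
  have hS : BddPartials 2 fun ξ => ∑ j, velocity m j ξ ^ 2 := by
    simp only [Fin.sum_univ_three]
    exact (((hV 0).pow 2).add ((hV 1).pow 2)).add ((hV 2).pow 2)
  have hc : BddPartials 0 fun ξ => (∑ j, velocity m j ξ ^ 2) ^ 2 * q ξ :=
    ((hS.pow 2).mul hq).of_succ.of_succ
  obtain ⟨K, hK⟩ := hc.bdd
  have hK0 : 0 ≤ K := (abs_nonneg _).trans (hK 0)
  refine ⟨3 * (∑ i, A i) + 2 * K, by have := Finset.sum_nonneg fun i (_ : i ∈ Finset.univ) => hA0 i; positivity, fun t ht φ χ => ?_⟩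
  have ht0 : 0 < |t| := by linarith
  set f := SchwartzMap.smulLeftCLM ℂ (weight (-σ)) φ with hf
  set g := SchwartzMap.smulLeftCLM ℂ (weight (-σ)) χ with hg
  set pf := SchwartzMap.smulLeftCLM ℂ (cutoff t) f with hpf
  set pg := SchwartzMap.smulLeftCLM ℂ (cutoff t) g with hpg
  have hφ := l2norm_nonneg φ
  have hχ := l2norm_nonneg χ
  have hT1 : 1 ≤ |t| ^ (2 - σ) := Real.one_le_rpow ht (by linarith)
  have hT2 : |t| ^ (2 - σ) = |t| ^ 2 * |t| ^ (-σ) := by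
    rw [sub_eq_add_neg, Real.rpow_add ht0, Real.rpow_two]
  have F2 := weightedNorm_two_cutoff_le (by linarith) h2 ht φ
  have G2 := weightedNorm_two_cutoff_le (by linarith) h2 ht χ
  have F1 := weightedNorm_cutoff_le h1 t φ
  have G1 := weightedNorm_cutoff_le h1 t χ
  have F0 := weightedNorm_cutoff_le (by linarith : 0 ≤ σ) t φ
  have G0 := weightedNorm_cutoff_le (by linarith : 0 ≤ σ) t χ
  have F3 := l2norm_sub_cutoff_le (by linarith) h2 ht φ
  have G3 := l2norm_sub_cutoff_le (by linarith) h2 ht χ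
  simp only [← hf, ← hg, ← hpf, ← hpg] at F2 G2 F1 G1 F0 G0 F3 G3
  have main : ‖form m t (fun ξ => (∑ j, velocity m j ξ ^ 2) ^ 2 * q ξ) pf pg‖ ≤
      3 * (∑ i, A i) * |t| ^ (-σ) * (l2norm φ * l2norm χ) := by
    rw [hsum, form_sum_symbol _ _ hterm]
    have : ∀ i : Fin 3 × Fin 3,
        ‖form m t (fun ξ => velocity m i.1 ξ ^ 2 * velocity m i.2 ξ ^ 2 * q ξ) pf pg‖ ≤
          A i * (3 * |t| ^ (-σ) * (l2norm φ * l2norm χ)) := by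
      intro i
      refine le_of_mul_le_mul_left ((hA i t pf pg).trans ?_) (by positivity : 0 < |t| ^ 2)
      have a1 : weightedNorm 2 pf * weightedNorm 0 pg ≤ |t| ^ (2 - σ) * l2norm φ * l2norm χ :=
        mul_le_mul F2 G0 (weightedNorm_nonneg _ _) (by positivity)
      have a2 : weightedNorm 1 pf * weightedNorm 1 pg ≤ l2norm φ * l2norm χ :=
        mul_le_mul F1 G1 (weightedNorm_nonneg _ _) (by positivity)
      have a3 : weightedNorm 0 pf * weightedNorm 2 pg ≤ l2norm φ * (|t| ^ (2 - σ) * l2norm χ) :=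
        mul_le_mul F0 G2 (weightedNorm_nonneg _ _) (by positivity)
      -- Since σ ≤ 2, the mixed term has the same bound as the two others; this accounts for the
      -- factor 3.
      have a4 : l2norm φ * l2norm χ ≤ |t| ^ (2 - σ) * (l2norm φ * l2norm χ) :=
        le_mul_of_one_le_left (by positivity) hT1
      calc _ ≤ A i * (3 * (|t| ^ (2 - σ) * (l2norm φ * l2norm χ))) :=
            mul_le_mul_of_nonneg_left (by linarith) (hA0 i)
        _ = _ := by rw [hT2]; ring
    refine (norm_sum_le _ _).trans ((Finset.sum_le_sum fun i _ => this i).trans (le_of_eq ?_))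
    rw [← Finset.sum_mul]; ring
  -- Only the pair of truncated functions is integrated by parts. In the two other terms one entry
  -- is a tail, and the bound without oscillation suffices.
  have hdec : form m t (fun ξ => (∑ j, velocity m j ξ ^ 2) ^ 2 * q ξ) f g =
      form m t (fun ξ => (∑ j, velocity m j ξ ^ 2) ^ 2 * q ξ) pf pg +
      form m t (fun ξ => (∑ j, velocity m j ξ ^ 2) ^ 2 * q ξ) (f - pf) pg +
      form m t (fun ξ => (∑ j, velocity m j ξ ^ 2) ^ 2 * q ξ) f (g - pg) := by
    rw [← form_add_left t hc, add_sub_cancel, ← form_add_right t hc, add_sub_cancel]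
  rw [hdec]
  have b1 := norm_form_le m t hK (f - pf) pg
  have b2 := norm_form_le m t hK f (g - pg)
  have b3 : l2norm (f - pf) * l2norm pg ≤ |t| ^ (-σ) * l2norm φ * l2norm χ :=
    mul_le_mul F3 (by rw [l2norm_eq_weightedNorm_zero]; exact G0) (l2norm_nonneg _) (by positivity)
  have F4 : l2norm f ≤ l2norm φ := by
    rw [← one_mul (l2norm φ)]
    refine l2norm_le_mul fun x => ?_
    rw [hf, norm_smulLeft_weight]
    gcongr
    exact Real.rpow_le_one_of_one_le_of_nonpos (by nlinarith [sq_nonneg ‖x‖]) (by linarith)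
  have b4 : l2norm f * l2norm (g - pg) ≤ l2norm φ * (|t| ^ (-σ) * l2norm χ) :=
    mul_le_mul F4 G3 (l2norm_nonneg _) (by positivity)
  refine norm_add₃_le.trans ?_
  have b5 := b1.trans (mul_le_mul_of_nonneg_left b3 hK0)
  have b6 := b2.trans (mul_le_mul_of_nonneg_left b4 hK0)
  calc _ ≤ _ := add_le_add (add_le_add main b5) b6
    _ = _ := by ring

/-- The weighted decay estimate for the form. -/
theorem norm_form_decay (hm : 0 < m) {α : ℝ → ℝ} (hα : BddDerivOn m 2 α) {σ : ℝ}
    (hσ : 3 / 2 < σ) :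
    ∃ C, 0 ≤ C ∧ ∀ (t : ℝ) (φ χ : 𝓢(R3, ℂ)),
      ‖form m t (fun ξ => α (omega m ξ))
        (SchwartzMap.smulLeftCLM ℂ (weight (-σ)) φ) (SchwartzMap.smulLeftCLM ℂ (weight (-σ)) χ)‖ ≤
        C / (1 + |t|) ^ (3 / 2 : ℝ) * (l2norm φ * l2norm χ) := by
  -- For σ > 2 the surplus weight ⟨x⟩^(2-σ) is at most 1 and is passed to φ and χ.
  wlog h2 : σ ≤ 2 generalizing σ
  · obtain ⟨C, hC0, hC⟩ := this (σ := 2) (by norm_num) le_rfl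
    refine ⟨C, hC0, fun t φ χ => ?_⟩
    have e : ∀ φ : 𝓢(R3, ℂ), SchwartzMap.smulLeftCLM ℂ (weight (-σ)) φ =
        SchwartzMap.smulLeftCLM ℂ (weight (-2))
          (SchwartzMap.smulLeftCLM ℂ (weight (-(σ - 2))) φ) := by
      intro φ
      ext x
      rw [SchwartzMap.smulLeftCLM_apply_apply (hasTemperateGrowth_weight _),
        SchwartzMap.smulLeftCLM_apply_apply (hasTemperateGrowth_weight _),
        SchwartzMap.smulLeftCLM_apply_apply (hasTemperateGrowth_weight _), smul_smul]
      congr 1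
      rw [weight, weight, weight, ← Complex.ofReal_mul, ← Real.rpow_add (by positivity)]
      congr 2
      ring
    have e2 : ∀ φ : 𝓢(R3, ℂ), l2norm (SchwartzMap.smulLeftCLM ℂ (weight (-(σ - 2))) φ) ≤
        l2norm φ := by
      intro φ
      rw [l2norm_eq_weightedNorm_zero φ]
      exact weightedNorm_mono (by linarith) φ
    rw [e φ, e χ]
    refine (hC t _ _).trans ?_
    exact mul_le_mul_of_nonneg_left
      (mul_le_mul (e2 φ) (e2 χ) (l2norm_nonneg _) (l2norm_nonneg _)) (by positivity)
  have hV := (BddPartials.inv_omega_and_velocity hm 2).2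
  have hS : BddPartials 2 fun ξ => ∑ j, velocity m j ξ ^ 2 := by
    simp only [Fin.sum_univ_three]
    exact (((hV 0).pow 2).add ((hV 1).pow 2)).add ((hV 2).pow 2)
  have hα' := BddPartials.comp_omega hm hα
  have hR : BddPartials 2 fun ξ => 1 - (∑ j, velocity m j ξ ^ 2) ^ 2 :=
    (BddPartials.const 1).sub (hS.pow 2)
  have hq : BddPartials 2 fun ξ => α (omega m ξ) * (1 + (1 - (∑ j, velocity m j ξ ^ 2) ^ 2) +
      (1 - (∑ j, velocity m j ξ ^ 2) ^ 2) ^ 2) :=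
    hα'.mul (((BddPartials.const 1).add hR).add (hR.pow 2))
  -- With S = |v|² and R = 1 - S² this is 1 - R³ = (1 - R)(1 + R + R²). The cube is what raises the
  -- decay of the low part to ω⁻⁶.
  have esplit : (fun ξ => α (omega m ξ)) = fun ξ =>
      α (omega m ξ) * (1 - (∑ j, velocity m j ξ ^ 2) ^ 2) ^ 3 +
      (∑ j, velocity m j ξ ^ 2) ^ 2 * (α (omega m ξ) *
        (1 + (1 - (∑ j, velocity m j ξ ^ 2) ^ 2) + (1 - (∑ j, velocity m j ξ ^ 2) ^ 2) ^ 2)) := by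
    ext ξ; ring
  obtain ⟨A, hA0, hA⟩ := norm_form_low_le hm hα
  obtain ⟨B, hB0, hB⟩ := norm_form_high_le hm hq (by linarith : 1 ≤ σ) h2
  obtain ⟨L, hL0, hL⟩ := integral_norm_smulLeft_weight_le hσ
  obtain ⟨K, hK⟩ := hα'.bdd
  have hK0 : 0 ≤ K := (abs_nonneg _).trans (hK 0)
  have F4 : ∀ φ : 𝓢(R3, ℂ), l2norm (SchwartzMap.smulLeftCLM ℂ (weight (-σ)) φ) ≤ l2norm φ := by
    intro φ
    rw [l2norm_eq_weightedNorm_zero φ]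
    exact weightedNorm_mono (by linarith) φ
  refine ⟨2 ^ (3 / 2 : ℝ) * (K + A * (L * L) + B), by positivity, fun t φ χ => ?_⟩
  have hφ := l2norm_nonneg φ
  have hχ := l2norm_nonneg χ
  -- For |t| ≤ 1 the estimate without oscillation is enough, because 1 + |t| ≤ 2; this produces the
  -- factor 2^(3/2).
  rcases le_total |t| 1 with ht | ht
  · refine (norm_form_le m t hK _ _).trans ?_
    calc _ ≤ K * (l2norm φ * l2norm χ) := by
          exact mul_le_mul_of_nonneg_left
            (mul_le_mul (F4 φ) (F4 χ) (l2norm_nonneg _) hφ) hK0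
      _ ≤ _ := by
          gcongr
          rw [le_div_iff₀ (by positivity), mul_comm]
          gcongr
          · linarith
          · have : 0 ≤ A * (L * L) := by positivity
            linarith
  · have ht0 : 0 < |t| := by linarith
    have r : |t| ^ (-(3 / 2) : ℝ) ≤ 2 ^ (3 / 2 : ℝ) / (1 + |t|) ^ (3 / 2 : ℝ) := by
      rw [Real.rpow_neg ht0.le, ← one_div, ← Real.div_rpow (by norm_num) (by positivity),
        ← Real.one_rpow (3 / 2 : ℝ), ← Real.div_rpow (by norm_num) (by positivity)]
      gcongr ?_ ^ _
      rw [Real.one_rpow, div_le_div_iff₀ ht0 (by positivity)]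
      linarith
    have r1 : (|t| * √|t|)⁻¹ = |t| ^ (-(3 / 2) : ℝ) := by
      rw [Real.rpow_neg ht0.le, Real.sqrt_eq_rpow, show (3 / 2 : ℝ) = 1 + 1 / 2 by norm_num,
        Real.rpow_add ht0, Real.rpow_one]
    have r2 : |t| ^ (-σ) ≤ |t| ^ (-(3 / 2) : ℝ) :=
      Real.rpow_le_rpow_of_exponent_le ht (by linarith)
    rw [esplit, form_add_symbol t (hα'.mul (hR.pow 3)).of_succ.of_succ
      ((hS.pow 2).mul hq).of_succ.of_succ]
    refine (norm_add_le _ _).trans ?_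
    have b1 := hA t ht (SchwartzMap.smulLeftCLM ℂ (weight (-σ)) φ)
      (SchwartzMap.smulLeftCLM ℂ (weight (-σ)) χ)
    have b2 := hB t ht φ χ
    have b3 : (∫ x, ‖SchwartzMap.smulLeftCLM ℂ (weight (-σ)) φ x‖) *
        (∫ x, ‖SchwartzMap.smulLeftCLM ℂ (weight (-σ)) χ x‖) ≤
        (L * l2norm φ) * (L * l2norm χ) :=
      mul_le_mul (hL φ) (hL χ) (integral_nonneg fun _ => norm_nonneg _) (by positivity)
    calc _ ≤ A * |t| ^ (-(3 / 2) : ℝ) * ((L * l2norm φ) * (L * l2norm χ)) +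
          B * |t| ^ (-(3 / 2) : ℝ) * (l2norm φ * l2norm χ) := by
          refine add_le_add (b1.trans ?_) (b2.trans (by gcongr))
          rw [div_eq_mul_inv, r1]
          gcongr
      _ = (A * (L * L) + B) * |t| ^ (-(3 / 2) : ℝ) * (l2norm φ * l2norm χ) := by ring
      _ ≤ (K + A * (L * L) + B) * (2 ^ (3 / 2 : ℝ) / (1 + |t|) ^ (3 / 2 : ℝ)) *
          (l2norm φ * l2norm χ) := by
          gcongr
          linarith
      _ = _ := by ring

end FormDecay

/-! ### Temperate growth of the symbols -/

section Symbols

theorem abs_iteratedDeriv_sin_cos_le (n : ℕ) (x : ℝ) :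
    |iteratedDeriv n Real.sin x| ≤ 1 ∧ |iteratedDeriv n Real.cos x| ≤ 1 := by
  induction n with
  | zero => simpa using ⟨Real.abs_sin_le_one x, Real.abs_cos_le_one x⟩
  | succ n ih =>
    rw [Real.iteratedDeriv_add_one_sin, Real.iteratedDeriv_add_one_cos]
    exact ⟨ih.2, by simpa using ih.1⟩

theorem hasTemperateGrowth_sin : Real.sin.HasTemperateGrowth := by
  refine ⟨Real.contDiff_sin, fun n => ⟨0, 1, fun x => ?_⟩⟩
  rw [norm_iteratedFDeriv_eq_norm_iteratedDeriv]
  simpa using (abs_iteratedDeriv_sin_cos_le n x).1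

theorem hasTemperateGrowth_cos : Real.cos.HasTemperateGrowth := by
  refine ⟨Real.contDiff_cos, fun n => ⟨0, 1, fun x => ?_⟩⟩
  rw [norm_iteratedFDeriv_eq_norm_iteratedDeriv]
  simpa using (abs_iteratedDeriv_sin_cos_le n x).2

variable {m : ℝ}

/-- Rescaling to a power of 1 + |x|² gives temperate growth of ω and of 1/ω at once. -/
theorem omega_eq (hm : 0 < m) (ξ : R3) :
    omega m ξ = m * (1 + ‖((2 * Real.pi) / m) • ξ‖ ^ 2) ^ ((1 : ℝ) / 2) := by
  rw [← Real.sqrt_eq_rpow, ← Real.sqrt_sq (omega_pos hm ξ).le, sq_omega]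
  nth_rewrite 2 [← Real.sqrt_sq hm.le]
  rw [← Real.sqrt_mul (by positivity), norm_smul, Real.norm_of_nonneg (by positivity)]
  congr 1
  field_simp

theorem hasTemperateGrowth_rpow_smul (r c : ℝ) :
    (fun ξ : R3 => (1 + ‖c • ξ‖ ^ 2) ^ r).HasTemperateGrowth :=
  (Function.hasTemperateGrowth_one_add_norm_sq_rpow (H := R3) r).comp
    ((c • ContinuousLinearMap.id ℝ R3).hasTemperateGrowth)

theorem hasTemperateGrowth_omega (hm : 0 < m) : (omega m).HasTemperateGrowth := by
  rw [funext (omega_eq hm)]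
  exact (Function.HasTemperateGrowth.const m).mul (hasTemperateGrowth_rpow_smul _ _)

theorem hasTemperateGrowth_inv_omega (hm : 0 < m) :
    (fun ξ => (omega m ξ)⁻¹).HasTemperateGrowth := by
  have : (fun ξ => (omega m ξ)⁻¹) =
      fun ξ => m⁻¹ * (1 + ‖((2 * Real.pi) / m) • ξ‖ ^ 2) ^ (-((1 : ℝ) / 2)) := by
    ext ξ
    rw [omega_eq hm, mul_inv, Real.rpow_neg (by positivity)]
  rw [this]
  exact (Function.HasTemperateGrowth.const _).mul (hasTemperateGrowth_rpow_smul _ _)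

theorem hasTemperateGrowth_ofReal {f : R3 → ℝ} (hf : f.HasTemperateGrowth) :
    (fun ξ => (f ξ : ℂ)).HasTemperateGrowth :=
  Function.Complex.hasTemperateGrowth_ofReal.comp hf

theorem hasTemperateGrowth_sin_omega (hm : 0 < m) (t : ℝ) :
    (fun ξ => Real.sin (t * omega m ξ)).HasTemperateGrowth :=
  hasTemperateGrowth_sin.comp ((Function.HasTemperateGrowth.const t).mul
    (hasTemperateGrowth_omega hm))

theorem hasTemperateGrowth_cos_omega (hm : 0 < m) (t : ℝ) :
    (fun ξ => Real.cos (t * omega m ξ)).HasTemperateGrowth :=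
  hasTemperateGrowth_cos.comp ((Function.HasTemperateGrowth.const t).mul
    (hasTemperateGrowth_omega hm))

theorem besselSymbol_zero (ξ : R3) : besselSymbol 0 ξ = 1 := by simp [besselSymbol]

theorem besselSymbol_neg_mul (s : ℝ) (ξ : R3) : besselSymbol (-s) ξ * besselSymbol s ξ = 1 := by
  rw [besselSymbol, besselSymbol, ← Complex.ofReal_mul, ← Real.rpow_add (by positivity),
    show -s / 2 + s / 2 = 0 by ring, Real.rpow_zero, Complex.ofReal_one]

theorem besselSymbol_one (ξ : R3) : besselSymbol 1 ξ = (omega 1 ξ : ℂ) := by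
  rw [besselSymbol, omega_eq one_pos, div_one, one_mul]

theorem besselSymbol_neg_one (ξ : R3) : besselSymbol (-1) ξ = ((omega 1 ξ)⁻¹ : ℝ) := by
  have h := besselSymbol_neg_mul 1 ξ
  rw [besselSymbol_one] at h
  rw [Complex.ofReal_inv]
  exact eq_inv_of_mul_eq_one_left h

/-- The symbol of ⟨∇⟩ becomes a function of ω, so the factors created by conjugation fit the form
α(ω). -/
theorem unitDisp_omega (m : ℝ) (ξ : R3) : unitDisp m (omega m ξ) = omega 1 ξ := by
  rw [unitDisp, ← Real.sqrt_sq (omega_pos one_pos ξ).le, sq_omega, sq_omega]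
  congr 1
  ring

end Symbols

/-! ### Transposed Fourier multipliers -/

section DualMult

/-- The transpose of the Fourier multiplier with the symbol `a`. -/
def dualMult (a : R3 → ℂ) (φ : 𝓢(R3, ℂ)) : 𝓢(R3, ℂ) := 𝓕 (SchwartzMap.smulLeftCLM ℂ a (𝓕⁻ φ))

theorem weightedBessel_apply (s σ : ℝ) (u : Dist) (φ : 𝓢(R3, ℂ)) :
    weightedBessel s σ u φ =
      u (dualMult (besselSymbol s) (SchwartzMap.smulLeftCLM ℂ (weight σ) φ)) := rfl

variable {a b c : R3 → ℂ}

/-- The inverse transform diagonalizes all transposed multipliers, so identities among them reduce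
to pointwise identities of symbols. -/
theorem fourierInv_dualMult_apply (ha : a.HasTemperateGrowth) (φ : 𝓢(R3, ℂ)) (ξ : R3) :
    𝓕⁻ (dualMult a φ) ξ = a ξ * 𝓕⁻ φ ξ := by
  rw [dualMult, FourierTransform.fourierInv_fourier_eq, SchwartzMap.smulLeftCLM_apply_apply ha,
    smul_eq_mul]

theorem eq_of_fourierInv_eq {φ χ : 𝓢(R3, ℂ)} (h : ∀ ξ, 𝓕⁻ φ ξ = 𝓕⁻ χ ξ) : φ = χ := by
  have : (𝓕⁻ φ : 𝓢(R3, ℂ)) = 𝓕⁻ χ := SchwartzMap.ext h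
  simpa only [FourierTransform.fourier_fourierInv_eq] using
    congrArg (fun f : 𝓢(R3, ℂ) => (𝓕 f : 𝓢(R3, ℂ))) this

theorem dualMult_dualMult (ha : a.HasTemperateGrowth) (hb : b.HasTemperateGrowth)
    (hc : c.HasTemperateGrowth) (h : ∀ ξ, a ξ * b ξ = c ξ) (φ : 𝓢(R3, ℂ)) :
    dualMult a (dualMult b φ) = dualMult c φ :=
  eq_of_fourierInv_eq fun ξ => by
    rw [fourierInv_dualMult_apply ha, fourierInv_dualMult_apply hb, fourierInv_dualMult_apply hc,
      ← h, mul_assoc]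

theorem dualMult_sub (ha : a.HasTemperateGrowth) (hb : b.HasTemperateGrowth)
    (hc : c.HasTemperateGrowth) (h : ∀ ξ, a ξ - b ξ = c ξ) (φ : 𝓢(R3, ℂ)) :
    dualMult a φ - dualMult b φ = dualMult c φ :=
  eq_of_fourierInv_eq fun ξ => by
    rw [sub_eq_add_neg, FourierTransform.fourierInv_add, FourierTransform.fourierInv_neg, add_apply,
      neg_apply, fourierInv_dualMult_apply ha, fourierInv_dualMult_apply hb,
      fourierInv_dualMult_apply hc, ← h]
    ring

theorem dualMult_const (c : ℂ) (φ : 𝓢(R3, ℂ)) : dualMult (fun _ => c) φ = c • φ :=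
  eq_of_fourierInv_eq fun ξ => by
    rw [fourierInv_dualMult_apply (Function.HasTemperateGrowth.const c),
      FourierTransform.fourierInv_smul]
    rfl

theorem dualMult_besselSymbol_zero (φ : 𝓢(R3, ℂ)) : dualMult (besselSymbol 0) φ = φ := by
  rw [funext besselSymbol_zero, dualMult_const, one_smul]

theorem smulLeft_weight_zero (φ : 𝓢(R3, ℂ)) : SchwartzMap.smulLeftCLM ℂ (weight 0) φ = φ := by
  ext x
  rw [SchwartzMap.smulLeftCLM_apply_apply (hasTemperateGrowth_weight 0)]
  simp [weight]

theorem smulLeft_weight_neg (σ : ℝ) (φ : 𝓢(R3, ℂ)) :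
    SchwartzMap.smulLeftCLM ℂ (weight σ) (SchwartzMap.smulLeftCLM ℂ (weight (-σ)) φ) = φ := by
  ext x
  rw [SchwartzMap.smulLeftCLM_apply_apply (hasTemperateGrowth_weight _),
    SchwartzMap.smulLeftCLM_apply_apply (hasTemperateGrowth_weight _), smul_smul, weight, weight,
    ← Complex.ofReal_mul, ← Real.rpow_add (by positivity), show σ / 2 + -σ / 2 = 0 by ring]
  simp

theorem l2norm_dualMult_le_mul (ha : a.HasTemperateGrowth) (hb : b.HasTemperateGrowth) {K : ℝ}
    (h : ∀ ξ, ‖a ξ‖ ≤ K * ‖b ξ‖) (φ : 𝓢(R3, ℂ)) :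
    l2norm (dualMult a φ) ≤ K * l2norm (dualMult b φ) := by
  rw [← l2norm_fourierInv (dualMult a φ), ← l2norm_fourierInv (dualMult b φ)]
  refine l2norm_le_mul fun ξ => ?_
  rw [fourierInv_dualMult_apply ha, fourierInv_dualMult_apply hb, norm_mul, norm_mul, ← mul_assoc]
  gcongr
  exact h ξ

theorem l2norm_dualMult_le (ha : a.HasTemperateGrowth) {K : ℝ} (h : ∀ ξ, ‖a ξ‖ ≤ K)
    (φ : 𝓢(R3, ℂ)) : l2norm (dualMult a φ) ≤ K * l2norm φ := by
  have := l2norm_dualMult_le_mul ha (Function.HasTemperateGrowth.const (1 : ℂ))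
    (K := K) (by simpa using h) φ
  rwa [dualMult_const, one_smul] at this

/-- Recovering a distribution from `⟨x⟩ ^ σ ⟨∇⟩ ^ s u`. -/
theorem apply_dualMult_of_weightedBessel_eq {s σ : ℝ} {u v : Dist} (h : weightedBessel s σ u = v)
    (ha : a.HasTemperateGrowth) (hb : b.HasTemperateGrowth)
    (hab : ∀ ξ, besselSymbol (-s) ξ * a ξ = b ξ) (φ : 𝓢(R3, ℂ)) :
    u (dualMult a φ) = v (SchwartzMap.smulLeftCLM ℂ (weight (-σ)) (dualMult b φ)) := by
  rw [← h, weightedBessel_apply, smulLeft_weight_neg,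
    dualMult_dualMult (hasTemperateGrowth_besselSymbol s) hb ha fun ξ => ?_]
  rw [← hab, ← mul_assoc, mul_comm (besselSymbol s ξ), besselSymbol_neg_mul, one_mul]

/-- Once the symbol is a pointwise factor under an integral, dependence on time can be treated by
dominated convergence. -/
theorem toTemperedDistribution_dualMult (ha : a.HasTemperateGrowth)
    (g : Lp ℂ 2 (volume : Measure R3)) (φ : 𝓢(R3, ℂ)) :
    (g : Dist) (dualMult a φ) =
      ∫ ξ, a ξ * 𝓕⁻ φ ξ * (𝓕 g : Lp ℂ 2 (volume : Measure R3)) ξ := by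
  have h : (g : Dist) (dualMult a φ) =
      (𝓕 (g : Dist)) (SchwartzMap.smulLeftCLM ℂ a (𝓕⁻ φ)) := rfl
  rw [h, Lp.fourier_toTemperedDistribution_eq, Lp.toTemperedDistribution_apply]
  refine integral_congr_ae (Eventually.of_forall fun ξ => ?_)
  simp only [SchwartzMap.smulLeftCLM_apply_apply ha, smul_eq_mul]

end DualMult

/-! ### Differentiation and continuity in time -/

section TimeDependence

/-- A family of symbols that is differentiable in time, with a uniform bound. -/
structure SymbolPath (a a' : ℝ → R3 → ℂ) : Prop where
  growth : ∀ t, (a t).HasTemperateGrowth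
  growth_deriv : ∀ t, (a' t).HasTemperateGrowth
  hasDerivAt : ∀ t ξ, HasDerivAt (fun s => a s ξ) (a' t ξ) t
  bound : ∃ h : R3 → ℂ, h.HasTemperateGrowth ∧ ∀ t ξ, ‖a' t ξ‖ ≤ ‖h ξ‖

variable {a a' : ℝ → R3 → ℂ}

theorem SymbolPath.hasDerivAt_apply_Lp (ha : SymbolPath a a')
    (g : Lp ℂ 2 (volume : Measure R3)) (φ : 𝓢(R3, ℂ)) (t : ℝ) :
    HasDerivAt (fun s => (g : Dist) (dualMult (a s) φ)) ((g : Dist) (dualMult (a' t) φ)) t := by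
  obtain ⟨h, hh, hb⟩ := ha.bound
  have I : ∀ {c : R3 → ℂ}, c.HasTemperateGrowth → Integrable fun ξ =>
      c ξ * 𝓕⁻ φ ξ * (𝓕 g : Lp ℂ 2 (volume : Measure R3)) ξ := by
    intro c hc
    have := ((SchwartzMap.smulLeftCLM ℂ c (𝓕⁻ φ)).memLp 2 volume).integrable_mul
      (Lp.memLp (𝓕 g : Lp ℂ 2 (volume : Measure R3)))
    refine this.congr (Eventually.of_forall fun ξ => ?_)
    simp only [Pi.mul_apply, SchwartzMap.smulLeftCLM_apply_apply hc, smul_eq_mul]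
  simp only [toTemperedDistribution_dualMult (ha.growth _),
    toTemperedDistribution_dualMult (ha.growth_deriv _)]
  refine (hasDerivAt_integral_of_dominated_loc_of_deriv_le (s := Set.univ)
    (F' := fun s ξ => a' s ξ * 𝓕⁻ φ ξ * (𝓕 g : Lp ℂ 2 (volume : Measure R3)) ξ)
    (bound := fun ξ => ‖h ξ * 𝓕⁻ φ ξ * (𝓕 g : Lp ℂ 2 (volume : Measure R3)) ξ‖)
    univ_mem (Eventually.of_forall fun s => (I (ha.growth s)).aestronglyMeasurable)
    (I (ha.growth t)) (I (ha.growth_deriv t)).aestronglyMeasurable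
    (Eventually.of_forall fun ξ s _ => ?_) (I hh).norm
    (Eventually.of_forall fun ξ s _ => ?_)).2
  · rw [norm_mul, norm_mul, norm_mul, norm_mul]
    gcongr
    exact hb s ξ
  · exact ((ha.hasDerivAt s ξ).mul_const _).mul_const _

/-- Reduction to L²: u is ⟨∇⟩^(-s) of an L² function, and this operator can be transferred to the
test function, since multipliers commute. -/
theorem SymbolPath.hasDerivAt_apply (ha : SymbolPath a a') {s : ℝ} {u : Dist}
    (hu : sobolevNorm s 0 u < ∞) (φ : 𝓢(R3, ℂ)) (t : ℝ) :
    HasDerivAt (fun r => u (dualMult (a r) φ)) (u (dualMult (a' t) φ)) t := by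
  obtain ⟨f, hf, -⟩ := exists_eq_of_sobolevNorm_lt_top hu
  have hB := hasTemperateGrowth_besselSymbol (-s)
  have key : ∀ {c : R3 → ℂ}, c.HasTemperateGrowth →
      u (dualMult c φ) = (f : Dist) (dualMult c (dualMult (besselSymbol (-s)) φ)) := by
    intro c hc
    rw [apply_dualMult_of_weightedBessel_eq hf hc (hB.mul hc) (fun ξ => rfl), neg_zero,
      smulLeft_weight_zero, dualMult_dualMult hc hB (hB.mul hc) fun ξ => mul_comm _ _]
  simp only [key (ha.growth _), key (ha.growth_deriv _)]
  exact ha.hasDerivAt_apply_Lp f _ t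

theorem SymbolPath.norm_sub_le (ha : SymbolPath a a') {h : R3 → ℂ}
    (hb : ∀ t ξ, ‖a' t ξ‖ ≤ ‖h ξ‖) (s t : ℝ) (ξ : R3) :
    ‖a s ξ - a t ξ‖ ≤ |s - t| * ‖h ξ‖ := by
  have := Convex.norm_image_sub_le_of_norm_hasDerivWithin_le (s := Set.univ)
    (fun x _ => (ha.hasDerivAt x ξ).hasDerivWithinAt) (fun x _ => hb x ξ) convex_univ
    (Set.mem_univ t) (Set.mem_univ s)
  rwa [Real.norm_eq_abs, mul_comm] at this

/-- The product rule for a curve of distributions that is continuous in `L²` and a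
differentiable family of multipliers. -/
theorem SymbolPath.hasDerivAt_pairing (ha : SymbolPath a a') {u : ℝ → Dist} {t : ℝ}
    (hu : sobolevNorm 0 0 (u t) < ∞)
    (hc : Tendsto (fun s => sobolevNorm 0 0 (u s - u t)) (𝓝 t) (𝓝 0)) (φ : 𝓢(R3, ℂ)) {d : ℂ}
    (hd : HasDerivAt (fun s => u s (dualMult (a t) φ)) d t) :
    HasDerivAt (fun s => u s (dualMult (a s) φ)) (d + u t (dualMult (a' t) φ)) t := by
  obtain ⟨h, hh, hb⟩ := ha.bound
  have h0 := ha.hasDerivAt_apply hu φ t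
  have hsum := hd.add h0
  -- The cross term is o(s - t): the first factor tends to zero in L², while the second is O(s - t)
  -- by the mean value inequality. The denominator L + 1 avoids division by zero.
  have hrest : HasDerivAt (fun s => (u s - u t) (dualMult (a s) φ - dualMult (a t) φ)) 0 t := by
    rw [hasDerivAt_iff_isLittleO, Asymptotics.isLittleO_iff]
    intro ε hε
    set L := l2norm (dualMult h φ) with hL
    have hL0 : 0 ≤ L := l2norm_nonneg _
    have hev : ∀ᶠ s in 𝓝 t, sobolevNorm 0 0 (u s - u t) < ENNReal.ofReal (ε / (L + 1)) :=
      hc.eventually_lt_const (ENNReal.ofReal_pos.2 (by positivity))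
    filter_upwards [hev] with s hs
    obtain ⟨g, hg, hgn⟩ := exists_eq_of_sobolevNorm_lt_top (hs.trans ENNReal.ofReal_lt_top)
    rw [hgn, ← ofReal_norm, ENNReal.ofReal_lt_ofReal_iff (by positivity)] at hs
    have e : (u s - u t) = (g : Dist) := by
      rw [← hg]
      ext χ
      rw [weightedBessel_apply, smulLeft_weight_zero, dualMult_besselSymbol_zero]
    have hD : l2norm (dualMult (a s) φ - dualMult (a t) φ) ≤ |s - t| * L := by
      rw [dualMult_sub (ha.growth s) (ha.growth t) ((ha.growth s).sub (ha.growth t)) fun ξ => rfl]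
      exact l2norm_dualMult_le_mul ((ha.growth s).sub (ha.growth t)) hh
        (ha.norm_sub_le hb s t) φ
    have := norm_toTemperedDistribution_apply_le g (dualMult (a s) φ - dualMult (a t) φ)
    simp only [sub_self, map_zero, smul_zero, sub_zero]
    rw [e, Real.norm_eq_abs]
    calc _ ≤ ‖g‖ * (|s - t| * L) := this.trans (by gcongr)
      _ ≤ ε / (L + 1) * (|s - t| * (L + 1)) := by gcongr; linarith
      _ = ε * |s - t| := by field_simp
  have := hsum.add hrest
  rw [add_zero] at this
  have h1 : HasDerivAt (fun _ : ℝ => u t (dualMult (a t) φ)) 0 t := hasDerivAt_const _ _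
  have := this.sub h1
  rw [sub_zero] at this
  refine this.congr_of_eventuallyEq (Eventually.of_forall fun s => ?_)
  simp only [Pi.add_apply, Pi.sub_apply, map_sub, sub_apply]
  ring

/-- Strong continuity of a bounded family of multipliers on `L²`. -/
theorem tendsto_eLpNorm_symbol_sub {b : ℝ → R3 → ℂ} (hbc : ∀ t, Continuous (b t))
    (hbt : ∀ ξ, Continuous fun t => b t ξ) {K : ℝ} (hK : ∀ t ξ, ‖b t ξ‖ ≤ K)
    (G : Lp ℂ 2 (volume : Measure R3)) (t : ℝ) :
    Tendsto (fun s => eLpNorm (fun ξ => (b s ξ - b t ξ) * G ξ) 2 volume) (𝓝 t) (𝓝 0) := by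
  have hG := Lp.memLp G
  have hK0 : 0 ≤ K := (norm_nonneg _).trans (hK 0 0)
  have e : ∀ s, eLpNorm (fun ξ => (b s ξ - b t ξ) * G ξ) 2 volume =
      (∫⁻ ξ, ‖(b s ξ - b t ξ) * G ξ‖ₑ ^ (2 : ℝ)) ^ (1 / 2 : ℝ) := fun s => by
    rw [eLpNorm_eq_lintegral_rpow_enorm_toReal two_ne_zero ENNReal.ofNat_ne_top]
    simp
  simp only [e]
  have hlim : Tendsto (fun s => ∫⁻ ξ, ‖(b s ξ - b t ξ) * G ξ‖ₑ ^ (2 : ℝ)) (𝓝 t)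
      (𝓝 (∫⁻ _ : R3, 0)) := by
    refine tendsto_lintegral_filter_of_dominated_convergence
      (fun ξ => (ENNReal.ofReal (2 * K) * ‖G ξ‖ₑ) ^ (2 : ℝ)) (Eventually.of_forall fun s => ?_)
      (Eventually.of_forall fun s => Eventually.of_forall fun ξ => ?_) ?_
      (Eventually.of_forall fun ξ => ?_)
    · exact ((((hbc s).sub (hbc t)).measurable.mul
        (Lp.stronglyMeasurable G).measurable).enorm).pow_const _
    · simp only [enorm_mul]
      gcongr
      rw [← ofReal_norm]
      refine ENNReal.ofReal_le_ofReal ((norm_sub_le _ _).trans ?_)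
      linarith [hK s ξ, hK t ξ]
    · have h1 := lintegral_rpow_enorm_lt_top_of_eLpNorm_lt_top two_ne_zero ENNReal.ofNat_ne_top
        hG.2
      simp only [ENNReal.toReal_ofNat] at h1
      simp only [ENNReal.mul_rpow_of_nonneg _ _ zero_le_two]
      rw [lintegral_const_mul' _ _ (by finiteness)]
      exact ENNReal.mul_ne_top (by finiteness) h1.ne
    · have h1 : Tendsto (fun s => ‖(b s ξ - b t ξ) * G ξ‖ₑ) (𝓝 t) (𝓝 0) := by
        have : Continuous fun s => ‖(b s ξ - b t ξ) * G ξ‖ₑ :=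
          (((hbt ξ).sub continuous_const).mul continuous_const).enorm
        simpa using this.tendsto t
      simpa [Function.comp_def] using (ENNReal.continuous_rpow_const (y := 2)).tendsto 0 |>.comp h1
  rw [lintegral_zero] at hlim
  have := (ENNReal.continuous_rpow_const (y := 1 / 2)).tendsto 0 |>.comp hlim
  simpa [Function.comp_def] using this

/-- The bound K only ensures finiteness. The estimate keeps the norm of c times the transform of g,
which can tend to zero even when the supremum of c does not. -/
theorem norm_apply_dualMult_le {c : R3 → ℂ} (hc : c.HasTemperateGrowth) {K : ℝ}
    (hK : ∀ ξ, ‖c ξ‖ ≤ K) (g : Lp ℂ 2 (volume : Measure R3)) (φ : 𝓢(R3, ℂ)) :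
    ‖(g : Dist) (dualMult c φ)‖ ≤ (eLpNorm (fun ξ => c ξ *
      (𝓕 g : Lp ℂ 2 (volume : Measure R3)) ξ) 2 volume).toReal * l2norm φ := by
  set G := (𝓕 g : Lp ℂ 2 (volume : Measure R3))
  have hm : AEStronglyMeasurable (fun ξ => c ξ * G ξ) volume :=
    hc.1.continuous.aestronglyMeasurable.mul (Lp.aestronglyMeasurable G)
  have hfin : MemLp (fun ξ => c ξ * G ξ) 2 volume := by
    refine (Lp.memLp G).of_le_mul (c := K) hm (Eventually.of_forall fun ξ => ?_)
    rw [norm_mul]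
    gcongr
    exact hK ξ
  have h := enorm_integral_mul_le (𝓕⁻ φ : 𝓢(R3, ℂ)).continuous.aestronglyMeasurable hm
  have e : (g : Dist) (dualMult c φ) = ∫ ξ, 𝓕⁻ φ ξ * (c ξ * G ξ) := by
    rw [toTemperedDistribution_dualMult hc]
    refine integral_congr_ae (Eventually.of_forall fun ξ => ?_)
    simp only [G]
    ring
  rw [e]
  rw [← ofReal_l2norm, l2norm_fourierInv, ← ENNReal.ofReal_toReal hfin.2.ne,
    ← ENNReal.ofReal_mul (l2norm_nonneg _), ← ofReal_norm] at h
  rw [mul_comm]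
  exact (ENNReal.ofReal_le_ofReal_iff (mul_nonneg (l2norm_nonneg _) ENNReal.toReal_nonneg)).1 h

end TimeDependence

/-! ### Existence and uniqueness of the solution -/

section Propagator

variable {m : ℝ}

/-- The symbol `cos (t ω)`. -/
def cosSymbol (m t : ℝ) (ξ : R3) : ℂ := (Real.cos (t * omega m ξ) : ℝ)

/-- The symbol `α(ω) sin (t ω)`. -/
def sinSymbol (m : ℝ) (α : ℝ → ℝ) (t : ℝ) (ξ : R3) : ℂ :=
  (α (omega m ξ) * Real.sin (t * omega m ξ) : ℝ)

/-- The propagator of the free Klein-Gordon equation. -/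
def propagator (m t : ℝ) (Ψ : Phase) : Phase :=
  (fourierMultiplierCLM ℂ (cosSymbol m t) Ψ.1 +
      fourierMultiplierCLM ℂ (sinSymbol m (fun w => w⁻¹) t) Ψ.2,
    fourierMultiplierCLM ℂ (sinSymbol m (fun w => -w) t) Ψ.1 +
      fourierMultiplierCLM ℂ (cosSymbol m t) Ψ.2)

theorem hasTemperateGrowth_cosSymbol (hm : 0 < m) (t : ℝ) :
    (cosSymbol m t).HasTemperateGrowth :=
  hasTemperateGrowth_ofReal (hasTemperateGrowth_cos_omega hm t)

theorem hasTemperateGrowth_sinSymbol (hm : 0 < m) {α : ℝ → ℝ}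
    (hα : (fun ξ => α (omega m ξ)).HasTemperateGrowth) (t : ℝ) :
    (sinSymbol m α t).HasTemperateGrowth :=
  hasTemperateGrowth_ofReal (hα.mul (hasTemperateGrowth_sin_omega hm t))

theorem hasTemperateGrowth_neg_omega (hm : 0 < m) :
    (fun ξ => -omega m ξ).HasTemperateGrowth := (hasTemperateGrowth_omega hm).neg

theorem hasTemperateGrowth_unitDisp_mul_inv (hm : 0 < m) :
    (fun ξ => unitDisp m (omega m ξ) * (omega m ξ)⁻¹).HasTemperateGrowth := by
  simp only [unitDisp_omega]
  exact (hasTemperateGrowth_omega one_pos).mul (hasTemperateGrowth_inv_omega hm)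

theorem hasTemperateGrowth_neg_mul_inv_unitDisp (hm : 0 < m) :
    (fun ξ => -(omega m ξ * (unitDisp m (omega m ξ))⁻¹)).HasTemperateGrowth := by
  simp only [unitDisp_omega]
  exact ((hasTemperateGrowth_omega hm).mul (hasTemperateGrowth_inv_omega one_pos)).neg

theorem norm_cosSymbol_le (m t : ℝ) (ξ : R3) : ‖cosSymbol m t ξ‖ ≤ 1 := by
  rw [cosSymbol, Complex.norm_real]
  exact Real.abs_cos_le_one _

theorem norm_sinSymbol_le (α : ℝ → ℝ) (t : ℝ) (ξ : R3) :
    ‖sinSymbol m α t ξ‖ ≤ |α (omega m ξ)| := by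
  rw [sinSymbol, Complex.norm_real, Real.norm_eq_abs, abs_mul]
  exact mul_le_of_le_one_right (abs_nonneg _) (Real.abs_sin_le_one _)

theorem hasDerivAt_cos_mul (t w : ℝ) : HasDerivAt (fun s => Real.cos (s * w))
    (-w * Real.sin (t * w)) t := by
  have := ((hasDerivAt_id t).mul_const w).cos
  simp only [id_eq, one_mul] at this
  exact this.congr_deriv (by ring)

theorem hasDerivAt_sin_mul (t w : ℝ) : HasDerivAt (fun s => Real.sin (s * w))
    (w * Real.cos (t * w)) t := by
  have := ((hasDerivAt_id t).mul_const w).sin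
  simp only [id_eq, one_mul] at this
  exact this.congr_deriv (by ring)

theorem symbolPath_cos (hm : 0 < m) :
    SymbolPath (cosSymbol m) (sinSymbol m fun w => -w) where
  growth := hasTemperateGrowth_cosSymbol hm
  growth_deriv := hasTemperateGrowth_sinSymbol hm (hasTemperateGrowth_neg_omega hm)
  hasDerivAt t ξ := (hasDerivAt_cos_mul t (omega m ξ)).ofReal_comp
  bound := ⟨_, hasTemperateGrowth_ofReal (hasTemperateGrowth_omega hm), fun t ξ => by
    refine (norm_sinSymbol_le _ t ξ).trans ?_
    rw [abs_neg, Complex.norm_real, Real.norm_eq_abs]⟩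

theorem symbolPath_sinc (hm : 0 < m) :
    SymbolPath (sinSymbol m fun w => w⁻¹) (cosSymbol m) where
  growth := hasTemperateGrowth_sinSymbol hm (hasTemperateGrowth_inv_omega hm)
  growth_deriv := hasTemperateGrowth_cosSymbol hm
  hasDerivAt t ξ := by
    have h := ((hasDerivAt_sin_mul t (omega m ξ)).const_mul (omega m ξ)⁻¹).ofReal_comp
    rw [← mul_assoc, inv_mul_cancel₀ (omega_pos hm ξ).ne', one_mul] at h
    exact h
  bound := ⟨_, Function.HasTemperateGrowth.const (1 : ℂ), fun t ξ => by
    rw [norm_one]; exact norm_cosSymbol_le m t ξ⟩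

/-- The symbol `-ω² cos (t ω)`. -/
def negSqCosSymbol (m t : ℝ) (ξ : R3) : ℂ := (-omega m ξ * (omega m ξ * Real.cos (t * omega m ξ)) : ℝ)

theorem symbolPath_sin (hm : 0 < m) :
    SymbolPath (sinSymbol m fun w => -w) (negSqCosSymbol m) where
  growth := hasTemperateGrowth_sinSymbol hm (hasTemperateGrowth_neg_omega hm)
  growth_deriv t := hasTemperateGrowth_ofReal ((hasTemperateGrowth_neg_omega hm).mul
    ((hasTemperateGrowth_omega hm).mul (hasTemperateGrowth_cos_omega hm t)))
  hasDerivAt t ξ := ((hasDerivAt_sin_mul t (omega m ξ)).const_mul (-omega m ξ)).ofReal_comp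
  bound := ⟨_, hasTemperateGrowth_ofReal ((hasTemperateGrowth_omega hm).mul
    (hasTemperateGrowth_omega hm)), fun t ξ => by
      rw [negSqCosSymbol, Complex.norm_real, Complex.norm_real, norm_mul, norm_mul, norm_neg,
        Pi.mul_apply, norm_mul]
      gcongr
      exact mul_le_of_le_one_right (norm_nonneg _) (Real.abs_cos_le_one _)⟩

theorem SymbolPath.comp_const_sub {a a' : ℝ → R3 → ℂ} (ha : SymbolPath a a') (T : ℝ) :
    SymbolPath (fun s => a (T - s)) (fun s => -a' (T - s)) where
  growth t := ha.growth _
  growth_deriv t := (ha.growth_deriv _).neg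
  hasDerivAt t ξ := (ha.hasDerivAt (T - t) ξ).comp_const_sub T t
  bound := by
    obtain ⟨h, hh, hb⟩ := ha.bound
    exact ⟨h, hh, fun t ξ => by simpa using hb (T - t) ξ⟩

theorem hasTemperateGrowth_neg_sq_omega (hm : 0 < m) :
    (fun ξ => ((-omega m ξ * omega m ξ : ℝ) : ℂ)).HasTemperateGrowth :=
  hasTemperateGrowth_ofReal ((hasTemperateGrowth_neg_omega hm).mul (hasTemperateGrowth_omega hm))

/-- The operator Δ - m² has the symbol -ω², so the second equation becomes the oscillator equation
π' = -ω² ψ frequency by frequency. -/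
theorem laplacian_sub_apply (hm : 0 < m) (u : Dist) (φ : 𝓢(R3, ℂ)) :
    (Δ u - ((m : ℂ) ^ 2) • u) φ = u (dualMult (fun ξ => ((-omega m ξ * omega m ξ : ℝ) : ℂ)) φ) := by
  have hT : (fun ξ : R3 => ((‖ξ‖ ^ 2 : ℝ) : ℂ)).HasTemperateGrowth :=
    hasTemperateGrowth_ofReal (Function.hasTemperateGrowth_norm_sq R3)
  have e : dualMult (fun ξ => ((-omega m ξ * omega m ξ : ℝ) : ℂ)) φ =
      (-(2 * Real.pi : ℂ) ^ 2) • dualMult (fun ξ : R3 => ((‖ξ‖ ^ 2 : ℝ) : ℂ)) φ -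
        ((m : ℂ) ^ 2) • φ := by
    refine eq_of_fourierInv_eq fun ξ => ?_
    rw [sub_eq_add_neg, FourierTransform.fourierInv_add, FourierTransform.fourierInv_neg,
      FourierTransform.fourierInv_smul, FourierTransform.fourierInv_smul, add_apply, neg_apply,
      smul_apply, smul_apply, fourierInv_dualMult_apply (hasTemperateGrowth_neg_sq_omega hm),
      fourierInv_dualMult_apply hT, neg_mul, ← sq, sq_omega]
    simp only [smul_eq_mul]
    push_cast
    ring
  rw [e, laplacian_eq_fourierMultiplierCLM, map_sub, map_smul, map_smul]
  change (-(2 * Real.pi) ^ 2 : ℝ) • (u (dualMult _ φ)) - _ = _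
  rw [Complex.real_smul]
  push_cast
  rfl

theorem freeHamiltonian_fst_apply (m : ℝ) (Ψ : Phase) (φ : 𝓢(R3, ℂ)) :
    -Complex.I * (freeHamiltonian m Ψ).1 φ = Ψ.2 φ := by
  change -Complex.I * (Complex.I * Ψ.2 φ) = Ψ.2 φ
  rw [← mul_assoc, neg_mul, Complex.I_mul_I, neg_neg, one_mul]

theorem freeHamiltonian_snd_apply (hm : 0 < m) (Ψ : Phase) (φ : 𝓢(R3, ℂ)) :
    -Complex.I * (freeHamiltonian m Ψ).2 φ =
      Ψ.1 (dualMult (fun ξ => ((-omega m ξ * omega m ξ : ℝ) : ℂ)) φ) := by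
  rw [← laplacian_sub_apply hm]
  change -Complex.I * (Complex.I * (Δ Ψ.1 - ((m : ℂ) ^ 2) • Ψ.1) φ) = _
  rw [← mul_assoc, neg_mul, Complex.I_mul_I, neg_neg, one_mul]

theorem propagator_fst_apply (m t : ℝ) (Ψ : Phase) (φ : 𝓢(R3, ℂ)) :
    (propagator m t Ψ).1 φ = Ψ.1 (dualMult (cosSymbol m t) φ) +
      Ψ.2 (dualMult (sinSymbol m (fun w => w⁻¹) t) φ) := rfl

theorem propagator_snd_apply (m t : ℝ) (Ψ : Phase) (φ : 𝓢(R3, ℂ)) :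
    (propagator m t Ψ).2 φ = Ψ.1 (dualMult (sinSymbol m (fun w => -w) t) φ) +
      Ψ.2 (dualMult (cosSymbol m t) φ) := rfl

theorem dualMult_cosSymbol_zero (m : ℝ) (φ : 𝓢(R3, ℂ)) : dualMult (cosSymbol m 0) φ = φ := by
  have : cosSymbol m 0 = fun _ => 1 := by ext; simp [cosSymbol]
  rw [this, dualMult_const, one_smul]

theorem dualMult_sinSymbol_zero (m : ℝ) (α : ℝ → ℝ) (φ : 𝓢(R3, ℂ)) :
    dualMult (sinSymbol m α 0) φ = 0 := by
  have : sinSymbol m α 0 = fun _ => 0 := by ext; simp [sinSymbol]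
  rw [this, dualMult_const, zero_smul]

theorem propagator_zero (m : ℝ) (Ψ : Phase) : propagator m 0 Ψ = Ψ := by
  refine Prod.ext ?_ ?_
  · ext φ
    rw [propagator_fst_apply, dualMult_cosSymbol_zero, dualMult_sinSymbol_zero, map_zero, add_zero]
  · ext φ
    rw [propagator_snd_apply, dualMult_cosSymbol_zero, dualMult_sinSymbol_zero, map_zero, zero_add]

theorem apply_dualMult_dualMult {s σ r : ℝ} {u v : Dist} (h : weightedBessel s σ u = v)
    {a e : R3 → ℂ} (ha : a.HasTemperateGrowth) (he : e.HasTemperateGrowth)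
    (hae : ∀ ξ, besselSymbol (-s) ξ * (a ξ * besselSymbol r ξ) = e ξ) (φ : 𝓢(R3, ℂ)) :
    u (dualMult a (dualMult (besselSymbol r) φ)) =
      v (SchwartzMap.smulLeftCLM ℂ (weight (-σ)) (dualMult e φ)) := by
  have hB := hasTemperateGrowth_besselSymbol r
  rw [dualMult_dualMult ha hB (ha.mul hB) fun ξ => rfl,
    apply_dualMult_of_weightedBessel_eq h (ha.mul hB) he hae]

/-- The factor ⟨∇⟩ on the output cancels the ⟨∇⟩⁻¹ of the first datum and turns ω⁻¹ into ω₁/ω for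
the second. The output weight τ is independent of σ: τ = 0 serves the solution property and τ = -σ
the decay. -/
theorem weightedBessel_propagator_fst (hm : 0 < m) {σ : ℝ} {Ψ : Phase} {f g : Dist}
    (hf : weightedBessel 1 σ Ψ.1 = f) (hg : weightedBessel 0 σ Ψ.2 = g) (τ t : ℝ)
    (φ : 𝓢(R3, ℂ)) :
    weightedBessel 1 τ (propagator m t Ψ).1 φ =
      f (SchwartzMap.smulLeftCLM ℂ (weight (-σ))
        (dualMult (cosSymbol m t) (SchwartzMap.smulLeftCLM ℂ (weight τ) φ))) +
      g (SchwartzMap.smulLeftCLM ℂ (weight (-σ))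
        (dualMult (sinSymbol m (fun w => unitDisp m w * w⁻¹) t)
          (SchwartzMap.smulLeftCLM ℂ (weight τ) φ))) := by
  rw [weightedBessel_apply, propagator_fst_apply,
    apply_dualMult_dualMult hf (hasTemperateGrowth_cosSymbol hm t)
      (hasTemperateGrowth_cosSymbol hm t) fun ξ => ?_,
    apply_dualMult_dualMult hg (hasTemperateGrowth_sinSymbol hm (hasTemperateGrowth_inv_omega hm) t)
      (hasTemperateGrowth_sinSymbol (α := fun w => unitDisp m w * w⁻¹) hm
        (hasTemperateGrowth_unitDisp_mul_inv hm) t) fun ξ => ?_]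
  · rw [neg_zero, besselSymbol_zero, besselSymbol_one, sinSymbol, sinSymbol, unitDisp_omega]
    push_cast
    ring
  · rw [mul_left_comm, besselSymbol_neg_mul, mul_one]

theorem weightedBessel_propagator_snd (hm : 0 < m) {σ : ℝ} {Ψ : Phase} {f g : Dist}
    (hf : weightedBessel 1 σ Ψ.1 = f) (hg : weightedBessel 0 σ Ψ.2 = g) (τ t : ℝ)
    (φ : 𝓢(R3, ℂ)) :
    weightedBessel 0 τ (propagator m t Ψ).2 φ =
      f (SchwartzMap.smulLeftCLM ℂ (weight (-σ))
        (dualMult (sinSymbol m (fun w => -(w * (unitDisp m w)⁻¹)) t)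
          (SchwartzMap.smulLeftCLM ℂ (weight τ) φ))) +
      g (SchwartzMap.smulLeftCLM ℂ (weight (-σ))
        (dualMult (cosSymbol m t) (SchwartzMap.smulLeftCLM ℂ (weight τ) φ))) := by
  rw [weightedBessel_apply, propagator_snd_apply,
    apply_dualMult_dualMult hf (hasTemperateGrowth_sinSymbol hm (hasTemperateGrowth_neg_omega hm) t)
      (hasTemperateGrowth_sinSymbol (α := fun w => -(w * (unitDisp m w)⁻¹)) hm
        (hasTemperateGrowth_neg_mul_inv_unitDisp hm) t) fun ξ => ?_,
    apply_dualMult_dualMult hg (hasTemperateGrowth_cosSymbol hm t)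
      (hasTemperateGrowth_cosSymbol hm t) fun ξ => ?_]
  · rw [neg_zero, besselSymbol_zero, mul_one, one_mul]
  · rw [besselSymbol_zero, besselSymbol_neg_one, sinSymbol, sinSymbol, unitDisp_omega]
    push_cast
    ring

/-- A continuous and uniformly bounded family of symbols. -/
structure BddSymbolPath (e : ℝ → R3 → ℂ) : Prop where
  growth : ∀ t, (e t).HasTemperateGrowth
  continuous : ∀ ξ, Continuous fun t => e t ξ
  bound : ∃ K, 0 ≤ K ∧ ∀ t ξ, ‖e t ξ‖ ≤ K

theorem bddSymbolPath_cos (hm : 0 < m) : BddSymbolPath (cosSymbol m) where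
  growth := hasTemperateGrowth_cosSymbol hm
  continuous ξ := by unfold cosSymbol; fun_prop
  bound := ⟨1, zero_le_one, norm_cosSymbol_le m⟩

theorem bddSymbolPath_sin (hm : 0 < m) {α : ℝ → ℝ}
    (hα : (fun ξ => α (omega m ξ)).HasTemperateGrowth) (hb : BddDerivOn m 0 α) :
    BddSymbolPath (sinSymbol m α) where
  growth := hasTemperateGrowth_sinSymbol hm hα
  continuous ξ := by unfold sinSymbol; fun_prop
  bound := by
    obtain ⟨K, hK⟩ := hb.bdd
    exact ⟨K, (abs_nonneg _).trans (hK m le_rfl), fun t ξ =>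
      (norm_sinSymbol_le α t ξ).trans (hK _ (le_omega m ξ))⟩

section Bounded

variable {e₁ e₂ : ℝ → R3 → ℂ} {s : ℝ} {u : ℝ → Dist} {f g : Lp ℂ 2 (volume : Measure R3)}

theorem sobolevNorm_lt_top_of_bddSymbolPath (h₁ : BddSymbolPath e₁) (h₂ : BddSymbolPath e₂)
    (hu : ∀ r φ, weightedBessel s 0 (u r) φ =
      (f : Dist) (dualMult (e₁ r) φ) + (g : Dist) (dualMult (e₂ r) φ)) (t : ℝ) :
    sobolevNorm s 0 (u t) < ∞ := by
  obtain ⟨K₁, hK₁, hb₁⟩ := h₁.bound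
  obtain ⟨K₂, hK₂, hb₂⟩ := h₂.bound
  refine lt_of_le_of_lt (sobolevNorm_le_of_forall (C := ‖f‖ * K₁ + ‖g‖ * K₂) (by positivity)
    fun φ => ?_) ENNReal.ofReal_lt_top
  rw [hu]
  have n1 := norm_toTemperedDistribution_apply_le f (dualMult (e₁ t) φ)
  have n2 := norm_toTemperedDistribution_apply_le g (dualMult (e₂ t) φ)
  have l1 := l2norm_dualMult_le (h₁.growth t) (hb₁ t) φ
  have l2 := l2norm_dualMult_le (h₂.growth t) (hb₂ t) φ
  calc _ ≤ ‖f‖ * (K₁ * l2norm φ) + ‖g‖ * (K₂ * l2norm φ) :=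
        (norm_add_le _ _).trans (add_le_add (n1.trans (by gcongr)) (n2.trans (by gcongr)))
    _ = _ := by ring

theorem tendsto_sobolevNorm_sub_of_bddSymbolPath (h₁ : BddSymbolPath e₁) (h₂ : BddSymbolPath e₂)
    (hu : ∀ r φ, weightedBessel s 0 (u r) φ =
      (f : Dist) (dualMult (e₁ r) φ) + (g : Dist) (dualMult (e₂ r) φ)) (t : ℝ) :
    Tendsto (fun r => sobolevNorm s 0 (u r - u t)) (𝓝 t) (𝓝 0) := by
  have step : ∀ {e : ℝ → R3 → ℂ}, BddSymbolPath e → ∀ f : Lp ℂ 2 (volume : Measure R3),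
      ∃ N : ℝ → ℝ, (∀ r, 0 ≤ N r) ∧ Tendsto N (𝓝 t) (𝓝 0) ∧ ∀ r φ,
        ‖(f : Dist) (dualMult (e r) φ) - (f : Dist) (dualMult (e t) φ)‖ ≤ N r * l2norm φ := by
    intro e h f
    obtain ⟨K, hK, hb⟩ := h.bound
    refine ⟨fun r => (eLpNorm (fun ξ => (e r ξ - e t ξ) *
      (𝓕 f : Lp ℂ 2 (volume : Measure R3)) ξ) 2 volume).toReal, fun r => ENNReal.toReal_nonneg,
      ?_, fun r φ => ?_⟩
    · exact (ENNReal.tendsto_toReal ENNReal.zero_ne_top).comp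
        (tendsto_eLpNorm_symbol_sub (fun r => (h.growth r).1.continuous) h.continuous hb
          (𝓕 f : Lp ℂ 2 (volume : Measure R3)) t)
    · have hs := (h.growth r).sub (h.growth t)
      rw [← map_sub, dualMult_sub (h.growth r) (h.growth t) hs fun ξ => rfl]
      exact norm_apply_dualMult_le hs (K := K + K)
        (fun ξ => (norm_sub_le _ _).trans (add_le_add (hb r ξ) (hb t ξ))) f φ
  obtain ⟨N₁, hN₁, hT₁, hB₁⟩ := step h₁ f
  obtain ⟨N₂, hN₂, hT₂, hB₂⟩ := step h₂ g
  have hlim : Tendsto (fun r => ENNReal.ofReal (N₁ r + N₂ r)) (𝓝 t) (𝓝 0) := by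
    simpa using ENNReal.tendsto_ofReal (hT₁.add hT₂)
  refine tendsto_of_tendsto_of_tendsto_of_le_of_le tendsto_const_nhds hlim
    (fun _ => zero_le) fun r => ?_
  refine sobolevNorm_le_of_forall (add_nonneg (hN₁ r) (hN₂ r)) fun φ => ?_
  rw [map_sub, sub_apply, hu, hu, add_sub_add_comm, add_mul]
  exact (norm_add_le _ _).trans (add_le_add (hB₁ r φ) (hB₂ r φ))

end Bounded

/-- After conjugation with ⟨∇⟩ all symbols are bounded and continuous in time, which yields finite
energy and norm continuity. The equations are the derivatives of cos(tω), ω⁻¹ sin(tω) and -ω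
sin(tω). -/
theorem isFreeSolution_propagator (hm : 0 < m) {Ψ : Phase} (hΨ : Ψ ∈ energySpace 0) :
    IsFreeSolution m fun t => propagator m t Ψ := by
  have h1 : sobolevNorm 1 0 Ψ.1 < ∞ := lt_of_le_of_lt le_self_add hΨ
  have h2 : sobolevNorm 0 0 Ψ.2 < ∞ := lt_of_le_of_lt le_add_self hΨ
  obtain ⟨f, hf, -⟩ := exists_eq_of_sobolevNorm_lt_top h1
  obtain ⟨g, hg, -⟩ := exists_eq_of_sobolevNorm_lt_top h2
  have b0 := bddSymbolPath_cos hm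
  have b1 := bddSymbolPath_sin (α := fun w => unitDisp m w * w⁻¹) hm (hasTemperateGrowth_unitDisp_mul_inv hm)
    (bddDerivOn_unitDisp_mul_inv hm 0)
  have b2 := bddSymbolPath_sin (α := fun w => -(w * (unitDisp m w)⁻¹)) hm (hasTemperateGrowth_neg_mul_inv_unitDisp hm)
    (bddDerivOn_inv_unitDisp_and hm 0).2.neg
  have u1 := fun t φ => weightedBessel_propagator_fst hm hf hg 0 t φ
  have u2 := fun t φ => weightedBessel_propagator_snd hm hf hg 0 t φ
  simp only [neg_zero, smulLeft_weight_zero] at u1 u2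
  refine ⟨fun t => ENNReal.add_lt_top.2
    ⟨sobolevNorm_lt_top_of_bddSymbolPath b0 b1 u1 t,
      sobolevNorm_lt_top_of_bddSymbolPath b2 b0 u2 t⟩, fun t => ?_, fun t φ => ?_, fun t φ => ?_⟩
  · simpa [energyNorm] using (tendsto_sobolevNorm_sub_of_bddSymbolPath b0 b1 u1 t).add
      (tendsto_sobolevNorm_sub_of_bddSymbolPath b2 b0 u2 t)
  · rw [freeHamiltonian_fst_apply]
    exact ((symbolPath_cos hm).hasDerivAt_apply h1 φ t).add
      ((symbolPath_sinc hm).hasDerivAt_apply h2 φ t)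
  · have hq := hasTemperateGrowth_neg_sq_omega hm
    rw [freeHamiltonian_snd_apply hm, propagator_fst_apply,
      dualMult_dualMult (hasTemperateGrowth_cosSymbol hm t) hq ((symbolPath_sin hm).growth_deriv t)
        fun ξ => ?_,
      dualMult_dualMult (hasTemperateGrowth_sinSymbol hm (hasTemperateGrowth_inv_omega hm) t) hq
        ((symbolPath_cos hm).growth_deriv t) fun ξ => ?_]
    · exact ((symbolPath_sin hm).hasDerivAt_apply h1 φ t).add
        ((symbolPath_cos hm).hasDerivAt_apply h2 φ t)
    · have := (omega_pos hm ξ).ne'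
      rw [sinSymbol, sinSymbol, ← Complex.ofReal_mul]
      congr 1
      field_simp
    · rw [cosSymbol, negSqCosSymbol, ← Complex.ofReal_mul]
      congr 1
      ring

/-- `H^1` embeds into `L²`. -/
theorem sobolevNorm_zero_le_one (u : Dist) : sobolevNorm 0 0 u ≤ sobolevNorm 1 0 u := by
  rcases eq_or_ne (sobolevNorm 1 0 u) ∞ with h | h
  · rw [h]; exact le_top
  obtain ⟨f, hf, hn⟩ := exists_eq_of_sobolevNorm_lt_top h.lt_top
  rw [hn, ← ofReal_norm]
  have hB := hasTemperateGrowth_besselSymbol (-1)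
  refine sobolevNorm_le_of_forall (norm_nonneg _) fun φ => ?_
  rw [weightedBessel_apply, smulLeft_weight_zero,
    apply_dualMult_of_weightedBessel_eq hf (hasTemperateGrowth_besselSymbol 0) hB
      (fun ξ => by rw [besselSymbol_zero, mul_one]), neg_zero, smulLeft_weight_zero]
  refine (norm_toTemperedDistribution_apply_le f _).trans ?_
  gcongr
  rw [← one_mul (l2norm φ)]
  refine l2norm_dualMult_le hB (fun ξ => ?_) φ
  rw [besselSymbol, Complex.norm_real, Real.norm_of_nonneg (by positivity)]
  exact Real.rpow_le_one_of_one_le_of_nonpos (by nlinarith [sq_nonneg ‖(2 * Real.pi) • ξ‖])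
    (by norm_num)

theorem dualMult_neg {a : R3 → ℂ} (ha : a.HasTemperateGrowth) (φ : 𝓢(R3, ℂ)) :
    dualMult (-a) φ = -dualMult a φ := by
  have := dualMult_sub (Function.HasTemperateGrowth.const (0 : ℂ)) ha ha.neg (fun ξ => by simp) φ
  rw [dualMult_const, zero_smul, zero_sub] at this
  exact this.symm

/-- Uniqueness of the solution, by duality. -/
theorem IsFreeSolution.eq_propagator (hm : 0 < m) {Ψ : ℝ → Phase} (h : IsFreeSolution m Ψ)
    (T : ℝ) : Ψ T = propagator m T (Ψ 0) := by
  -- For uniqueness the L² topology is enough in both components, because all spatial derivatives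
  -- are carried by the test functions.
  have hmem1 : ∀ t, sobolevNorm 0 0 (Ψ t).1 < ∞ := fun t =>
    lt_of_le_of_lt ((sobolevNorm_zero_le_one _).trans le_self_add) (h.mem t)
  have hmem2 : ∀ t, sobolevNorm 0 0 (Ψ t).2 < ∞ := fun t => lt_of_le_of_lt le_add_self (h.mem t)
  have hc1 : ∀ t, Tendsto (fun s => sobolevNorm 0 0 ((Ψ s).1 - (Ψ t).1)) (𝓝 t) (𝓝 0) := fun t =>
    tendsto_of_tendsto_of_tendsto_of_le_of_le tendsto_const_nhds (h.continuous t)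
      (fun _ => zero_le) fun s => (sobolevNorm_zero_le_one _).trans le_self_add
  have hc2 : ∀ t, Tendsto (fun s => sobolevNorm 0 0 ((Ψ s).2 - (Ψ t).2)) (𝓝 t) (𝓝 0) := fun t =>
    tendsto_of_tendsto_of_tendsto_of_le_of_le tendsto_const_nhds (h.continuous t)
      (fun _ => zero_le) fun s => le_add_self
  have hfst : ∀ T, (Ψ T).1 = (propagator m T (Ψ 0)).1 := by
    intro T
    ext φ
    -- The solution is evolved to time s and the test function backwards over T - s. The value at s
    -- = T is that of the solution, the value at s = 0 that of the propagator.
    set E : ℝ → ℂ := fun s => (Ψ s).1 (dualMult (cosSymbol m (T - s)) φ) +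
      (Ψ s).2 (dualMult (sinSymbol m (fun w => w⁻¹) (T - s)) φ) with hE
    have hq := hasTemperateGrowth_neg_sq_omega hm
    have hder : ∀ t, HasDerivAt E 0 t := by
      intro t
      have d1 := h.equation_fst t (dualMult (cosSymbol m (T - t)) φ)
      rw [freeHamiltonian_fst_apply] at d1
      have d2 := h.equation_snd t (dualMult (sinSymbol m (fun w => w⁻¹) (T - t)) φ)
      rw [freeHamiltonian_snd_apply hm, dualMult_dualMult hq
        (hasTemperateGrowth_sinSymbol hm (hasTemperateGrowth_inv_omega hm) (T - t))
        ((symbolPath_cos hm).growth_deriv (T - t)) fun ξ => ?_] at d2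
      · have p1 := ((symbolPath_cos hm).comp_const_sub T).hasDerivAt_pairing
          (u := fun s => (Ψ s).1) (hmem1 t) (hc1 t) φ d1
        have p2 := ((symbolPath_sinc hm).comp_const_sub T).hasDerivAt_pairing
          (u := fun s => (Ψ s).2) (hmem2 t) (hc2 t) φ d2
        refine (p1.add p2).congr_deriv ?_
        rw [dualMult_neg ((symbolPath_cos hm).growth_deriv _),
          dualMult_neg ((symbolPath_sinc hm).growth_deriv _), map_neg, map_neg]
        ring
      · have := (omega_pos hm ξ).ne'
        rw [sinSymbol, sinSymbol, ← Complex.ofReal_mul]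
        congr 1
        field_simp
    have hconst := is_const_of_deriv_eq_zero (fun t => (hder t).differentiableAt)
      (fun t => (hder t).deriv) T 0
    simp only [hE, sub_self, sub_zero, dualMult_cosSymbol_zero, dualMult_sinSymbol_zero, map_zero,
      add_zero] at hconst
    rw [hconst, propagator_fst_apply]
  -- The first equation identifies the second component as the time derivative of the first, so no
  -- further duality argument is needed.
  refine Prod.ext (hfst T) ?_
  ext φ
  have d1 := h.equation_fst T φ
  have d2 := (isFreeSolution_propagator hm (h.mem 0)).equation_fst T φ
  rw [freeHamiltonian_fst_apply] at d1 d2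
  simp only [← hfst] at d2
  exact d1.unique d2

end Propagator

/-! ### Weighted decay of the propagator -/

section Decay

variable {m : ℝ}

/-- Weighted spaces of positive order embed into the unweighted one. -/
theorem sobolevNorm_zero_weight_le {σ : ℝ} (hσ : 0 ≤ σ) (s : ℝ) (u : Dist) :
    sobolevNorm s 0 u ≤ sobolevNorm s σ u := by
  rcases eq_or_ne (sobolevNorm s σ u) ∞ with h | h
  · rw [h]; exact le_top
  obtain ⟨f, hf, hn⟩ := exists_eq_of_sobolevNorm_lt_top h.lt_top
  rw [hn, ← ofReal_norm]
  refine sobolevNorm_le_of_forall (norm_nonneg _) fun φ => ?_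
  rw [weightedBessel_apply, smulLeft_weight_zero,
    apply_dualMult_of_weightedBessel_eq hf (hasTemperateGrowth_besselSymbol s)
      (Function.HasTemperateGrowth.const (1 : ℂ)) (besselSymbol_neg_mul s), dualMult_const, one_smul]
  refine (norm_toTemperedDistribution_apply_le f _).trans ?_
  gcongr
  rw [l2norm_eq_weightedNorm_zero φ]
  exact weightedNorm_mono (by linarith) φ

theorem energyNorm_zero_le {σ : ℝ} (hσ : 0 ≤ σ) (Ψ : Phase) : energyNorm 0 Ψ ≤ energyNorm σ Ψ :=
  add_le_add (sobolevNorm_zero_weight_le hσ 1 Ψ.1) (sobolevNorm_zero_weight_le hσ 0 Ψ.2)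

/-- The multiplication formula for the Fourier transform brings the weighted multiplier into the
shape of `form`. -/
theorem integral_mul_smulLeft_dualMult {e : R3 → ℂ} (he : e.HasTemperateGrowth) (σ : ℝ)
    (χ φ : 𝓢(R3, ℂ)) :
    ∫ x, χ x * SchwartzMap.smulLeftCLM ℂ (weight σ) (dualMult e φ) x =
      ∫ ξ, e ξ * (𝓕⁻ φ ξ * 𝓕 (SchwartzMap.smulLeftCLM ℂ (weight σ) χ) ξ) := by
  have h1 : ∫ x, χ x * SchwartzMap.smulLeftCLM ℂ (weight σ) (dualMult e φ) x =
      ∫ x, SchwartzMap.smulLeftCLM ℂ (weight σ) χ x *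
        𝓕 (SchwartzMap.smulLeftCLM ℂ e (𝓕⁻ φ)) x := by
    refine integral_congr_ae (Eventually.of_forall fun x => ?_)
    simp only [SchwartzMap.smulLeftCLM_apply_apply (hasTemperateGrowth_weight σ), smul_eq_mul,
      dualMult]
    ring
  rw [h1, ← SchwartzMap.integral_fourier_mul_eq]
  refine integral_congr_ae (Eventually.of_forall fun ξ => ?_)
  simp only [SchwartzMap.smulLeftCLM_apply_apply he, smul_eq_mul]
  ring

/-- By L² duality a bound for the bilinear form is an operator bound for the multiplier placed
between two weights. -/
theorem l2norm_smulLeft_dualMult_le {e : R3 → ℂ} (he : e.HasTemperateGrowth) {σ K : ℝ}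
    (hK : 0 ≤ K)
    (h : ∀ φ χ : 𝓢(R3, ℂ), ‖∫ ξ, e ξ * (𝓕⁻ (SchwartzMap.smulLeftCLM ℂ (weight σ) φ) ξ *
      𝓕 (SchwartzMap.smulLeftCLM ℂ (weight σ) χ) ξ)‖ ≤ K * (l2norm φ * l2norm χ))
    (φ : 𝓢(R3, ℂ)) :
    l2norm (SchwartzMap.smulLeftCLM ℂ (weight σ)
      (dualMult e (SchwartzMap.smulLeftCLM ℂ (weight σ) φ))) ≤ K * l2norm φ := by
  refine l2norm_le_of_forall (mul_nonneg hK (l2norm_nonneg _)) fun χ => ?_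
  rw [integral_mul_smulLeft_dualMult he, mul_assoc]
  exact h φ χ

/-- Euler's formula; this is why the form must be controlled for both signs of t. -/
theorem integral_cosSymbol (m t : ℝ) (f g : 𝓢(R3, ℂ)) :
    ∫ ξ, cosSymbol m t ξ * (𝓕⁻ f ξ * 𝓕 g ξ) =
      (form m t (fun _ => 1) f g + form m (-t) (fun _ => 1) f g) / 2 := by
  have hc : BddPartials 0 fun _ : R3 => (1 : ℝ) := BddPartials.const 1
  rw [form, form, ← integral_add (integrable_form m t hc _ _) (integrable_form m (-t) hc _ _),
    ← integral_div]
  refine integral_congr_ae (Eventually.of_forall fun ξ => ?_)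
  simp only [cosSymbol, phase, Complex.ofReal_cos, Complex.cos]
  push_cast
  ring_nf

theorem integral_sinSymbol (hm : 0 < m) {α : ℝ → ℝ} (hα : BddDerivOn m 0 α) (t : ℝ)
    (f g : 𝓢(R3, ℂ)) :
    ∫ ξ, sinSymbol m α t ξ * (𝓕⁻ f ξ * 𝓕 g ξ) =
      (form m (-t) (fun ξ => α (omega m ξ)) f g - form m t (fun ξ => α (omega m ξ)) f g) *
        (Complex.I / 2) := by
  have hc := BddPartials.comp_omega hm hα
  rw [form, form, ← integral_sub (integrable_form m (-t) hc _ _) (integrable_form m t hc _ _),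
    ← integral_mul_const]
  refine integral_congr_ae (Eventually.of_forall fun ξ => ?_)
  simp only [sinSymbol, phase, Complex.ofReal_mul, Complex.ofReal_sin, Complex.sin]
  push_cast
  ring_nf

theorem norm_integral_cosSymbol_le (hm : 0 < m) {σ : ℝ} (hσ : 3 / 2 < σ) :
    ∃ C, 0 ≤ C ∧ ∀ (t : ℝ) (φ χ : 𝓢(R3, ℂ)),
      ‖∫ ξ, cosSymbol m t ξ * (𝓕⁻ (SchwartzMap.smulLeftCLM ℂ (weight (-σ)) φ) ξ *
        𝓕 (SchwartzMap.smulLeftCLM ℂ (weight (-σ)) χ) ξ)‖ ≤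
        C / (1 + |t|) ^ (3 / 2 : ℝ) * (l2norm φ * l2norm χ) := by
  obtain ⟨C, hC0, hC⟩ := norm_form_decay hm (BddDerivOn.const 1) hσ
  refine ⟨C, hC0, fun t φ χ => ?_⟩
  have h1 := hC t φ χ
  have h2 := hC (-t) φ χ
  rw [abs_neg] at h2
  rw [integral_cosSymbol, norm_div, Complex.norm_ofNat]
  have := norm_add_le (form m t (fun _ => 1) (SchwartzMap.smulLeftCLM ℂ (weight (-σ)) φ)
    (SchwartzMap.smulLeftCLM ℂ (weight (-σ)) χ)) (form m (-t) (fun _ => 1)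
    (SchwartzMap.smulLeftCLM ℂ (weight (-σ)) φ) (SchwartzMap.smulLeftCLM ℂ (weight (-σ)) χ))
  linarith

theorem norm_integral_sinSymbol_le (hm : 0 < m) {α : ℝ → ℝ} (hα : BddDerivOn m 2 α) {σ : ℝ}
    (hσ : 3 / 2 < σ) :
    ∃ C, 0 ≤ C ∧ ∀ (t : ℝ) (φ χ : 𝓢(R3, ℂ)),
      ‖∫ ξ, sinSymbol m α t ξ * (𝓕⁻ (SchwartzMap.smulLeftCLM ℂ (weight (-σ)) φ) ξ *
        𝓕 (SchwartzMap.smulLeftCLM ℂ (weight (-σ)) χ) ξ)‖ ≤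
        C / (1 + |t|) ^ (3 / 2 : ℝ) * (l2norm φ * l2norm χ) := by
  obtain ⟨C, hC0, hC⟩ := norm_form_decay hm hα hσ
  refine ⟨C, hC0, fun t φ χ => ?_⟩
  have h1 := hC t φ χ
  have h2 := hC (-t) φ χ
  rw [abs_neg] at h2
  rw [integral_sinSymbol hm hα.of_succ.of_succ, norm_mul, norm_div, Complex.norm_ofNat,
    Complex.norm_I]
  have := norm_sub_le (form m (-t) (fun ξ => α (omega m ξ))
    (SchwartzMap.smulLeftCLM ℂ (weight (-σ)) φ) (SchwartzMap.smulLeftCLM ℂ (weight (-σ)) χ))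
    (form m t (fun ξ => α (omega m ξ)) (SchwartzMap.smulLeftCLM ℂ (weight (-σ)) φ)
      (SchwartzMap.smulLeftCLM ℂ (weight (-σ)) χ))
  linarith

/-- After conjugation the propagator is a 2 × 2 matrix with the entries cos(tω), (ω₁/ω) sin(tω),
-(ω/ω₁) sin(tω), cos(tω), each between two weights ⟨x⟩^(-σ). Each entry decays at the required rate.
-/
theorem energyNorm_propagator_le (hm : 0 < m) {σ : ℝ} (hσ : 3 / 2 < σ) :
    ∃ C : ℝ, 0 < C ∧ ∀ Ψ ∈ energySpace σ, ∀ t : ℝ, energyNorm (-σ) (propagator m t Ψ) ≤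
      ENNReal.ofReal (C / (1 + |t|) ^ (3 / 2 : ℝ)) * energyNorm σ Ψ := by
  have hα₁ := bddDerivOn_unitDisp_mul_inv hm 2
  have hα₂ := (bddDerivOn_inv_unitDisp_and hm 2).2.neg
  obtain ⟨A, hA0, hA⟩ := norm_integral_cosSymbol_le hm hσ
  obtain ⟨B, hB0, hB⟩ := norm_integral_sinSymbol_le hm hα₁ hσ
  obtain ⟨D, hD0, hD⟩ := norm_integral_sinSymbol_le hm hα₂ hσ
  -- The summand 1 makes the constant positive, as A, B and D are only known to be nonnegative.
  refine ⟨A + B + D + 1, by positivity, fun Ψ hΨ t => ?_⟩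
  obtain ⟨f, hf, hfn⟩ := exists_eq_of_sobolevNorm_lt_top (lt_of_le_of_lt le_self_add hΨ)
  obtain ⟨g, hg, hgn⟩ := exists_eq_of_sobolevNorm_lt_top (lt_of_le_of_lt le_add_self hΨ)
  set T := (1 + |t|) ^ (3 / 2 : ℝ) with hT
  have hT0 : 0 < T := by positivity
  have kA := l2norm_smulLeft_dualMult_le (hasTemperateGrowth_cosSymbol hm t)
    (div_nonneg hA0 hT0.le) (hA t)
  have kB := l2norm_smulLeft_dualMult_le (hasTemperateGrowth_sinSymbol
    (α := fun w => unitDisp m w * w⁻¹) hm (hasTemperateGrowth_unitDisp_mul_inv hm) t)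
    (div_nonneg hB0 hT0.le) (hB t)
  have kD := l2norm_smulLeft_dualMult_le (hasTemperateGrowth_sinSymbol
    (α := fun w => -(w * (unitDisp m w)⁻¹)) hm (hasTemperateGrowth_neg_mul_inv_unitDisp hm) t)
    (div_nonneg hD0 hT0.le) (hD t)
  have n1 : sobolevNorm 1 (-σ) (propagator m t Ψ).1 ≤
      ENNReal.ofReal (‖f‖ * (A / T) + ‖g‖ * (B / T)) := by
    refine sobolevNorm_le_of_forall (by positivity) fun φ => ?_
    rw [weightedBessel_propagator_fst hm hf hg]
    calc _ ≤ ‖f‖ * (A / T * l2norm φ) + ‖g‖ * (B / T * l2norm φ) :=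
          (norm_add_le _ _).trans (add_le_add
            ((norm_toTemperedDistribution_apply_le f _).trans (by gcongr; exact kA φ))
            ((norm_toTemperedDistribution_apply_le g _).trans (by gcongr; exact kB φ)))
      _ = _ := by ring
  have n2 : sobolevNorm 0 (-σ) (propagator m t Ψ).2 ≤
      ENNReal.ofReal (‖f‖ * (D / T) + ‖g‖ * (A / T)) := by
    refine sobolevNorm_le_of_forall (by positivity) fun φ => ?_
    rw [weightedBessel_propagator_snd hm hf hg]
    calc _ ≤ ‖f‖ * (D / T * l2norm φ) + ‖g‖ * (A / T * l2norm φ) :=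
          (norm_add_le _ _).trans (add_le_add
            ((norm_toTemperedDistribution_apply_le f _).trans (by gcongr; exact kD φ))
            ((norm_toTemperedDistribution_apply_le g _).trans (by gcongr; exact kA φ)))
      _ = _ := by ring
  have e : energyNorm σ Ψ = ENNReal.ofReal (‖f‖ + ‖g‖) := by
    rw [energyNorm, hfn, hgn, ← ofReal_norm, ← ofReal_norm,
      ENNReal.ofReal_add (norm_nonneg _) (norm_nonneg _)]
  rw [e, ← ENNReal.ofReal_mul (by positivity)]
  refine (add_le_add n1 n2).trans ?_
  rw [← ENNReal.ofReal_add (by positivity) (by positivity)]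
  refine ENNReal.ofReal_le_ofReal ?_
  have hf0 := norm_nonneg f
  have hg0 := norm_nonneg g
  calc _ = ((A + D) * ‖f‖ + (A + B) * ‖g‖) / T := by ring
    _ ≤ ((A + B + D + 1) * ‖f‖ + (A + B + D + 1) * ‖g‖) / T := by
      have h1 : A + D ≤ A + B + D + 1 := by linarith
      have h2 : A + B ≤ A + B + D + 1 := by linarith
      gcongr
    _ = _ := by ring

end Decay

end KleinGordon

end

theorem proposition2p1 (m : ℝ) (hm : 0 < m) :
    -- the group `𝓤₀(t)`: `𝓤₀(t)Ψ₀` is the value at `t` of the unique solution starting at `Ψ₀`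
    (∀ Ψ₀ ∈ KleinGordon.energySpace 0,
      ∃! Ψ : ℝ → KleinGordon.Phase, KleinGordon.IsFreeSolution m Ψ ∧ Ψ 0 = Ψ₀) ∧
    -- the decay of `𝓤₀(t)Ψ₀`
    ∀ σ : ℝ, 3 / 2 < σ → ∃ C : ℝ, 0 < C ∧
      ∀ Ψ₀ ∈ KleinGordon.energySpace σ, Ψ₀ ∈ KleinGordon.energySpace 0 ∧
        ∀ Ψ : ℝ → KleinGordon.Phase, KleinGordon.IsFreeSolution m Ψ → Ψ 0 = Ψ₀ →
          ∀ t : ℝ, KleinGordon.energyNorm (-σ) (Ψ t) ≤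
            ENNReal.ofReal (C / (1 + |t|) ^ (3 / 2 : ℝ)) * KleinGordon.energyNorm σ Ψ₀ := by
  refine ⟨fun Ψ₀ h₀ => ⟨fun t => KleinGordon.propagator m t Ψ₀,
    ⟨KleinGordon.isFreeSolution_propagator hm h₀, KleinGordon.propagator_zero m Ψ₀⟩,
    fun Ψ hΨ => funext fun t => ?_⟩, fun σ hσ => ?_⟩
  · rw [hΨ.1.eq_propagator hm t, hΨ.2]
  · obtain ⟨C, hC, h⟩ := KleinGordon.energyNorm_propagator_le hm hσ
    refine ⟨C, hC, fun Ψ₀ h₀ => ⟨lt_of_le_of_lt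
      (KleinGordon.energyNorm_zero_le (by linarith) Ψ₀) h₀, fun Ψ hΨ hΨ₀ t => ?_⟩⟩
    rw [hΨ.eq_propagator hm t, hΨ₀]
    exact h Ψ₀ h₀ t
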